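/- **Setting.** There are $M$ unobserved types, $J$ firms, $T\ge 1$ periods, a finite state space $\mathcal X$ and a finite action set $\mathcal A$. For one type, $\theta\in\Theta\subseteq\mathbb R^{d}$ is the structural parameter, $Y\in\mathcal Y\subseteq\mathbb R^{n}$ the nuisance vector and $P=(P_j(a|x))_{j,x,a}\in\mathcal P\subseteq\mathbb R^{J|\mathcal X||\mathcal A|}$ the vector of conditional choice probabilities (CCPs); all maps below are regarded as functions of the full vector $P$ on a set $\mathcal P$ with nonempty interior (a map given only on CCPs is extended by normalising $P$). Given are a map $G(\theta,\tilde\theta,Y,P)$; an inner algorithm $\Gamma^q(\theta,\tilde\theta,P;Y)$ ($1\le q\le\infty$) for the equation $Y=G(\theta,\tilde\theta,Y,P)$; and choice-specific values $v_j(x,a;\theta,Y,P)$ with the logit CCP map $\Lambda_j(\theta,Y,P)(a|x)=e^{v_j(x,a;\theta,Y,P)}/\sum_{a'}e^{v_j(x,a';\theta,Y,P)}$. Put $\Lambda^q(\theta,\tilde\theta,Y,P)=\Lambda(\theta,\Gamma^q(\theta,\tilde\theta,P;Y),P)$. Boldface denotes stacking over types $m=1,\dots,M$; maps act type by type. *Data.*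 $s^*=(\boldsymbol\pi^*,\boldsymbol\theta^*,\mathbf Y^*,\mathbf P^*)$ are the true values: $\pi^*_m>0$, $\sum_m\pi^*_m=1$; $\theta^{m*},Y^{m*},P^{m*}$ are interior points of $\Theta,\mathcal Y,\mathcal P$; $Y^{m*}=G(\theta^{m*},\theta^{m*},Y^{m*},P^{m*})$ and $P^{m*}=\Lambda(\theta^{m*},Y^{m*},P^{m*})$. Markets $i=1,2,\dots$ are i.i.d.; a record $z=(x_t,(a_{jt})_j)_{t\le T}$ has probability $\sum_m\pi^*_m\,p_0(x_1)\prod_{t<T}f_x(x_{t+1}|x_t,a_t)\prod_{t,j}P^{m*}_j(a_{jt}|x_t)$, where the initial distribution $p_0$ and the transition probabilities $f_x$ do not depend on the type. $\mathbb E$ is expectation under this law. *Algorithm.* Let $w_{m}(\mathbf P,\boldsymbol\pi)(z)=\pi_m\prod_{t,j}P^m_j(a_{jt}|x_t)\big/\sum_{m'}\pi_{m'}\prod_{t,j}P^{m'}_j(a_{jt}|x_t)$. On a sample of $N$ markets, one iteration of EM-NPL($q$) maps $(\boldsymbol\pi,\boldsymbol\theta,\mathbf Y,\mathbf P)$ to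 any $(\boldsymbol\pi',\boldsymbol\theta',\mathbf Y',\mathbf P')$ with $\pi'_m=\frac1N\sum_i w_{m}(\mathbf P,\boldsymbol\pi)(z_i)$; $\theta'^m$ a maximiser over $\vartheta\in\Theta$ of $\sum_i w_m(\mathbf P,\boldsymbol\pi)(z_i)\sum_{t,j}\log\Lambda_j\bigl(\vartheta,\Gamma^q(\vartheta,\theta^m,P^m;Y^m),P^m\bigr)(a_{jit}|x_{it})$; $Y'^m=\Gamma^q(\theta'^m,\theta^m,P^m;Y^m)$; $P'^m=\Lambda(\theta'^m,Y'^m,P^m)$. EM-NPL is the case $q=\infty$. We say that EM-NPL($q$) *converges locally* if there is a neighbourhood $U$ of $s^*$ such that, almost surely, there are states $\hat s_N\to s^*$ such that for all large $N$: $\hat s_N\in U$ is a fixed point of the iteration, the iteration can be run from every point of $U$, and every run started in $U$ converges to $\hat s_N$. *Rate matrix.* Let $E(\boldsymbol\pi,\mathbf P)=(\mathbb E[w_m(\mathbf P,\boldsymbol\pi)])_m$ and $\ell_E^q(\boldsymbol\theta;\tilde{\boldsymbol\theta},\mathbf Y,\mathbf P,\boldsymbol\pi)=\sum_m\mathbb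 E\bigl[w_m(\mathbf P,\boldsymbol\pi)\sum_{t,j}\log\Lambda^q_j(\theta^m,\tilde\theta^m,Y^m,P^m)(a_{jt}|x_t)\bigr]$. Subscripts denote Jacobian matrices at $s^*$ (with $\boldsymbol\theta=\tilde{\boldsymbol\theta}=\boldsymbol\theta^*$), and $H^q_u=-(\nabla^2_{\boldsymbol\theta\boldsymbol\theta}\ell^q_E)^{-1}\nabla^2_{\boldsymbol\theta u}\ell^q_E$ for $u\in\{\boldsymbol\pi,\tilde{\boldsymbol\theta},\mathbf Y,\mathbf P\}$. Then $$R^q=\begin{pmatrix}E_{\boldsymbol\pi}&0&0&E_{\mathbf P}\\ H^q_{\boldsymbol\pi}&H^q_{\tilde{\boldsymbol\theta}}&H^q_{\mathbf Y}&H^q_{\mathbf P}\\ \Gamma^q_{\boldsymbol\theta}H^q_{\boldsymbol\pi}&\Gamma^q_{\boldsymbol\theta}H^q_{\tilde{\boldsymbol\theta}}+\Gamma^q_{\tilde{\boldsymbol\theta}}&\Gamma^q_{\boldsymbol\theta}H^q_{\mathbf Y}+\Gamma^q_{\mathbf Y}&\Gamma^q_{\boldsymbol\theta}H^q_{\mathbf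 P}+\Gamma^q_{\mathbf P}\\ \Lambda^q_{\boldsymbol\theta}H^q_{\boldsymbol\pi}&\Lambda^q_{\boldsymbol\theta}H^q_{\tilde{\boldsymbol\theta}}+\Lambda^q_{\tilde{\boldsymbol\theta}}&\Lambda^q_{\boldsymbol\theta}H^q_{\mathbf Y}+\Lambda^q_{\mathbf Y}&\Lambda^q_{\boldsymbol\theta}H^q_{\mathbf P}+\Lambda^q_{\mathbf P}\end{pmatrix}.$$ **Assumptions.** 1. (Fixed points) For all $\theta,\tilde\theta\in\Theta$, $P\in\mathcal P$ the equation $Y=G(\theta,\tilde\theta,Y,P)$ has a unique solution $Y(\theta,\tilde\theta,P)$ in $\mathcal Y$; for $1\le q\le\infty$, $\Gamma^q(\theta,\tilde\theta,P;\cdot)$ maps $\mathcal Y$ to $\mathcal Y$ and has the same fixed point; and $\Gamma^\infty(\theta,\tilde\theta,P;Y_0)$ solves the equation for every $Y_0\in\mathcal Y$. 2. (Regularity, for every $1\le q\le\infty$) $\Theta$ is compact; $\Gamma^q$ and $v$ are three times continuously differentiable on $\Theta\times\Theta\times\mathcal P\times\mathcal Y$ and $\Theta\times\mathcal Y\times\mathcal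 P$; for $(\tilde{\boldsymbol\theta},\mathbf Y,\mathbf P)$ near $(\boldsymbol\theta^*,\mathbf Y^*,\mathbf P^*)$ the maximiser over $\Theta^M\times\Delta^{M-1}$ of $(\boldsymbol\theta,\boldsymbol\pi)\mapsto\mathbb E\bigl[\log\sum_m\pi_m\prod_{t,j}\Lambda^q_j(\theta^m,\tilde\theta^m,Y^m,P^m)(a_{jt}|x_t)\bigr]$ is unique up to label permutation; and $\nabla^2_{\boldsymbol\theta\boldsymbol\theta}\ell^q_E$ is nonsingular at $s^*$. 3. (Approximation error) There is $f(q)\to0$ such that for every $m$ there is a neighbourhood of $(\theta^{m*},\theta^{m*},P^{m*},Y^{m*})$ on which $\|Y(\theta,\tilde\theta,P)-\Gamma^q(\theta,\tilde\theta,P;Y)\|_2\le\|Y(\theta,\tilde\theta,P)-Y\|_2\,f(q)$ for all finite $q\ge1$. 4. (Gradient bound) $Y(\theta,\tilde\theta,P)$ is continuously differentiable, and $\|\nabla_\theta\Gamma^q(\theta^{m*},\theta^{m*},P^{m*};Y^{m*})\|_F\le C$ for all $m$ and all $1\le q\le\infty$, with a constant $C<\infty$. **Theorem (Local Convergence for Sufficient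 $q$).** Under these assumptions, suppose that the spectral radius satisfies $\rho(R^\infty)<1$. Then $\|R^q-R^\infty\|_F=O(f(q))$ as $q\to\infty$, and for all sufficiently large $q$ one has $\rho(R^q)<1$ and the EM-NPL($q$) algorithm converges locally. -/

import Mathlib

open Filter Topology MeasureTheory ProbabilityTheory

noncomputable section

namespace EMNPL

/-! ### Jacobians, Hessian blocks, norms, spectral radius -/

/-- Jacobian matrix of `f` at `x`. -/
def jac {ι κ : Type*} [Fintype ι] [DecidableEq ι] [Fintype κ]
    (f : (ι → ℝ) → (κ → ℝ)) (x : ι → ℝ) : Matrix κ ι ℝ :=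
  LinearMap.toMatrix' (fderiv ℝ f x).toLinearMap

/-- Gradient (vector of partial derivatives) of `f` at `x`. -/
def grad {ι : Type*} [Fintype ι] [DecidableEq ι] (f : (ι → ℝ) → ℝ) (x : ι → ℝ) : ι → ℝ :=
  fun i => fderiv ℝ f x (Pi.single i 1)

/-- The block of second derivatives `∂²F/∂θ∂y` at `(θ, y)`; rows are indexed by `θ`. -/
def crossHess {ι κ : Type*} [Fintype ι] [DecidableEq ι] [Fintype κ] [DecidableEq κ]
    (F : (ι → ℝ) → (κ → ℝ) → ℝ) (θ : ι → ℝ) (y : κ → ℝ) : Matrix ι κ ℝ :=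
  jac (fun y' => grad (fun θ' => F θ' y') θ) y

/-- The Hessian matrix of `F`. -/
def hess {ι : Type*} [Fintype ι] [DecidableEq ι] (F : (ι → ℝ) → ℝ) (θ : ι → ℝ) :
    Matrix ι ι ℝ :=
  jac (fun θ' => grad F θ') θ

/-- Frobenius norm of a real matrix. -/
def frob {ι κ : Type*} [Fintype ι] [Fintype κ] (A : Matrix ι κ ℝ) : ℝ :=
  Real.sqrt (∑ i, ∑ j, A i j ^ 2)

/-- Euclidean norm of a real vector. -/
def norm2 {ι : Type*} [Fintype ι] (y : ι → ℝ) : ℝ :=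
  Real.sqrt (∑ i, y i ^ 2)

/-- Spectral radius of a real square matrix: the largest modulus of its complex eigenvalues. -/
def specRad {ι : Type*} [Fintype ι] (A : Matrix ι ι ℝ) : ENNReal := by
  classical
  exact spectralRadius ℂ (A.map (fun r : ℝ => (r : ℂ)))

/-- The block of type `m` of a vector stacked over types. -/
def blk {M : ℕ} {ι : Type*} (u : Fin M × ι → ℝ) (m : Fin M) : ι → ℝ :=
  fun i => u (m, i)

/-! ### Observations, states and primitives -/

/-- The record `(x_t, (a_{jt})_j)_t` of one market: `T` periods, `J` firms. -/
abbrev Obs (J T : ℕ) (X A : Type*) : Type _ := Fin T → X × (Fin J → A)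

/-- A state `(π, θ, Y, P)` of the algorithm, stacked over the `M` types.  A CCP profile of one
type is the vector of all `P_j(a|x)`, indexed by `(j, x, a)`. -/
abbrev State (M J d n : ℕ) (X A : Type*) : Type _ :=
  (Fin M → ℝ) × (Fin M × Fin d → ℝ) × (Fin M × Fin n → ℝ) × (Fin M × (Fin J × X × A) → ℝ)

/-- The primitives of the estimation problem (no property is imposed here). -/
structure Setup (J d n : ℕ) (X A : Type*) where
  /-- parameter space of one type -/
  Θ : Set (Fin d → ℝ)
  /-- space of nuisance vectors of one type -/
  YSp : Set (Fin n → ℝ)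
  /-- space of CCP vectors of one type on which the maps are considered -/
  PSp : Set (Fin J × X × A → ℝ)
  /-- fixed-point map `G(θ, θ̃, Y, P)` -/
  G : (Fin d → ℝ) → (Fin d → ℝ) → (Fin n → ℝ) → (Fin J × X × A → ℝ) → (Fin n → ℝ)
  /-- inner algorithm `Γ^q(θ, θ̃, P; Y)`, `q ≤ ∞` -/
  Γ : ℕ∞ → (Fin d → ℝ) → (Fin d → ℝ) → (Fin J × X × A → ℝ) → (Fin n → ℝ) → (Fin n → ℝ)
  /-- choice-specific values `v_j(x, a; θ, Y, P)` -/
  v : (Fin d → ℝ) → (Fin n → ℝ) → (Fin J × X × A → ℝ) → (Fin J × X × A → ℝ)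
  /-- distribution of the first observed state -/
  initDist : X → ℝ
  /-- transition probabilities `f_x(x' | x, a)`, common across types -/
  transProb : X → (Fin J → A) → X → ℝ

namespace Setup

section OneType

variable {J d n T : ℕ} {X A : Type*} [Fintype X] [Fintype A]

/-- The CCP map `Λ_j(θ, Y, P)(a|x)`: logit of the choice-specific values. -/
def Lam (S : Setup J d n X A) (θ : Fin d → ℝ) (Y : Fin n → ℝ) (P : Fin J × X × A → ℝ) :
    Fin J × X × A → ℝ :=
  fun c => Real.exp (S.v θ Y P c) / ∑ a : A, Real.exp (S.v θ Y P (c.1, c.2.1, a))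

/-- The exact solution `Y(θ, θ̃, P)` of `Y = G(θ, θ̃, Y, P)`. -/
def exactSol (S : Setup J d n X A) (θ θt : Fin d → ℝ) (P : Fin J × X × A → ℝ) : Fin n → ℝ :=
  Classical.epsilon (fun Y => Y ∈ S.YSp ∧ Y = S.G θ θt Y P)

/-- `∏_t ∏_j P_j(a_{jt} | x_t)`. -/
def lik (P : Fin J × X × A → ℝ) (z : Obs J T X A) : ℝ :=
  ∏ t, ∏ j, P (j, (z t).1, (z t).2 j)

/-- `∑_t ∑_j log Λ_j(ϑ, Γ^q(ϑ, θ̃, P; Y), P)(a_{jt} | x_t)`. -/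
def logLik (S : Setup J d n X A) (q : ℕ∞) (θt : Fin d → ℝ) (Y : Fin n → ℝ)
    (P : Fin J × X × A → ℝ) (ϑ : Fin d → ℝ) (z : Obs J T X A) : ℝ :=
  ∑ t, ∑ j, Real.log (S.Lam ϑ (S.Γ q ϑ θt P Y) P (j, (z t).1, (z t).2 j))

/-- The type-independent part of the probability of a record: first state and transitions. -/
def pathProb [NeZero T] (S : Setup J d n X A) (z : Obs J T X A) : ℝ :=
  S.initDist (z 0).1 *
    ∏ t : Fin T, if h : t.1 + 1 < T then S.transProb (z t).1 (z t).2 (z ⟨t.1 + 1, h⟩).1 else 1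

end OneType

section Stacked

variable {M J d n T : ℕ} {X A : Type*} [Fintype X] [Fintype A]

/-- `Γ^q`, stacked over types. -/
def GamS (S : Setup J d n X A) (q : ℕ∞) (θ θt : Fin M × Fin d → ℝ)
    (P : Fin M × (Fin J × X × A) → ℝ) (Y : Fin M × Fin n → ℝ) : Fin M × Fin n → ℝ :=
  fun c => S.Γ q (blk θ c.1) (blk θt c.1) (blk P c.1) (blk Y c.1) c.2

/-- `Λ`, stacked over types. -/
def LamS (S : Setup J d n X A) (θ : Fin M × Fin d → ℝ) (Y : Fin M × Fin n → ℝ)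
    (P : Fin M × (Fin J × X × A) → ℝ) : Fin M × (Fin J × X × A) → ℝ :=
  fun c => S.Lam (blk θ c.1) (blk Y c.1) (blk P c.1) c.2

/-- `Λ^q(θ, θ̃, Y, P) = Λ(θ, Γ^q(θ, θ̃, P; Y), P)`, stacked over types. -/
def LamqS (S : Setup J d n X A) (q : ℕ∞) (θ θt : Fin M × Fin d → ℝ) (Y : Fin M × Fin n → ℝ)
    (P : Fin M × (Fin J × X × A) → ℝ) : Fin M × (Fin J × X × A) → ℝ :=
  S.LamS θ (S.GamS q θ θt P Y) P

/-- Posterior type probability `w_m(P, π)` of a market with record `z`. -/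
def post (π : Fin M → ℝ) (P : Fin M × (Fin J × X × A) → ℝ) (m : Fin M) (z : Obs J T X A) : ℝ :=
  π m * lik (blk P m) z / ∑ m', π m' * lik (blk P m') z

/-- Probability of the record `z` under the finite mixture with weights `π` and CCPs `P`. -/
def mixProb [NeZero T] (S : Setup J d n X A) (π : Fin M → ℝ)
    (P : Fin M × (Fin J × X × A) → ℝ) (z : Obs J T X A) : ℝ :=
  ∑ m, π m * (S.pathProb z * lik (blk P m) z)

/-- Population mean at the true values `s = (π*, θ*, Y*, P*)`. -/
def popMean [NeZero T] (S : Setup J d n X A) (s : State M J d n X A)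
    (g : Obs J T X A → ℝ) : ℝ :=
  ∑ z, S.mixProb s.1 s.2.2.2 z * g z

/-- One iteration `s ↦ s'` of the EM-NPL(q) algorithm; `Ex` is the average over the markets.
The maximisation in the M-step is over all of `Θ`. -/
def EMStep (S : Setup J d n X A) (q : ℕ∞) (Ex : (Obs J T X A → ℝ) → ℝ)
    (s s' : State M J d n X A) : Prop :=
  (∀ m, s'.1 m = Ex (post s.1 s.2.2.2 m)) ∧
  (∀ m, blk s'.2.1 m ∈ S.Θ ∧
    IsMaxOn (fun ϑ => Ex (fun z => post s.1 s.2.2.2 m z *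
      S.logLik q (blk s.2.1 m) (blk s.2.2.1 m) (blk s.2.2.2 m) ϑ z)) S.Θ (blk s'.2.1 m)) ∧
  s'.2.2.1 = S.GamS q s'.2.1 s.2.1 s.2.2.2 s.2.2.1 ∧
  s'.2.2.2 = S.LamS s'.2.1 s'.2.2.1 s.2.2.2

/-- Average over the first `N` markets. -/
def sampleMean (N : ℕ) (z : ℕ → Obs J T X A) (g : Obs J T X A → ℝ) : ℝ :=
  (∑ i ∈ Finset.range N, g (z i)) / N

/-- A sequence of iterates of the EM-NPL(q) algorithm on the first `N` markets. -/
def IsRun (S : Setup J d n X A) (q : ℕ∞) (N : ℕ) (z : ℕ → Obs J T X A)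
    (s : ℕ → State M J d n X A) : Prop :=
  ∀ k, S.EMStep q (sampleMean N z) (s k) (s (k + 1))

/-- Local convergence of the EM-NPL(q) algorithm: on a fixed neighbourhood `U` of the true values,
almost surely for all large sample sizes `N`, the algorithm can be run from every initial value in
`U` and all its runs from `U` converge to one sample fixed point `ŝ_N ∈ U`; and `ŝ_N` is
consistent. -/
def LocallyConverges {Ω : Type*} [MeasurableSpace Ω] (S : Setup J d n X A) (q : ℕ∞)
    (μ : Measure Ω) (obs : ℕ → Ω → Obs J T X A) (s₀ : State M J d n X A) : Prop :=
  ∃ U ∈ 𝓝 s₀, ∀ᵐ ω ∂μ, ∃ shat : ℕ → State M J d n X A,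
    Tendsto shat atTop (𝓝 s₀) ∧
    ∀ᶠ N in atTop,
      shat N ∈ U ∧
      S.EMStep q (sampleMean N (fun i => obs i ω)) (shat N) (shat N) ∧
      (∀ u ∈ U, ∃ s, s 0 = u ∧ S.IsRun q N (fun i => obs i ω) s) ∧
      ∀ s, s 0 ∈ U → S.IsRun q N (fun i => obs i ω) s → Tendsto s atTop (𝓝 (shat N))

section RateMatrix

variable [NeZero T] [DecidableEq X] [DecidableEq A]

/-- The population E-step map `E(π, P)`, at the true values `s₀`. -/
def Estep (T : ℕ) [NeZero T] (S : Setup J d n X A) (s₀ : State M J d n X A) (π : Fin M → ℝ)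
    (P : Fin M × (Fin J × X × A) → ℝ) : Fin M → ℝ :=
  fun m => S.popMean (T := T) s₀ (post π P m)

/-- The population M-step objective `ℓ_E^q(θ; θ̃, Y, P, π)`. -/
def ellE (T : ℕ) [NeZero T] (S : Setup J d n X A) (s₀ : State M J d n X A) (q : ℕ∞)
    (θ θt : Fin M × Fin d → ℝ) (Y : Fin M × Fin n → ℝ) (P : Fin M × (Fin J × X × A) → ℝ)
    (π : Fin M → ℝ) : ℝ :=
  ∑ m, S.popMean (T := T) s₀ (fun z => post π P m z *
    S.logLik q (blk θt m) (blk Y m) (blk P m) (blk θ m) z)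

/-- The population pseudo-likelihood `𝒬^q(θ, π; θ̃, Y, P)`. -/
def pseudoLik (T : ℕ) [NeZero T] (S : Setup J d n X A) (s₀ : State M J d n X A) (q : ℕ∞)
    (θ : Fin M × Fin d → ℝ) (π : Fin M → ℝ)
    (θt : Fin M × Fin d → ℝ) (Y : Fin M × Fin n → ℝ) (P : Fin M × (Fin J × X × A) → ℝ) : ℝ :=
  S.popMean (T := T) s₀ (fun z =>
    Real.log (∑ m, π m * lik (blk (S.LamqS q θ θt Y P) m) z))

/-- `(θ, π)` is a global maximiser of the population pseudo-likelihood given `(θ̃, Y, P)`. -/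
def IsPseudoMax (T : ℕ) [NeZero T] (S : Setup J d n X A) (s₀ : State M J d n X A) (q : ℕ∞)
    (θt : Fin M × Fin d → ℝ) (Y : Fin M × Fin n → ℝ) (P : Fin M × (Fin J × X × A) → ℝ)
    (θ : Fin M × Fin d → ℝ) (π : Fin M → ℝ) : Prop :=
  (∀ m, blk θ m ∈ S.Θ) ∧ π ∈ stdSimplex ℝ (Fin M) ∧
  ∀ θ' π', (∀ m, blk θ' m ∈ S.Θ) → π' ∈ stdSimplex ℝ (Fin M) →
    S.pseudoLik T s₀ q θ' π' θt Y P ≤ S.pseudoLik T s₀ q θ π θt Y P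

/-- The M-step Hessian `∇²_{θθ} ℓ_E^q` at the true values. -/
def hessE (T : ℕ) [NeZero T] (S : Setup J d n X A) (s₀ : State M J d n X A) (q : ℕ∞) :
    Matrix (Fin M × Fin d) (Fin M × Fin d) ℝ :=
  hess (fun θ => S.ellE T s₀ q θ s₀.2.1 s₀.2.2.1 s₀.2.2.2 s₀.1) s₀.2.1

/-- M-step sensitivity `H_π^q`. -/
def Hpi (T : ℕ) [NeZero T] (S : Setup J d n X A) (s₀ : State M J d n X A) (q : ℕ∞) :
    Matrix (Fin M × Fin d) (Fin M) ℝ :=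
  -((S.hessE T s₀ q)⁻¹ *
    crossHess (fun θ π => S.ellE T s₀ q θ s₀.2.1 s₀.2.2.1 s₀.2.2.2 π) s₀.2.1 s₀.1)

/-- M-step sensitivity `H_θ̃^q`. -/
def Hth (T : ℕ) [NeZero T] (S : Setup J d n X A) (s₀ : State M J d n X A) (q : ℕ∞) :
    Matrix (Fin M × Fin d) (Fin M × Fin d) ℝ :=
  -((S.hessE T s₀ q)⁻¹ *
    crossHess (fun θ θt => S.ellE T s₀ q θ θt s₀.2.2.1 s₀.2.2.2 s₀.1) s₀.2.1 s₀.2.1)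

/-- M-step sensitivity `H_Y^q`. -/
def HY (T : ℕ) [NeZero T] (S : Setup J d n X A) (s₀ : State M J d n X A) (q : ℕ∞) :
    Matrix (Fin M × Fin d) (Fin M × Fin n) ℝ :=
  -((S.hessE T s₀ q)⁻¹ *
    crossHess (fun θ Y => S.ellE T s₀ q θ s₀.2.1 Y s₀.2.2.2 s₀.1) s₀.2.1 s₀.2.2.1)

/-- M-step sensitivity `H_P^q`. -/
def HP (T : ℕ) [NeZero T] (S : Setup J d n X A) (s₀ : State M J d n X A) (q : ℕ∞) :
    Matrix (Fin M × Fin d) (Fin M × (Fin J × X × A)) ℝ :=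
  -((S.hessE T s₀ q)⁻¹ *
    crossHess (fun θ P => S.ellE T s₀ q θ s₀.2.1 s₀.2.2.1 P s₀.1) s₀.2.1 s₀.2.2.2)

/-- The rate matrix `R^q`, in the order `(π, θ, Y, P)`. -/
def rateMatrix (T : ℕ) [NeZero T] (S : Setup J d n X A) (s₀ : State M J d n X A) (q : ℕ∞) :
    Matrix (Fin M ⊕ (Fin M × Fin d) ⊕ (Fin M × Fin n) ⊕ (Fin M × (Fin J × X × A)))
      (Fin M ⊕ (Fin M × Fin d) ⊕ (Fin M × Fin n) ⊕ (Fin M × (Fin J × X × A))) ℝ :=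
  let π := s₀.1
  let θ := s₀.2.1
  let Y := s₀.2.2.1
  let P := s₀.2.2.2
  let Eπ := jac (fun π' => S.Estep T s₀ π' P) π
  let EP := jac (fun P' => S.Estep T s₀ π P') P
  let Hπ := S.Hpi T s₀ q
  let Hθ := S.Hth T s₀ q
  let HY := S.HY T s₀ q
  let HP := S.HP T s₀ q
  let Γθ := jac (fun θ' => S.GamS q θ' θ P Y) θ
  let Γt := jac (fun θt' => S.GamS q θ θt' P Y) θ
  let ΓY := jac (fun Y' => S.GamS q θ θ P Y') Y
  let ΓP := jac (fun P' => S.GamS q θ θ P' Y) P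
  let Λθ := jac (fun θ' => S.LamqS q θ' θ Y P) θ
  let Λt := jac (fun θt' => S.LamqS q θ θt' Y P) θ
  let ΛY := jac (fun Y' => S.LamqS q θ θ Y' P) Y
  let ΛP := jac (fun P' => S.LamqS q θ θ Y P') P
  .fromRows (.fromCols Eπ (.fromCols 0 (.fromCols 0 EP)))
    (.fromRows (.fromCols Hπ (.fromCols Hθ (.fromCols HY HP)))
      (.fromRows
        (.fromCols (Γθ * Hπ)
          (.fromCols (Γθ * Hθ + Γt) (.fromCols (Γθ * HY + ΓY) (Γθ * HP + ΓP))))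
        (.fromCols (Λθ * Hπ)
          (.fromCols (Λθ * Hθ + Λt) (.fromCols (Λθ * HY + ΛY) (Λθ * HP + ΛP))))))

end RateMatrix

/-! ### Assumptions -/

/-- `s₀ = (π*, θ*, Y*, P*)` are true values at which the fixed-point equations hold, and the
primitives of the state process are probabilities. -/
structure IsTruth (S : Setup J d n X A) (s₀ : State M J d n X A) : Prop where
  init_nonneg : ∀ x, 0 ≤ S.initDist x
  init_sum : ∑ x, S.initDist x = 1
  trans_nonneg : ∀ x a x', 0 ≤ S.transProb x a x'
  trans_sum : ∀ x a, ∑ x', S.transProb x a x' = 1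
  pi_pos : ∀ m, 0 < s₀.1 m
  pi_sum : ∑ m, s₀.1 m = 1
  theta_interior : ∀ m, blk s₀.2.1 m ∈ interior S.Θ
  Y_interior : ∀ m, blk s₀.2.2.1 m ∈ interior S.YSp
  P_interior : ∀ m, blk s₀.2.2.2 m ∈ interior S.PSp
  Y_eq : ∀ m, blk s₀.2.2.1 m =
    S.G (blk s₀.2.1 m) (blk s₀.2.1 m) (blk s₀.2.2.1 m) (blk s₀.2.2.2 m)
  P_eq : s₀.2.2.2 = S.LamS s₀.2.1 s₀.2.2.1 s₀.2.2.2

/-- The records of the markets are i.i.d. draws from the finite mixture with the true values. -/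
structure IsSample {Ω : Type*} [MeasurableSpace Ω] [MeasurableSpace X] [MeasurableSpace A]
    [NeZero T] (S : Setup J d n X A) (s₀ : State M J d n X A) (μ : Measure Ω)
    (obs : ℕ → Ω → Obs J T X A) : Prop where
  meas : ∀ i, Measurable (obs i)
  indep : iIndepFun obs μ
  law : ∀ i z, μ.real (obs i ⁻¹' {z}) = S.mixProb s₀.1 s₀.2.2.2 z

/-- The fixed-point equation has a unique solution, each `Γ^q` has the same fixed points as `G`,
and `Γ^∞` solves the equation exactly. -/
structure SameFixedPoint (S : Setup J d n X A) : Prop where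
  unique : ∀ θ ∈ S.Θ, ∀ θt ∈ S.Θ, ∀ P ∈ S.PSp, ∃! Y, Y ∈ S.YSp ∧ Y = S.G θ θt Y P
  mapsTo : ∀ q : ℕ∞, 1 ≤ q → ∀ θ ∈ S.Θ, ∀ θt ∈ S.Θ, ∀ P ∈ S.PSp, ∀ Y ∈ S.YSp, S.Γ q θ θt P Y ∈ S.YSp
  same : ∀ q : ℕ∞, 1 ≤ q → ∀ θ ∈ S.Θ, ∀ θt ∈ S.Θ, ∀ P ∈ S.PSp, ∀ Y ∈ S.YSp,
    (Y = S.Γ q θ θt P Y ↔ Y = S.G θ θt Y P)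
  exact_top : ∀ θ ∈ S.Θ, ∀ θt ∈ S.Θ, ∀ P ∈ S.PSp, ∀ Y ∈ S.YSp,
    S.Γ ⊤ θ θt P Y = S.G θ θt (S.Γ ⊤ θ θt P Y) P

/-- Regularity: compact parameter space, smooth maps, global maximiser of the population
pseudo-likelihood unique up to relabelling near the true values, nonsingular M-step Hessian. -/
structure Regular (T : ℕ) [NeZero T] [DecidableEq X] [DecidableEq A] (S : Setup J d n X A)
    (s₀ : State M J d n X A) : Prop where
  compact : IsCompact S.Θ
  smooth_inner : ∀ q : ℕ∞, 1 ≤ q → ContDiffOn ℝ 3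
    (fun p : (Fin d → ℝ) × (Fin d → ℝ) × (Fin J × X × A → ℝ) × (Fin n → ℝ) =>
      S.Γ q p.1 p.2.1 p.2.2.1 p.2.2.2) (S.Θ ×ˢ S.Θ ×ˢ S.PSp ×ˢ S.YSp)
  smooth_ccp : ContDiffOn ℝ 3
    (fun p : (Fin d → ℝ) × (Fin n → ℝ) × (Fin J × X × A → ℝ) =>
      S.v p.1 p.2.1 p.2.2) (S.Θ ×ˢ S.YSp ×ˢ S.PSp)
  unique_max : ∀ q : ℕ∞, 1 ≤ q → ∀ᶠ p in 𝓝 s₀.2, ∀ θ π θ' π',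
    S.IsPseudoMax T s₀ q p.1 p.2.1 p.2.2 θ π → S.IsPseudoMax T s₀ q p.1 p.2.1 p.2.2 θ' π' →
    ∃ σ : Equiv.Perm (Fin M), ∀ m, blk θ' m = blk θ (σ m) ∧ π' m = π (σ m)
  nonsingular : ∀ q : ℕ∞, 1 ≤ q → IsUnit (S.hessE T s₀ q).det

/-- Approximation error: near the true values of each type,
`‖Y(θ, θ̃, P) - Γ^q(θ, θ̃, P; Y)‖₂ ≤ ‖Y(θ, θ̃, P) - Y‖₂ f(q)`, where `f(q) → 0`. -/
structure ApproxError (S : Setup J d n X A) (s₀ : State M J d n X A) (f : ℕ → ℝ) : Prop where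
  tendsto : Tendsto f atTop (𝓝 0)
  bound : ∀ m, ∀ᶠ p in 𝓝 (blk s₀.2.1 m, blk s₀.2.1 m, blk s₀.2.2.2 m, blk s₀.2.2.1 m),
    ∀ q : ℕ, 1 ≤ q →
      norm2 (S.exactSol p.1 p.2.1 p.2.2.1 - S.Γ q p.1 p.2.1 p.2.2.1 p.2.2.2) ≤
        norm2 (S.exactSol p.1 p.2.1 p.2.2.1 - p.2.2.2) * f q

/-- Gradient bound: the exact solution is continuously differentiable and `∇_θ Γ^q` at the true
values is bounded uniformly in `q ≤ ∞`. -/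
structure GradBound (S : Setup J d n X A) (s₀ : State M J d n X A) : Prop where
  smooth : ContDiffOn ℝ 1
    (fun p : (Fin d → ℝ) × (Fin d → ℝ) × (Fin J × X × A → ℝ) =>
      S.exactSol p.1 p.2.1 p.2.2) (S.Θ ×ˢ S.Θ ×ˢ S.PSp)
  bound : ∃ C : ℝ, ∀ q : ℕ∞, 1 ≤ q → ∀ m,
    frob (jac (fun θ => S.Γ q θ (blk s₀.2.1 m) (blk s₀.2.2.2 m) (blk s₀.2.2.1 m))
      (blk s₀.2.1 m)) ≤ C

end Stacked

end Setup

end EMNPL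

end

/-! Records take finitely many values, so a sample enters an iteration only through the vector p of
relative frequencies of the records. The iteration is thus a relation between states with the
finite-dimensional parameter p; the truth p* is the law of a record, and p tends to p* almost surely
by the strong law (`ae_tendsto_empFreq`).

Near (p*, s*) this relation is the graph of a smooth map. Zeros of the M-step score form one smooth
branch, because the M-step Hessian is nonsingular. At the truth each type's M-step is a
cross-entropy problem: Gibbs' inequality and uniqueness of the pseudo-likelihood maximiser up to
relabelling make its global maximiser unique (`eq_truth_of_le`). By compactness of the parameter
space, all nearby global maximisers are then close to the truth, hence interior, hence on the branch
(`eventually_emStep_iff`). The state derivative of the resulting map is the rate matrix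
(`exists_strict_iteration`). If its spectral radius is below one, it contracts an equivalent norm
(`exists_contracted_seminorm`), so the iteration is a uniform contraction of a fixed ball for all p
near p* (`exists_local_attractor`).

It remains to compare the matrices for finite and infinite q. The approximation error is at most
f(q) times the distance from Y to the exact solution. That distance vanishes at the truth and is of
first order near it, so the derivatives of the finite and the exact inner map at the truth differ by
O(f(q)) (`exists_GamJ_sub_le`, `closeTo_fderiv_GamJ`). This argument controls first derivatives
only, whereas the rate matrix contains second derivatives of the M-step objective. Correct
specification closes the gap: likelihoods sum to one identically, so the score can be rewritten with
a factor that vanishes at the truth, and its derivative involves only first derivatives of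
log-likelihoods (`fderiv_score`, `closeTo_fderiv_scoreJ`). All entries of the rate matrix are then
algebraic in O(f(q))-close quantities, with a nonsingular limit Hessian as the only matrix inverted.
Upper semicontinuity of the spectrum carries the bound on the spectral radius to large q. -/

noncomputable section

namespace EMNPL

set_option linter.unusedSectionVars false

/-! ### Local attractors of parametrised maps -/

/-- A parametrised map that is strictly differentiable at a fixed point, and whose state derivative
contracts an equivalent norm, has an attracting fixed point for every nearby parameter. -/
theorem exists_local_attractor {Q E : Type*} [NormedAddCommGroup Q] [NormedSpace ℝ Q]
    [NormedAddCommGroup E] [NormedSpace ℝ E] [CompleteSpace E]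
    {F : Q × E → E} {F' : Q × E →L[ℝ] E} {p₀ : Q} {s₀ : E}
    (hF : HasStrictFDerivAt F F' (p₀, s₀)) (hfix : F (p₀, s₀) = s₀)
    (V : Seminorm ℝ E) {C r : ℝ} (hlow : ∀ x, ‖x‖ ≤ V x) (hup : ∀ x, V x ≤ C * ‖x‖)
    (hC : 0 ≤ C) (hr0 : 0 ≤ r) (hr1 : r < 1) (hcontr : ∀ x, V (F' (0, x)) ≤ r * V x)
    (Step : Q → E → E → Prop)
    (hStep : ∀ᶠ x in 𝓝 (p₀, s₀), ∀ s', Step x.1 x.2 s' ↔ s' = F x) :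
    ∃ U ∈ 𝓝 s₀, ∀ p : ℕ → Q, Tendsto p atTop (𝓝 p₀) → ∃ shat : ℕ → E,
      Tendsto shat atTop (𝓝 s₀) ∧ ∀ᶠ N in atTop, shat N ∈ U ∧
        Step (p N) (shat N) (shat N) ∧
        (∀ u ∈ U, ∃ s : ℕ → E, s 0 = u ∧ ∀ k, Step (p N) (s k) (s (k + 1))) ∧
        ∀ s : ℕ → E, s 0 ∈ U → (∀ k, Step (p N) (s k) (s (k + 1))) →
          Tendsto s atTop (𝓝 (shat N)) := by
  -- The linearisation error ε in the original norm costs C * ε ≤ (1 - r) / 2 in `V`; added to the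
  -- contraction factor r this gives ρ = (1 + r) / 2 < 1.
  set ε : ℝ := (1 - r) / (2 * (C + 1)) with hε
  have hε0 : 0 < ε := by rw [hε]; apply div_pos <;> linarith
  have hCε : C * ε ≤ (1 - r) / 2 := by
    rw [hε]
    have : C * ((1 - r) / (2 * (C + 1))) = (1 - r) / 2 * (C / (C + 1)) := by
      field_simp
    rw [this]
    have h1 : C / (C + 1) ≤ 1 := by rw [div_le_one (by linarith)]; linarith
    nlinarith
  set ρ : ℝ := (1 + r) / 2 with hρ
  have hρ1 : ρ < 1 := by rw [hρ]; linarith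
  have hρ0 : 0 ≤ ρ := by rw [hρ]; linarith
  have hVcont : Continuous V := by
    refine Seminorm.continuous_of_continuousAt_zero ?_
    rw [ContinuousAt, map_zero]
    refine squeeze_zero (fun x => apply_nonneg V x) hup ?_
    have h : Continuous fun x : E => C * ‖x‖ := by fun_prop
    simpa using h.tendsto 0
  have h1 : ∀ᶠ x in 𝓝 ((p₀, s₀), (p₀, s₀)), ‖F x.1 - F x.2 - F' (x.1 - x.2)‖ ≤ ε * ‖x.1 - x.2‖ :=
    hF.isLittleO.def hε0
  have h2 : ∀ᶠ x : Q × E × E in 𝓝 (p₀, s₀, s₀),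
      ‖F (x.1, x.2.1) - F (x.1, x.2.2) - F' (0, x.2.1 - x.2.2)‖ ≤ ε * ‖x.2.1 - x.2.2‖ := by
    have hc : Tendsto (fun x : Q × E × E => ((x.1, x.2.1), (x.1, x.2.2))) (𝓝 (p₀, s₀, s₀))
        (𝓝 ((p₀, s₀), (p₀, s₀))) :=
      Continuous.tendsto (by fun_prop) (p₀, s₀, s₀)
    filter_upwards [hc.eventually h1] with x hx
    have e : ((x.1, x.2.1) : Q × E) - (x.1, x.2.2) = (0, x.2.1 - x.2.2) := by simp
    have e2 : ‖((0 : Q), x.2.1 - x.2.2)‖ = ‖x.2.1 - x.2.2‖ := by simp [Prod.norm_def]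
    simpa only [e, e2] using hx
  -- Each condition is split into one on the parameter and one on the states, so that the
  -- neighbourhood of states can be chosen before the parameter.
  rw [nhds_prod_eq, nhds_prod_eq] at h2
  obtain ⟨P1, hP1, P2, hP2, h2⟩ := Filter.eventually_prod_iff.1 h2
  obtain ⟨P3, hP3, hP3'⟩ := Filter.eventually_prod_self_iff'.1 hP2
  rw [nhds_prod_eq] at hStep
  obtain ⟨P4, hP4, P5, hP5, h4⟩ := Filter.eventually_prod_iff.1 hStep
  obtain ⟨δ, hδ, hball⟩ := Metric.eventually_nhds_iff.1
    ((show ∀ᶠ s in 𝓝 s₀, s ∈ P3 from hP3).and hP5)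
  -- A closed `V`-ball, so that limits of iterates stay inside; since `V` dominates the norm, radius
  -- δ / 2 keeps it within the norm ball of radius δ.
  set U : Set E := {s | V (s - s₀) ≤ δ / 2} with hU
  have hUsub : ∀ s ∈ U, s ∈ P3 ∧ P5 s := by
    intro s hs
    apply hball
    rw [dist_eq_norm]
    have := hlow (s - s₀)
    have hs' : V (s - s₀) ≤ δ / 2 := hs
    linarith
  have hUclosed : IsClosed U :=
    isClosed_le (hVcont.comp (continuous_id.sub continuous_const)) continuous_const
  have hs₀U : s₀ ∈ U := by simp [hU]; positivity
  have hUn : U ∈ 𝓝 s₀ := by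
    have : Tendsto (fun s => V (s - s₀)) (𝓝 s₀) (𝓝 (V (s₀ - s₀))) :=
      (hVcont.comp (continuous_id.sub continuous_const)).tendsto s₀
    rw [sub_self, map_zero] at this
    filter_upwards [this.eventually (ge_mem_nhds (half_pos hδ))] with s hs using hs
  have hpcont : Tendsto (fun p => V (F (p, s₀) - s₀)) (𝓝 p₀) (𝓝 0) := by
    have hc1 : ContinuousAt (fun p => F (p, s₀)) p₀ := by
      have h := hF.continuousAt
      exact ContinuousAt.comp (f := fun p : Q => (p, s₀)) (x := p₀) h
        (continuous_id.prodMk continuous_const).continuousAt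
    have := (hVcont.continuousAt.comp (hc1.sub continuousAt_const)).tendsto
      (x := p₀) (f := V ∘ fun p => F (p, s₀) - s₀)
    simpa [hfix, Function.comp_def] using this
  -- The contraction uses up ρ * (δ / 2) of the radius; the displacement of the centre may use the
  -- rest, and the ball is then invariant.
  have hsmall : ∀ᶠ p in 𝓝 p₀, V (F (p, s₀) - s₀) ≤ (1 - ρ) * (δ / 2) :=
    hpcont.eventually (ge_mem_nhds (by apply mul_pos <;> linarith))
  set W : Set Q := {p | P1 p ∧ P4 p ∧ V (F (p, s₀) - s₀) ≤ (1 - ρ) * (δ / 2)} with hW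
  have hWn : ∀ᶠ p in 𝓝 p₀, p ∈ W := by
    filter_upwards [hP1, hP4, hsmall] with p a b c using ⟨a, b, c⟩
  have hlip : ∀ p ∈ W, ∀ s ∈ U, ∀ s' ∈ U, V (F (p, s) - F (p, s')) ≤ ρ * V (s - s') := by
    intro p hp s hs s' hs'
    have h := h2 hp.1 (hP3' s (hUsub s hs).1 s' (hUsub s' hs').1)
    simp only at h
    calc V (F (p, s) - F (p, s'))
        = V ((F (p, s) - F (p, s') - F' (0, s - s')) + F' (0, s - s')) := by congr 1; abel
      _ ≤ V (F (p, s) - F (p, s') - F' (0, s - s')) + V (F' (0, s - s')) := map_add_le_add _ _ _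
      _ ≤ C * (ε * V (s - s')) + r * V (s - s') := by
          refine add_le_add ((hup _).trans ?_) (hcontr _)
          exact mul_le_mul_of_nonneg_left
            (h.trans (mul_le_mul_of_nonneg_left (hlow _) hε0.le)) hC
      _ ≤ ρ * V (s - s') := by
          have : 0 ≤ V (s - s') := apply_nonneg _ _
          rw [hρ]; nlinarith
  have hmaps : ∀ p ∈ W, ∀ s ∈ U, F (p, s) ∈ U := by
    intro p hp s hs
    have h := hlip p hp s hs s₀ hs₀U
    have hs' : V (s - s₀) ≤ δ / 2 := hs
    have h3 := hp.2.2
    change V (F (p, s) - s₀) ≤ δ / 2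
    calc V (F (p, s) - s₀) = V ((F (p, s) - F (p, s₀)) + (F (p, s₀) - s₀)) := by congr 1; abel
      _ ≤ V (F (p, s) - F (p, s₀)) + V (F (p, s₀) - s₀) := map_add_le_add _ _ _
      _ ≤ ρ * (δ / 2) + (1 - ρ) * (δ / 2) := by
          refine add_le_add (h.trans (mul_le_mul_of_nonneg_left hs' hρ0)) h3
      _ = δ / 2 := by ring
  -- Banach's fixed point argument on `U`. The hypothesis `p ∈ W` stands inside the existential so
  -- that the fixed point is chosen as a total function of p.
  have hfp : ∀ p, ∃ s, p ∈ W → s ∈ U ∧ F (p, s) = s := by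
    intro p
    by_cases hp : p ∈ W
    swap
    · exact ⟨s₀, fun h => absurd h hp⟩
    let u : ℕ → E := fun k => (fun s => F (p, s))^[k] s₀
    have hu1 : ∀ k, u (k + 1) = F (p, u k) := fun k => Function.iterate_succ_apply' _ _ _
    have huU : ∀ k, u k ∈ U := by
      intro k
      induction k with
      | zero => exact hs₀U
      | succ k ih => rw [hu1]; exact hmaps p hp _ ih
    have hgeo : ∀ k, V (u k - u (k + 1)) ≤ V (u 0 - u 1) * ρ ^ k := by
      intro k
      induction k with
      | zero => simp
      | succ k ih =>
        rw [hu1 (k + 1)]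
        nth_rewrite 1 [hu1 k]
        refine (hlip p hp _ (huU _) _ (huU _)).trans ?_
        rw [pow_succ]
        nlinarith
    have hcau : CauchySeq u := cauchySeq_of_le_geometric ρ (V (u 0 - u 1)) hρ1 fun k => by
      rw [dist_eq_norm]; exact (hlow _).trans (hgeo k)
    obtain ⟨s, hs⟩ := cauchySeq_tendsto_of_complete hcau
    have hsU : s ∈ U := hUclosed.mem_of_tendsto hs (Eventually.of_forall huU)
    refine ⟨s, fun _ => ⟨hsU, ?_⟩⟩
    have hlim : Tendsto (fun k => u (k + 1)) atTop (𝓝 (F (p, s))) := by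
      rw [tendsto_iff_norm_sub_tendsto_zero]
      have hz : Tendsto (fun k => ρ * V (u k - s)) atTop (𝓝 0) := by
        have := (hVcont.tendsto (s - s)).comp (hs.sub_const s)
        rw [sub_self, map_zero] at this
        simpa using this.const_mul ρ
      refine squeeze_zero (fun _ => norm_nonneg _) (fun k => ?_) hz
      rw [hu1]
      exact (hlow _).trans (hlip p hp _ (huU _) _ hsU)
    exact tendsto_nhds_unique hlim (hs.comp (tendsto_add_atTop_nat 1))
  choose fp hfp using hfp
  refine ⟨U, hUn, fun p hp => ⟨fun N => fp (p N), ?_, ?_⟩⟩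
  · rw [tendsto_iff_norm_sub_tendsto_zero]
    -- By contraction, the distance from the fixed point to s₀ is at most 1 / (1 - ρ) times the
    -- displacement of s₀, which tends to zero with p.
    have hz : Tendsto (fun N => V (F (p N, s₀) - s₀) / (1 - ρ)) atTop (𝓝 0) := by
      simpa using (hpcont.comp hp).div_const (1 - ρ)
    refine squeeze_zero' (Eventually.of_forall fun _ => norm_nonneg _) ?_ hz
    filter_upwards [hp.eventually hWn] with N hN
    obtain ⟨h1, h2⟩ := hfp _ hN
    refine (hlow _).trans ?_
    rw [le_div_iff₀ (by linarith)]
    have h3 := hlip _ hN _ h1 _ hs₀U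
    rw [h2] at h3
    have h4 : V (fp (p N) - s₀) ≤ V (fp (p N) - F (p N, s₀)) + V (F (p N, s₀) - s₀) := by
      refine le_trans (le_of_eq ?_) (map_add_le_add V _ _)
      congr 1; abel
    linarith
  · filter_upwards [hp.eventually hWn] with N hN
    obtain ⟨hU1, hF1⟩ := hfp _ hN
    have hst : ∀ s ∈ U, ∀ s', Step (p N) s s' ↔ s' = F (p N, s) := fun s hs =>
      h4 hN.2.1 (hUsub s hs).2
    refine ⟨hU1, (hst _ hU1 _).2 hF1.symm, fun u hu => ?_, fun s hs0 hs => ?_⟩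
    · refine ⟨fun k => (fun s => F (p N, s))^[k] u, rfl, fun k => ?_⟩
      have hk : ∀ k, (fun s => F (p N, s))^[k] u ∈ U := by
        intro k
        induction k with
        | zero => exact hu
        | succ k ih => rw [Function.iterate_succ_apply']; exact hmaps _ hN _ ih
      exact (hst _ (hk k) _).2 (Function.iterate_succ_apply' _ _ _)
    · have hsU : ∀ k, s k ∈ U := by
        intro k
        induction k with
        | zero => exact hs0
        | succ k ih => rw [(hst _ ih _).1 (hs k)]; exact hmaps _ hN _ ih
      have hgeo : ∀ k, V (s k - fp (p N)) ≤ ρ ^ k * V (s 0 - fp (p N)) := by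
        intro k
        induction k with
        | zero => simp
        | succ k ih =>
          have h := hlip _ hN _ (hsU k) _ hU1
          rw [hF1, ← (hst _ (hsU k) _).1 (hs k)] at h
          refine h.trans ?_
          rw [pow_succ]
          nlinarith
      rw [tendsto_iff_norm_sub_tendsto_zero]
      refine squeeze_zero (fun _ => norm_nonneg _) (fun k => (hlow _).trans (hgeo k)) ?_
      simpa using (tendsto_pow_atTop_nhds_zero_of_lt_one hρ0 hρ1).mul_const (V (s 0 - fp (p N)))

/-! ### Spectral radius -/

section SpectralRadius

attribute [local instance] Matrix.linftyOpNormedAddCommGroup Matrix.linftyOpNormedRing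
  Matrix.linftyOpNormedAlgebra

/-- Gelfand's formula: the k-th roots of the norms of the powers tend to the spectral radius, and a
root below one forces the power's norm below one. -/
theorem exists_norm_pow_lt_one {B : Type*} [NormedRing B] [NormedAlgebra ℂ B] [CompleteSpace B]
    (a : B) (h : spectralRadius ℂ a < 1) : ∃ k : ℕ, 0 < k ∧ ‖a ^ k‖ < 1 := by
  have h1 := (spectrum.pow_nnnorm_pow_one_div_tendsto_nhds_spectralRadius a).eventually
    (gt_mem_nhds h)
  obtain ⟨k, hk, hk0⟩ := (h1.and (eventually_gt_atTop 0)).exists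
  refine ⟨k, hk0, ?_⟩
  by_contra! hcon
  have h2 : (1 : ENNReal) ≤ (‖a ^ k‖₊ : ENNReal) := by exact_mod_cast hcon
  have h3 : (1 : ENNReal) ≤ (‖a ^ k‖₊ : ENNReal) ^ (1 / k : ℝ) :=
    ENNReal.one_le_rpow h2 (by positivity)
  exact absurd hk (not_lt.2 h3)

/-- A real matrix of spectral radius less than one strictly contracts an equivalent norm. -/
theorem exists_contracted_seminorm {ι : Type*} [Fintype ι] (A : Matrix ι ι ℝ)
    (h : specRad A < 1) : ∃ (V : Seminorm ℝ (ι → ℝ)) (C r : ℝ), 0 ≤ C ∧ 0 ≤ r ∧ r < 1 ∧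
      (∀ x, ‖x‖ ≤ V x) ∧ (∀ x, V x ≤ C * ‖x‖) ∧ ∀ x, V (A.mulVec x) ≤ r * V x := by
  classical
  obtain ⟨k, hk0, hk⟩ := exists_norm_pow_lt_one (A.map (fun r : ℝ => (r : ℂ))) h
  have hmap : ∀ k, (A.map (fun r : ℝ => (r : ℂ))) ^ k = (A ^ k).map (fun r : ℝ => (r : ℂ)) :=
    fun k => ((Complex.ofRealHom.mapMatrix (m := ι)).map_pow A k).symm
  have hnorm : ∀ B : Matrix ι ι ℝ, ‖B.map (fun r : ℝ => (r : ℂ))‖ = ‖B‖ := by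
    intro B
    simp [Matrix.linfty_opNorm_def]
  rw [hmap, hnorm] at hk
  -- As r increases to 1, so does r ^ k, and it eventually exceeds ‖A ^ k‖ < 1; positivity of r
  -- permits the weights r⁻¹ ^ i.
  obtain ⟨r, hr0, hr1, hrk⟩ : ∃ r : ℝ, 0 < r ∧ r < 1 ∧ ‖A ^ k‖ ≤ r ^ k := by
    have hc : Tendsto (fun r : ℝ => r ^ k) (𝓝[<] 1) (𝓝 1) := by
      have : Tendsto (fun r : ℝ => r ^ k) (𝓝 1) (𝓝 (1 ^ k)) := (continuous_pow k).tendsto 1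
      rw [one_pow] at this
      exact this.mono_left nhdsWithin_le_nhds
    have h0 : ∀ᶠ r : ℝ in 𝓝[<] 1, 0 < r := nhdsWithin_le_nhds (lt_mem_nhds zero_lt_one)
    obtain ⟨r, ⟨h1, h2⟩, h3⟩ :=
      ((hc.eventually (lt_mem_nhds hk)).and h0 |>.and self_mem_nhdsWithin).exists
    exact ⟨r, h2, h3, h1.le⟩
  -- The adapted norm is the sum over i < k of r⁻¹ ^ i * ‖A ^ i x‖. Its term i = 0 is the norm
  -- itself, which gives the lower bound.
  let S : ℕ → Seminorm ℝ (ι → ℝ) := fun i =>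
    Real.toNNReal ((r⁻¹) ^ i) • (normSeminorm ℝ (ι → ℝ)).comp (Matrix.mulVecLin (A ^ i))
  have hS : ∀ i x, S i x = (r⁻¹) ^ i * ‖(A ^ i).mulVec x‖ := by
    intro i x
    simp only [S, _root_.smul_apply, Seminorm.comp_apply, coe_normSeminorm,
      Matrix.mulVecLin_apply, NNReal.smul_def, smul_eq_mul]
    rw [Real.coe_toNNReal _ (by positivity)]
  have hV : ∀ x, (∑ i ∈ Finset.range k, S i) x =
      ∑ i ∈ Finset.range k, (r⁻¹) ^ i * ‖(A ^ i).mulVec x‖ := by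
    intro x
    have : ∀ s : Finset ℕ, (∑ i ∈ s, S i) x = ∑ i ∈ s, S i x := fun s => by
      induction s using Finset.cons_induction with
      | empty => simp
      | cons a s ha ih => rw [Finset.sum_cons, Finset.sum_cons, ← ih]; rfl
    rw [this]
    exact Finset.sum_congr rfl fun i _ => hS i x
  refine ⟨∑ i ∈ Finset.range k, S i, ∑ i ∈ Finset.range k, (r⁻¹) ^ i * ‖A ^ i‖, r, ?_, hr0.le,
    hr1, ?_, ?_, ?_⟩
  · exact Finset.sum_nonneg fun i _ => by positivity
  · intro x
    rw [hV]
    refine le_trans (le_of_eq ?_) (Finset.single_le_sum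
      (f := fun i => (r⁻¹) ^ i * ‖(A ^ i).mulVec x‖) (fun i _ => by positivity)
      (Finset.mem_range.2 hk0))
    simp
  · intro x
    rw [hV, Finset.sum_mul]
    refine Finset.sum_le_sum fun i _ => ?_
    rw [mul_assoc]
    exact mul_le_mul_of_nonneg_left (Matrix.linfty_opNorm_mulVec _ _) (by positivity)
  · intro x
    rw [hV, hV, Finset.mul_sum]
    have e1 : ∀ i, (r⁻¹) ^ i * ‖(A ^ i).mulVec (A.mulVec x)‖ =
        r * ((r⁻¹) ^ (i + 1) * ‖(A ^ (i + 1)).mulVec x‖) := by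
      intro i
      rw [Matrix.mulVec_mulVec, ← pow_succ, pow_succ (r⁻¹)]
      field_simp
    rw [Finset.sum_congr rfl fun i _ => e1 i, ← Finset.mul_sum, ← Finset.mul_sum]
    refine mul_le_mul_of_nonneg_left ?_ hr0.le
    -- Applying A shifts the sum by one index: the term at 0 is exchanged for the term at k, which
    -- is no larger because ‖A ^ k‖ ≤ r ^ k.
    set g : ℕ → ℝ := fun i => (r⁻¹) ^ i * ‖(A ^ i).mulVec x‖ with hg
    change ∑ i ∈ Finset.range k, g (i + 1) ≤ ∑ i ∈ Finset.range k, g i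
    have h1 := Finset.sum_range_succ g k
    have h2 := Finset.sum_range_succ' g k
    have h3 : g k ≤ g 0 := by
      simp only [hg, pow_zero, Matrix.one_mulVec, one_mul]
      rw [inv_pow, inv_mul_le_iff₀ (by positivity)]
      exact (Matrix.linfty_opNorm_mulVec _ _).trans
        (mul_le_mul_of_nonneg_right hrk (norm_nonneg _))
    linarith

/-- The spectrum is upper hemicontinuous: once the limit has its spectrum in the open unit disc, so
do all nearby matrices. The supremum of the moduli is attained on a nonempty spectrum, so the bound
stays strict; an empty spectrum has radius zero. -/
theorem specRad_lt_one_of_tendsto {ι : Type*} [Fintype ι] {A : ℕ → Matrix ι ι ℝ}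
    {B : Matrix ι ι ℝ} (hB : specRad B < 1)
    (h : ∀ i j, Tendsto (fun q => A q i j) atTop (𝓝 (B i j))) :
    ∀ᶠ q in atTop, specRad (A q) < 1 := by
  classical
  have hlim : Tendsto (fun q => (A q).map (fun r : ℝ => (r : ℂ))) atTop
      (𝓝 (B.map (fun r : ℝ => (r : ℂ)))) := by
    refine tendsto_pi_nhds.2 fun i => tendsto_pi_nhds.2 fun j => ?_
    exact (Complex.continuous_ofReal.tendsto _).comp (h i j)
  have hsub : ∀ k ∈ spectrum ℂ (B.map (fun r : ℝ => (r : ℂ))), k ∈ Metric.ball (0 : ℂ) 1 := by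
    intro k hk
    have h1 : (‖k‖₊ : ENNReal) ≤ spectralRadius ℂ (B.map (fun r : ℝ => (r : ℂ))) :=
      le_iSup₂ (f := fun k (_ : k ∈ spectrum ℂ (B.map (fun r : ℝ => (r : ℂ)))) =>
        (‖k‖₊ : ENNReal)) k hk
    have h2 : (‖k‖₊ : ENNReal) < 1 := h1.trans_lt hB
    rw [mem_ball_zero_iff]
    exact_mod_cast h2
  have hev := ((upperHemicontinuous_spectrum ℂ (Matrix ι ι ℂ)) (B.map (fun r : ℝ => (r : ℂ))))
    (Metric.ball (0 : ℂ) 1) (Metric.isOpen_ball.mem_nhdsSet.2 hsub)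
  filter_upwards [hlim.eventually hev] with q hq
  have hq' := subset_of_mem_nhdsSet hq
  change spectralRadius ℂ ((A q).map (fun r : ℝ => (r : ℂ))) < 1
  rcases (spectrum ℂ ((A q).map (fun r : ℝ => (r : ℂ)))).eq_empty_or_nonempty with he | hne
  · simp [spectralRadius, he]
  · refine spectrum.spectralRadius_lt_of_forall_lt_of_nonempty hne (r := 1) fun k hk => ?_
    have := hq' hk
    rw [mem_ball_zero_iff] at this
    exact_mod_cast this

end SpectralRadius

/-! ### Sequences close to a limit at a given rate -/

/-- `a q - b = O(f q)`. -/
def CloseTo (f : ℕ → ℝ) (a : ℕ → ℝ) (b : ℝ) : Prop := (fun q => a q - b) =O[atTop] f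

namespace CloseTo

variable {f a a' : ℕ → ℝ} {b b' : ℝ}

theorem const (f : ℕ → ℝ) (b : ℝ) : CloseTo f (fun _ => b) b := by
  simp only [CloseTo, sub_self]
  exact Asymptotics.isBigO_zero _ _

theorem of_eventuallyEq (h : CloseTo f a b) (e : ∀ᶠ q in atTop, a' q = a q) :
    CloseTo f a' b :=
  Asymptotics.IsBigO.congr' h (e.mono fun q hq => by simp [hq]) EventuallyEq.rfl

theorem add (h : CloseTo f a b) (h' : CloseTo f a' b') :
    CloseTo f (fun q => a q + a' q) (b + b') := by
  refine (Asymptotics.IsBigO.add h h').congr_left fun q => ?_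
  ring

theorem neg (h : CloseTo f a b) : CloseTo f (fun q => -a q) (-b) := by
  refine (Asymptotics.IsBigO.neg_left h).congr_left fun q => ?_
  ring

theorem sub (h : CloseTo f a b) (h' : CloseTo f a' b') :
    CloseTo f (fun q => a q - a' q) (b - b') := by
  simpa only [sub_eq_add_neg] using h.add h'.neg

theorem tendsto (hf : Tendsto f atTop (𝓝 0)) (h : CloseTo f a b) : Tendsto a atTop (𝓝 b) := by
  have := (Asymptotics.IsBigO.trans_tendsto h hf).add_const b
  simpa using this

/-- Since f tends to zero, the first factor converges and is bounded; then split a a' - b b' = a (a'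
- b') + (a - b) b'. -/
theorem mul (hf : Tendsto f atTop (𝓝 0)) (h : CloseTo f a b) (h' : CloseTo f a' b') :
    CloseTo f (fun q => a q * a' q) (b * b') := by
  have h1 : (fun q => a q * (a' q - b')) =O[atTop] f := by
    simpa using ((h.tendsto hf).isBigO_one ℝ).mul h'
  have h2 : (fun q => (a q - b) * b') =O[atTop] f := by
    simpa using Asymptotics.IsBigO.mul h (Asymptotics.isBigO_refl (fun _ : ℕ => b') atTop)
      |>.trans (Asymptotics.isBigO_of_le' (c := ‖b'‖) _ fun q => by simp [mul_comm])
  refine (h1.add h2).congr_left fun q => ?_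
  ring

theorem const_mul (c : ℝ) (h : CloseTo f a b) : CloseTo f (fun q => c * a q) (c * b) := by
  refine (Asymptotics.IsBigO.const_mul_left h c).congr_left fun q => ?_
  ring

theorem sum {ι : Type*} {s : Finset ι} {a : ι → ℕ → ℝ} {b : ι → ℝ}
    (h : ∀ i ∈ s, CloseTo f (a i) (b i)) :
    CloseTo f (fun q => ∑ i ∈ s, a i q) (∑ i ∈ s, b i) := by
  refine (Asymptotics.IsBigO.sum h).congr_left fun q => ?_
  simp only [Finset.sum_apply]
  rw [Finset.sum_sub_distrib]

theorem prod (hf : Tendsto f atTop (𝓝 0)) {ι : Type*} {s : Finset ι} {a : ι → ℕ → ℝ} {b : ι → ℝ}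
    (h : ∀ i ∈ s, CloseTo f (a i) (b i)) :
    CloseTo f (fun q => ∏ i ∈ s, a i q) (∏ i ∈ s, b i) := by
  induction s using Finset.cons_induction with
  | empty => simpa using const f 1
  | cons i s hi ih =>
    simp only [Finset.prod_cons]
    exact (h i (by simp)).mul hf (ih fun j hj => h j (by simp [hj]))

theorem inv (hf : Tendsto f atTop (𝓝 0)) (h : CloseTo f a b) (hb : b ≠ 0) :
    CloseTo f (fun q => (a q)⁻¹) b⁻¹ := by
  have ht := h.tendsto hf
  have h1 : (fun q => (a q)⁻¹ * (-b⁻¹) * (a q - b)) =O[atTop] f := by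
    simpa using (((ht.inv₀ hb).mul_const (-b⁻¹)).isBigO_one ℝ).mul h
  refine Asymptotics.IsBigO.congr' h1 ?_ EventuallyEq.rfl
  filter_upwards [ht.eventually_ne hb] with q hq
  field_simp
  ring

end CloseTo

/-- Entrywise closeness of a sequence of matrices. -/
def MClose {ι κ : Type*} (f : ℕ → ℝ) (A : ℕ → Matrix ι κ ℝ) (B : Matrix ι κ ℝ) : Prop :=
  ∀ i j, CloseTo f (fun q => A q i j) (B i j)

namespace MClose

variable {ι κ μ : Type*} {f : ℕ → ℝ}

theorem const (f : ℕ → ℝ) (B : Matrix ι κ ℝ) : MClose f (fun _ => B) B := fun i j =>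
  CloseTo.const f (B i j)

theorem add {A A' : ℕ → Matrix ι κ ℝ} {B B' : Matrix ι κ ℝ} (h : MClose f A B)
    (h' : MClose f A' B') : MClose f (fun q => A q + A' q) (B + B') := fun i j =>
  (h i j).add (h' i j)

theorem neg {A : ℕ → Matrix ι κ ℝ} {B : Matrix ι κ ℝ} (h : MClose f A B) :
    MClose f (fun q => -A q) (-B) := fun i j => (h i j).neg

theorem mul [Fintype κ] (hf : Tendsto f atTop (𝓝 0)) {A : ℕ → Matrix ι κ ℝ}
    {A' : ℕ → Matrix κ μ ℝ} {B : Matrix ι κ ℝ} {B' : Matrix κ μ ℝ} (h : MClose f A B)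
    (h' : MClose f A' B') : MClose f (fun q => A q * A' q) (B * B') := fun i j => by
  simp only [Matrix.mul_apply]
  exact CloseTo.sum fun k _ => (h i k).mul hf (h' k j)

theorem det [Fintype ι] [DecidableEq ι] (hf : Tendsto f atTop (𝓝 0)) {A : ℕ → Matrix ι ι ℝ}
    {B : Matrix ι ι ℝ} (h : MClose f A B) : CloseTo f (fun q => (A q).det) B.det := by
  simp only [Matrix.det_apply']
  exact CloseTo.sum fun σ _ => (CloseTo.prod hf fun i _ => h _ _).const_mul _

/-- Cramer's rule: the entries of the inverse are determinants of row-updated matrices divided by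
the determinant, hence polynomials in the entries over a quantity with nonzero limit. -/
theorem inv [Fintype ι] [DecidableEq ι] (hf : Tendsto f atTop (𝓝 0)) {A : ℕ → Matrix ι ι ℝ}
    {B : Matrix ι ι ℝ} (h : MClose f A B) (hB : IsUnit B.det) :
    MClose f (fun q => (A q)⁻¹) B⁻¹ := fun i j => by
  simp only [Matrix.inv_def, Matrix.smul_apply, Ring.inverse_eq_inv', smul_eq_mul,
    Matrix.adjugate_apply]
  refine ((h.det hf).inv hf hB.ne_zero).mul hf (det hf fun k l => ?_)
  by_cases hk : k = j
  · subst hk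
    simp only [Matrix.updateRow_self]
    exact CloseTo.const _ _
  · simp only [Matrix.updateRow_ne hk]
    exact h k l

theorem fromRows {A : ℕ → Matrix ι κ ℝ} {A' : ℕ → Matrix μ κ ℝ} {B : Matrix ι κ ℝ}
    {B' : Matrix μ κ ℝ} (h : MClose f A B) (h' : MClose f A' B') :
    MClose f (fun q => Matrix.fromRows (A q) (A' q)) (Matrix.fromRows B B') := by
  rintro (i | i) j
  · exact h i j
  · exact h' i j

theorem fromCols {A : ℕ → Matrix ι κ ℝ} {A' : ℕ → Matrix ι μ ℝ} {B : Matrix ι κ ℝ}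
    {B' : Matrix ι μ ℝ} (h : MClose f A B) (h' : MClose f A' B') :
    MClose f (fun q => Matrix.fromCols (A q) (A' q)) (Matrix.fromCols B B') := by
  rintro i (j | j)
  · exact h i j
  · exact h' i j

theorem frob_isBigO [Fintype ι] [Fintype κ] {A : ℕ → Matrix ι κ ℝ} {B : Matrix ι κ ℝ}
    (h : MClose f A B) : (fun q => frob (A q - B)) =O[atTop] f := by
  have h1 : (fun q => ∑ i, ∑ j, ‖A q i j - B i j‖) =O[atTop] f :=
    (Asymptotics.IsBigO.sum (s := Finset.univ) fun i _ =>
      Asymptotics.IsBigO.sum (s := Finset.univ) fun j _ => Asymptotics.IsBigO.norm_left (h i j)).congr_left fun q => by simp only [Finset.sum_apply]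
  refine Asymptotics.IsBigO.trans (Asymptotics.isBigO_of_le _ fun q => ?_) h1
  have h0 : 0 ≤ ∑ i, ∑ j, ‖A q i j - B i j‖ :=
    Finset.sum_nonneg fun i _ => Finset.sum_nonneg fun j _ => norm_nonneg _
  rw [Real.norm_of_nonneg h0, frob, Real.norm_of_nonneg (Real.sqrt_nonneg _)]
  refine Real.sqrt_le_iff.2 ⟨h0, ?_⟩
  refine le_trans (Finset.sum_le_sum fun i _ => ?_)
    (Finset.sum_sq_le_sq_sum_of_nonneg fun i _ =>
      Finset.sum_nonneg fun j _ => norm_nonneg (A q i j - B i j))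
  refine le_trans (Finset.sum_le_sum fun j _ => ?_)
    (Finset.sum_sq_le_sq_sum_of_nonneg fun j _ => norm_nonneg (A q i j - B i j))
  simp [Matrix.sub_apply]

end MClose

/-! ### Gibbs' inequality -/

/-- The inequality log u ≤ u - 1 at u = b / a, weighted by c a and summed; equality of the two total
masses cancels the linear terms. Strictness of the inequality for u ≠ 1 gives the equality case, and
only where c does not vanish. -/
theorem gibbs {ι : Type*} [Fintype ι] {c a b : ι → ℝ} (hc : ∀ i, 0 ≤ c i) (ha : ∀ i, 0 < a i)
    (hb : ∀ i, 0 < b i) (h : ∑ i, c i * b i = ∑ i, c i * a i) :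
    ∑ i, c i * a i * Real.log (b i) ≤ ∑ i, c i * a i * Real.log (a i) ∧
    (∑ i, c i * a i * Real.log (a i) ≤ ∑ i, c i * a i * Real.log (b i) →
      ∀ i, c i = 0 ∨ b i = a i) := by
  have key : ∀ i, c i * a i * Real.log (b i) ≤
      c i * a i * Real.log (a i) + (c i * b i - c i * a i) := by
    intro i
    have h1 : Real.log (b i) - Real.log (a i) ≤ b i / a i - 1 := by
      rw [← Real.log_div (hb i).ne' (ha i).ne']
      exact Real.log_le_sub_one_of_pos (div_pos (hb i) (ha i))
    have h2 := mul_le_mul_of_nonneg_left h1 (mul_nonneg (hc i) (ha i).le)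
    have h3 : c i * a i * (b i / a i - 1) = c i * b i - c i * a i := by
      have := (ha i).ne'
      field_simp
    rw [h3] at h2
    linarith
  have hsum : ∑ i, (c i * a i * Real.log (a i) + (c i * b i - c i * a i)) =
      ∑ i, c i * a i * Real.log (a i) := by
    rw [Finset.sum_add_distrib, Finset.sum_sub_distrib, h, sub_self, add_zero]
  refine ⟨hsum ▸ Finset.sum_le_sum fun i _ => key i, fun hle i => ?_⟩
  by_contra! hcon
  refine absurd hle (not_le.2 ?_)
  rw [← hsum]
  refine Finset.sum_lt_sum (fun i _ => key i) ⟨i, Finset.mem_univ i, ?_⟩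
  have hci : 0 < c i := lt_of_le_of_ne (hc i) hcon.1.symm
  have h1 : Real.log (b i) - Real.log (a i) < b i / a i - 1 := by
    rw [← Real.log_div (hb i).ne' (ha i).ne']
    refine Real.log_lt_sub_one_of_pos (div_pos (hb i) (ha i)) fun h => hcon.2 ?_
    exact (div_eq_one_iff_eq (ha i).ne').1 h
  have h2 := mul_lt_mul_of_pos_left h1 (mul_pos hci (ha i))
  have h3 : c i * a i * (b i / a i - 1) = c i * b i - c i * a i := by
    have := (ha i).ne'
    field_simp
  rw [h3] at h2
  linarith

/-! ### Empirical frequencies -/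

/-- Relative frequency of each value among the first `N` observations. -/
def empFreq {O : Type*} [DecidableEq O] (N : ℕ) (z : ℕ → O) (o : O) : ℝ :=
  (∑ i ∈ Finset.range N, if z i = o then (1 : ℝ) else 0) / N

/-- The strong law for the indicator of each value; there are finitely many values, so the
exceptional null sets can be united. -/
theorem ae_tendsto_empFreq {Ω O : Type*} [MeasurableSpace Ω] {μ : Measure Ω}
    [IsProbabilityMeasure μ] [Fintype O] [DecidableEq O] [MeasurableSpace O]
    [MeasurableSingletonClass O] {obs : ℕ → Ω → O} {p : O → ℝ} (hm : ∀ i, Measurable (obs i))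
    (hi : iIndepFun obs μ) (hlaw : ∀ i o, μ.real (obs i ⁻¹' {o}) = p o) :
    ∀ᵐ ω ∂μ, Tendsto (fun N => empFreq N fun i => obs i ω) atTop (𝓝 p) := by
  simp only [tendsto_pi_nhds]
  rw [ae_all_iff]
  intro o
  let g : O → ℝ := fun x => if x = o then 1 else 0
  have hg : Measurable g := measurable_of_countable g
  have hint : ∀ i, g ∘ obs i = (obs i ⁻¹' {o}).indicator fun _ => (1 : ℝ) := by
    intro i
    ext ω
    by_cases hω : obs i ω = o
    · rw [Set.indicator_of_mem (by simpa using hω)]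
      simp [g, hω]
    · rw [Set.indicator_of_notMem (by simpa using hω)]
      simp [g, hω]
  have hms : ∀ i, MeasurableSet (obs i ⁻¹' {o}) := fun i => hm i (measurableSet_singleton o)
  -- On a finite space the probabilities of singletons determine the law, so the observations are
  -- identically distributed.
  have hid : ∀ i, Measure.map (obs i) μ = Measure.map (obs 0) μ := by
    intro i
    refine Measure.ext_of_singleton fun x => ?_
    rw [Measure.map_apply (hm i) (measurableSet_singleton x),
      Measure.map_apply (hm 0) (measurableSet_singleton x)]
    have := (hlaw i x).trans (hlaw 0 x).symm
    exact (measureReal_eq_measureReal_iff).1 this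
  have h := strong_law_ae_real (μ := μ) (fun i => g ∘ obs i)
    (by rw [hint]; exact (integrable_const _).indicator (hms 0))
    (fun i j hij => (hi.indepFun hij).comp hg hg)
    (fun i => (IdentDistrib.mk (hm i).aemeasurable (hm 0).aemeasurable (hid i)).comp hg)
  have he : μ[g ∘ obs 0] = p o := by
    rw [hint, integral_indicator_const _ (hms 0), hlaw]
    simp
  filter_upwards [h] with ω hω
  rw [he] at hω
  exact hω

/-- This replaces the sample by its vector of frequencies, the finite-dimensional parameter of the
iteration. -/
theorem sampleMean_eq {J T : ℕ} {X A : Type*} [Fintype X] [Fintype A] [DecidableEq X]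
    [DecidableEq A] (N : ℕ) (z : ℕ → Obs J T X A) (g : Obs J T X A → ℝ) :
    Setup.sampleMean N z g = ∑ o, empFreq N z o * g o := by
  simp only [Setup.sampleMean, empFreq, div_mul_eq_mul_div, Finset.sum_mul]
  rw [← Finset.sum_div, Finset.sum_comm]
  congr 1
  exact Finset.sum_congr rfl fun i _ => by simp

namespace Setup

/-! ### Probability of a record -/

section Records

variable {M J d n : ℕ} {X A : Type*} [Fintype X] [Fintype A]

theorem pathProb_succ {k : ℕ} (S : Setup J d n X A) (z : Obs J (k + 1) X A) :
    S.pathProb z = S.initDist (z 0).1 *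
      ∏ t : Fin k, S.transProb (z t.castSucc).1 (z t.castSucc).2 (z t.succ).1 := by
  rw [pathProb, Fin.prod_univ_castSucc]
  simp only [Fin.val_castSucc, Fin.val_last, lt_irrefl, dite_false, mul_one]
  congr 1
  refine Finset.prod_congr rfl fun t _ => ?_
  rw [dif_pos (by omega)]
  rfl

theorem sum_prod_actions {Q : Fin J × X × A → ℝ} (hQ : ∀ j x, ∑ a, Q (j, x, a) = 1) (x : X) :
    ∑ a : Fin J → A, ∏ j, Q (j, x, a j) = 1 := by
  classical
  have h := Finset.prod_univ_sum (fun _ : Fin J => (Finset.univ : Finset A))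
    (fun j a => Q (j, x, a))
  rw [Fintype.piFinset_univ] at h
  rw [← h]
  simp [hQ]

theorem sum_mul_prod_actions {Q : Fin J × X × A → ℝ} (hQ : ∀ j x, ∑ a, Q (j, x, a) = 1)
    {g : X → ℝ} (hg : ∑ x, g x = 1) :
    ∑ o : X × (Fin J → A), g o.1 * ∏ j, Q (j, o.1, o.2 j) = 1 := by
  rw [Fintype.sum_prod_type]
  simp only [← Finset.mul_sum, sum_prod_actions hQ, mul_one, hg]

/-- Induction on the horizon, summing out the last period: given the previous one, its transition
and choice probabilities sum to one. -/
theorem sum_pathProb_mul_lik_succ (S : Setup J d n X A) (hinit : ∑ x, S.initDist x = 1)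
    (htrans : ∀ x a, ∑ x', S.transProb x a x' = 1) {Q : Fin J × X × A → ℝ}
    (hQ : ∀ j x, ∑ a, Q (j, x, a) = 1) (k : ℕ) :
    ∑ z : Obs J (k + 1) X A, S.pathProb z * lik Q z = 1 := by
  induction k with
  | zero =>
    rw [← sum_mul_prod_actions hQ hinit, ← (Equiv.funUnique (Fin 1) (X × (Fin J → A))).sum_comp]
    refine Finset.sum_congr rfl fun z _ => ?_
    rw [pathProb_succ]
    simp [lik, Equiv.funUnique]
  | succ k ih =>
    rw [← (Fin.snocEquiv fun _ => X × (Fin J → A)).sum_comp, Fintype.sum_prod_type_right, ← ih]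
    refine Finset.sum_congr rfl fun z _ => ?_
    have h : ∀ o : X × (Fin J → A),
        S.pathProb (Fin.snocEquiv (fun _ => X × (Fin J → A)) (o, z)) *
          lik Q (Fin.snocEquiv (fun _ => X × (Fin J → A)) (o, z)) =
        S.pathProb z * lik Q z *
          (S.transProb (z (Fin.last k)).1 (z (Fin.last k)).2 o.1 *
            ∏ j, Q (j, o.1, o.2 j)) := by
      intro o
      rw [pathProb_succ, pathProb_succ, Fin.prod_univ_castSucc, lik, Fin.prod_univ_castSucc, lik]
      simp only [Fin.snocEquiv_apply, Fin.snoc_castSucc, Fin.succ_castSucc, Fin.succ_last,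
        Fin.snoc_last]
      rw [show (Fin.snoc z o : Fin (k + 2) → X × (Fin J → A)) 0 = z 0 from
        Fin.snoc_castSucc (α := fun _ => X × (Fin J → A)) o z 0]
      ring
    rw [Finset.sum_congr rfl fun o _ => h o, ← Finset.mul_sum,
      sum_mul_prod_actions hQ (htrans _ _), mul_one]

variable {T : ℕ}

theorem lik_pos {Q : Fin J × X × A → ℝ} (hQ : ∀ c, 0 < Q c) (z : Obs J T X A) : 0 < lik Q z :=
  Finset.prod_pos fun _ _ => Finset.prod_pos fun _ _ => hQ _

theorem Lam_pos (S : Setup J d n X A) (θ : Fin d → ℝ) (Y : Fin n → ℝ) (P : Fin J × X × A → ℝ)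
    (c : Fin J × X × A) : 0 < S.Lam θ Y P c :=
  div_pos (Real.exp_pos _) (Finset.sum_pos (fun _ _ => Real.exp_pos _) ⟨c.2.2, Finset.mem_univ _⟩)

theorem Lam_sum (S : Setup J d n X A) (hA : Fin J → Nonempty A) (θ : Fin d → ℝ) (Y : Fin n → ℝ)
    (P : Fin J × X × A → ℝ) (j : Fin J) (x : X) : ∑ a, S.Lam θ Y P (j, x, a) = 1 := by
  have := hA j
  simp only [Lam]
  rw [← Finset.sum_div]
  exact div_self (Finset.sum_pos (fun _ _ => Real.exp_pos _) Finset.univ_nonempty).ne'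

/-- Logit probabilities are positive, so the sum of logarithms is the logarithm of a record's
likelihood, a normalised object to which Gibbs' inequality applies. -/
theorem logLik_eq_log_lik (S : Setup J d n X A) (q : ℕ∞) (θt : Fin d → ℝ) (Y : Fin n → ℝ)
    (P : Fin J × X × A → ℝ) (ϑ : Fin d → ℝ) (z : Obs J T X A) :
    S.logLik q θt Y P ϑ z = Real.log (lik (S.Lam ϑ (S.Γ q ϑ θt P Y) P) z) := by
  rw [lik, Real.log_prod fun t _ =>
    (Finset.prod_pos fun j _ => S.Lam_pos _ _ _ _).ne', logLik]
  refine Finset.sum_congr rfl fun t _ => ?_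
  rw [Real.log_prod fun j _ => (S.Lam_pos _ _ _ _).ne']

theorem blk_LamqS (S : Setup J d n X A) (q : ℕ∞) (θ θt : Fin M × Fin d → ℝ)
    (Y : Fin M × Fin n → ℝ) (P : Fin M × (Fin J × X × A) → ℝ) (m : Fin M) :
    blk (S.LamqS q θ θt Y P) m =
      S.Lam (blk θ m) (S.Γ q (blk θ m) (blk θt m) (blk P m) (blk Y m)) (blk P m) := rfl

theorem blk_LamS (S : Setup J d n X A) (θ : Fin M × Fin d → ℝ)
    (Y : Fin M × Fin n → ℝ) (P : Fin M × (Fin J × X × A) → ℝ) (m : Fin M) :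
    blk (S.LamS θ Y P) m = S.Lam (blk θ m) (blk Y m) (blk P m) := rfl

variable [NeZero T]

/-- Records form a probability distribution for all normalised CCPs. -/
theorem sum_pathProb_mul_lik (S : Setup J d n X A) (hinit : ∑ x, S.initDist x = 1)
    (htrans : ∀ x a, ∑ x', S.transProb x a x' = 1) {Q : Fin J × X × A → ℝ}
    (hQ : ∀ j x, ∑ a, Q (j, x, a) = 1) :
    ∑ z : Obs J T X A, S.pathProb z * lik Q z = 1 := by
  obtain _ | k := T
  · exact absurd rfl (NeZero.ne 0)
  · exact sum_pathProb_mul_lik_succ S hinit htrans hQ k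

theorem pathProb_nonneg {S : Setup J d n X A} {s₀ : State M J d n X A} (h : S.IsTruth s₀)
    (z : Obs J T X A) : 0 ≤ S.pathProb z := by
  refine mul_nonneg (h.init_nonneg _) (Finset.prod_nonneg fun t _ => ?_)
  split_ifs
  · exact h.trans_nonneg _ _ _
  · exact zero_le_one

end Records

/-! ### Identification of the M-step maximiser -/

section Identification

variable {M J d n T : ℕ} [NeZero T] {X A : Type*} [Fintype X] [Fintype A]
  {S : Setup J d n X A} {s₀ : State M J d n X A}

theorem GamS_truth (hT : S.IsTruth s₀) (hF : S.SameFixedPoint) {q : ℕ∞} (hq : 1 ≤ q) :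
    S.GamS q s₀.2.1 s₀.2.1 s₀.2.2.2 s₀.2.2.1 = s₀.2.2.1 := by
  ext ⟨m, i⟩
  have h := (hF.same q hq _ (interior_subset (hT.theta_interior m)) _
    (interior_subset (hT.theta_interior m)) _ (interior_subset (hT.P_interior m)) _
    (interior_subset (hT.Y_interior m))).2 (hT.Y_eq m)
  exact (congrFun h i).symm

theorem LamqS_truth (hT : S.IsTruth s₀) (hF : S.SameFixedPoint) {q : ℕ∞} (hq : 1 ≤ q) :
    S.LamqS q s₀.2.1 s₀.2.1 s₀.2.2.1 s₀.2.2.2 = s₀.2.2.2 := by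
  rw [LamqS, GamS_truth hT hF hq, ← hT.P_eq]

theorem truth_P_pos (hT : S.IsTruth s₀) (c : Fin M × (Fin J × X × A)) : 0 < s₀.2.2.2 c := by
  rw [hT.P_eq]
  exact S.Lam_pos _ _ _ _

theorem truth_P_sum (hT : S.IsTruth s₀) (hA : Fin J → Nonempty A) (m : Fin M) (j : Fin J)
    (x : X) : ∑ a, blk s₀.2.2.2 m (j, x, a) = 1 := by
  rw [hT.P_eq, blk_LamS]
  exact S.Lam_sum hA _ _ _ j x

theorem mixture_pos {π : Fin M → ℝ} (hπ : π ∈ stdSimplex ℝ (Fin M)) {b : Fin M → ℝ}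
    (hb : ∀ m, 0 < b m) : 0 < ∑ m, π m * b m := by
  have h0 : ∀ m ∈ Finset.univ, 0 ≤ π m * b m := fun m _ => mul_nonneg (hπ.1 m) (hb m).le
  refine lt_of_le_of_ne (Finset.sum_nonneg h0) fun h => ?_
  have h1 := (Finset.sum_eq_zero_iff_of_nonneg h0).1 h.symm
  have h2 : ∑ m, π m = 0 := Finset.sum_eq_zero fun m hm =>
    (mul_eq_zero.1 (h1 m hm)).resolve_right (hb m).ne'
  linarith [hπ.2]

theorem truth_mem_stdSimplex (hT : S.IsTruth s₀) : s₀.1 ∈ stdSimplex ℝ (Fin M) :=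
  ⟨fun m => (hT.pi_pos m).le, hT.pi_sum⟩

theorem mixProb_eq (π : Fin M → ℝ) (P : Fin M × (Fin J × X × A) → ℝ) (z : Obs J T X A) :
    S.mixProb π P z = S.pathProb z * ∑ m, π m * lik (blk P m) z := by
  rw [mixProb, Finset.mul_sum]
  exact Finset.sum_congr rfl fun m _ => by ring

/-- Bayes' rule: the mixture denominator cancels. Averaging with posterior weights under the mixture
is therefore averaging under the law of a single type, which decouples the M-steps at the truth. -/
theorem mixProb_mul_post (hT : S.IsTruth s₀) (m : Fin M) (z : Obs J T X A) :
    S.mixProb s₀.1 s₀.2.2.2 z * post s₀.1 s₀.2.2.2 m z =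
      s₀.1 m * S.pathProb z * lik (blk s₀.2.2.2 m) z := by
  have h := (mixture_pos (truth_mem_stdSimplex hT) fun m =>
    lik_pos (fun c => truth_P_pos hT (m, c)) z).ne'
  change ∑ m, s₀.1 m * lik (blk s₀.2.2.2 m) z ≠ 0 at h
  rw [mixProb_eq, post, mul_comm (S.pathProb z), mul_assoc, mul_comm (S.pathProb z),
    ← mul_assoc, mul_div_cancel₀ _ h]
  ring

theorem sum_pathProb_mixture (hT : S.IsTruth s₀) {π : Fin M → ℝ} (hπ : ∑ m, π m = 1)
    {Q : Fin M → Fin J × X × A → ℝ} (hQ : ∀ m j x, ∑ a, Q m (j, x, a) = 1) :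
    ∑ z : Obs J T X A, S.pathProb z * ∑ m, π m * lik (Q m) z = 1 := by
  simp only [Finset.mul_sum]
  rw [Finset.sum_comm]
  have h : ∀ m, ∑ z : Obs J T X A, S.pathProb z * (π m * lik (Q m) z) = π m := by
    intro m
    have h1 := sum_pathProb_mul_lik (T := T) S hT.init_sum hT.trans_sum (hQ m)
    calc ∑ z : Obs J T X A, S.pathProb z * (π m * lik (Q m) z)
        = π m * ∑ z : Obs J T X A, S.pathProb z * lik (Q m) z := by
          rw [Finset.mul_sum]
          exact Finset.sum_congr rfl fun z _ => by ring
      _ = π m := by rw [h1, mul_one]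
  simp only [h, hπ]

/-- Gibbs' inequality with the path probabilities as reference weights; both mixtures have total
mass one. -/
theorem pseudoLik_le (hT : S.IsTruth s₀) (hA : Fin J → Nonempty A) {q : ℕ∞}
    (θ θt : Fin M × Fin d → ℝ) {π : Fin M → ℝ} (hπ : π ∈ stdSimplex ℝ (Fin M))
    (Y : Fin M × Fin n → ℝ) (P : Fin M × (Fin J × X × A) → ℝ) :
    S.pseudoLik T s₀ q θ π θt Y P ≤ ∑ z : Obs J T X A, S.mixProb s₀.1 s₀.2.2.2 z *
      Real.log (∑ m, s₀.1 m * lik (blk s₀.2.2.2 m) z) := by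
  have h := (gibbs (c := fun z : Obs J T X A => S.pathProb z)
    (a := fun z => ∑ m, s₀.1 m * lik (blk s₀.2.2.2 m) z)
    (b := fun z => ∑ m, π m * lik (blk (S.LamqS q θ θt Y P) m) z)
    (fun z => pathProb_nonneg hT z)
    (fun z => mixture_pos (truth_mem_stdSimplex hT) fun m =>
      lik_pos (fun c => truth_P_pos hT (m, c)) z)
    (fun z => mixture_pos hπ fun m => lik_pos (fun c => S.Lam_pos _ _ _ _) z)
    (by
      rw [sum_pathProb_mixture hT hT.pi_sum (truth_P_sum hT hA),
        sum_pathProb_mixture hT hπ.2 fun m j x => by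
          rw [blk_LamqS]; exact S.Lam_sum hA _ _ _ j x])).1
  simp only [← mixProb_eq] at h
  exact h

/-- At the true values, the population M-step objective has a unique global maximiser. -/
theorem eq_truth_of_le [DecidableEq X] [DecidableEq A] (hT : S.IsTruth s₀)
    (hA : Fin J → Nonempty A) (hF : S.SameFixedPoint) (hR : S.Regular T s₀) {q : ℕ∞} (hq : 1 ≤ q)
    (m : Fin M) {ϑ : Fin d → ℝ} (hϑ : ϑ ∈ S.Θ)
    (hle : S.popMean (T := T) s₀ (fun z => post s₀.1 s₀.2.2.2 m z *
        S.logLik q (blk s₀.2.1 m) (blk s₀.2.2.1 m) (blk s₀.2.2.2 m) (blk s₀.2.1 m) z) ≤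
      S.popMean (T := T) s₀ (fun z => post s₀.1 s₀.2.2.2 m z *
        S.logLik q (blk s₀.2.1 m) (blk s₀.2.2.1 m) (blk s₀.2.2.2 m) ϑ z)) :
    ϑ = blk s₀.2.1 m := by
  have hbase : ∀ k, S.Lam (blk s₀.2.1 k) (S.Γ q (blk s₀.2.1 k) (blk s₀.2.1 k) (blk s₀.2.2.2 k)
      (blk s₀.2.2.1 k)) (blk s₀.2.2.2 k) = blk s₀.2.2.2 k := fun k =>
    congrArg (fun P => blk P k) (LamqS_truth hT hF hq)
  simp only [popMean, ← mul_assoc, mixProb_mul_post hT, logLik_eq_log_lik, hbase] at hle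
  have hg := (gibbs (c := fun z : Obs J T X A => S.pathProb z)
    (a := fun z => lik (blk s₀.2.2.2 m) z)
    (b := fun z => lik (S.Lam ϑ (S.Γ q ϑ (blk s₀.2.1 m) (blk s₀.2.2.2 m) (blk s₀.2.2.1 m))
      (blk s₀.2.2.2 m)) z)
    (fun z => pathProb_nonneg hT z) (fun z => lik_pos (fun c => truth_P_pos hT (m, c)) z)
    (fun z => lik_pos (fun c => S.Lam_pos _ _ _ _) z)
    (by
      rw [sum_pathProb_mul_lik S hT.init_sum hT.trans_sum (truth_P_sum hT hA m),
        sum_pathProb_mul_lik S hT.init_sum hT.trans_sum fun j x => S.Lam_sum hA _ _ _ j x])).2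
  -- After division by the positive weight of type m this is the equality case of Gibbs' inequality:
  -- ϑ reproduces the true likelihood of every record of nonzero path probability.
  have hle' := hg (by
    refine le_of_mul_le_mul_left ?_ (hT.pi_pos m)
    simpa only [Finset.mul_sum, ← mul_assoc] using hle)
  -- Changing only block m to ϑ leaves the population pseudo-likelihood at its maximum, so θ' and
  -- the truth are two global maximisers.
  set θ' : Fin M × Fin d → ℝ := fun c => if c.1 = m then ϑ c.2 else s₀.2.1 c with hθ'
  have hθm : blk θ' m = ϑ := by ext i; simp [blk, hθ']
  have hθk : ∀ k, k ≠ m → blk θ' k = blk s₀.2.1 k := by intro k hk; ext i; simp [blk, hθ', hk]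
  have hmax1 : S.IsPseudoMax T s₀ q s₀.2.1 s₀.2.2.1 s₀.2.2.2 s₀.2.1 s₀.1 := by
    refine ⟨fun k => interior_subset (hT.theta_interior k), truth_mem_stdSimplex hT,
      fun θ1 π1 _ hπ1 => (pseudoLik_le hT hA _ _ hπ1 _ _).trans (le_of_eq ?_)⟩
    rw [pseudoLik, LamqS_truth hT hF hq, popMean]
  have heq : S.pseudoLik T s₀ q θ' s₀.1 s₀.2.1 s₀.2.2.1 s₀.2.2.2 =
      S.pseudoLik T s₀ q s₀.2.1 s₀.1 s₀.2.1 s₀.2.2.1 s₀.2.2.2 := by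
    simp only [pseudoLik, popMean]
    refine Finset.sum_congr rfl fun z _ => ?_
    rcases hle' z with h0 | h0
    · rw [mixProb_eq, h0, zero_mul, zero_mul, zero_mul]
    · rw [LamqS_truth hT hF hq]
      refine congrArg (fun x => S.mixProb s₀.1 s₀.2.2.2 z * Real.log x)
        (Finset.sum_congr rfl fun k _ => congrArg (s₀.1 k * ·) ?_)
      rw [blk_LamqS]
      by_cases hk : k = m
      · subst hk
        rw [hθm]
        exact h0
      · rw [hθk k hk, hbase]
  have hmax2 : S.IsPseudoMax T s₀ q s₀.2.1 s₀.2.2.1 s₀.2.2.2 θ' s₀.1 := by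
    refine ⟨fun k => ?_, truth_mem_stdSimplex hT, fun θ1 π1 h1 h2 => ?_⟩
    · by_cases hk : k = m
      · rw [hk, hθm]; exact hϑ
      · rw [hθk k hk]; exact interior_subset (hT.theta_interior k)
    · rw [heq]; exact hmax1.2.2 θ1 π1 h1 h2
  obtain ⟨σ, hσ⟩ := (hR.unique_max q hq).self_of_nhds _ _ _ _ hmax1 hmax2
  -- The relabelling is unknown, but the sum over types does not see it. The other blocks agree, so
  -- block m agrees as well.
  have hsum : ∑ k, blk θ' k = ∑ k, blk s₀.2.1 k := by
    rw [Finset.sum_congr rfl fun k _ => (hσ k).1, Equiv.sum_comp σ fun k => blk s₀.2.1 k]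
  rw [← Finset.add_sum_erase _ _ (Finset.mem_univ m),
    ← Finset.add_sum_erase _ (fun k => blk s₀.2.1 k) (Finset.mem_univ m),
    Finset.sum_congr rfl fun k hk => hθk k (Finset.ne_of_mem_erase hk), hθm] at hsum
  exact add_right_cancel hsum

end Identification

end Setup

/-! ### Derivative of the score of a normalised likelihood -/

section Score

variable {E : Type*} [NormedAddCommGroup E] [NormedSpace ℝ E]
  {ι ζ : Type*} [Fintype ι] [DecidableEq ι] [Fintype ζ]

/-- The score `∇_θ Σ_z W(x) z * lam(x, θ) z`. -/
def score (W : E → ζ → ℝ) (lam : E × (ι → ℝ) → ζ → ℝ) (x : E × (ι → ℝ)) : ι → ℝ :=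
  grad (fun θ => ∑ z, W x.1 z * lam (x.1, θ) z) x.2

variable {W : E → ζ → ℝ} {lam : E × (ι → ℝ) → ζ → ℝ} {a : E} {t : ι → ℝ}

theorem eventually_score_eq (hlam : ContDiffAt ℝ 2 lam (a, t)) :
    ∀ᶠ x in 𝓝 (a, t), ∀ i, score W lam x i =
      ∑ z, W x.1 z * fderiv ℝ lam x (0, Pi.single i 1) z := by
  filter_upwards [hlam.eventually (by simp)] with x hx i
  have hd : DifferentiableAt ℝ lam x := hx.differentiableAt (by simp)
  have h1 : HasFDerivAt (fun θ : ι → ℝ => (x.1, θ)) (ContinuousLinearMap.inr ℝ E (ι → ℝ)) x.2 :=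
    hasFDerivAt_prodMk_right x.1 x.2
  have h2 : HasFDerivAt (fun θ => lam (x.1, θ))
      ((fderiv ℝ lam x).comp (ContinuousLinearMap.inr ℝ E (ι → ℝ))) x.2 :=
    HasFDerivAt.comp (g := lam) x.2 hd.hasFDerivAt h1
  have h3 := HasFDerivAt.fun_sum (u := Finset.univ) fun z _ =>
    ((hasFDerivAt_pi'.1 h2) z).const_mul (W x.1 z)
  simp only [score, grad]
  rw [h3.fderiv]
  simp

/-- Differentiating the constant total mass gives the mean-zero identity of the score, in a whole
neighbourhood. -/
theorem eventually_sum_mul_fderiv_eq_zero (hlam : ContDiffAt ℝ 2 lam (a, t)) {c : ζ → ℝ} {K : ℝ}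
    (hc : ∀ᶠ x in 𝓝 (a, t), ∑ z, c z * Real.exp (lam x z) = K) :
    ∀ᶠ x in 𝓝 (a, t), ∀ δ, ∑ z, c z * Real.exp (lam x z) * fderiv ℝ lam x δ z = 0 := by
  filter_upwards [hlam.eventually (by simp), eventually_eventually_nhds.2 hc] with x hx hcx δ
  have hd : DifferentiableAt ℝ lam x := hx.differentiableAt (by simp)
  have h3 := HasFDerivAt.fun_sum (u := Finset.univ) fun z _ =>
    (((hasFDerivAt_pi'.1 hd.hasFDerivAt) z).exp).const_mul (c z)
  have h4 := h3.unique ((hasFDerivAt_const K x).congr_of_eventuallyEq hcx)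
  have h5 := congrArg (fun L => L δ) h4
  simpa [mul_assoc] using h5

theorem contDiffAt_score (hlam : ContDiffAt ℝ 2 lam (a, t)) (hW : ContDiffAt ℝ 1 W a) :
    ContDiffAt ℝ 1 (score W lam) (a, t) := by
  have h1 : ContDiffAt ℝ 1 (fderiv ℝ lam) (a, t) := hlam.fderiv_right (by norm_num)
  have hW' : ContDiffAt ℝ 1 (fun x : E × (ι → ℝ) => W x.1) (a, t) :=
    ContDiffAt.comp (g := W) (a, t) hW contDiffAt_fst
  have h2 : ContDiffAt ℝ 1 (fun x => fun i =>
      ∑ z, W x.1 z * fderiv ℝ lam x (0, Pi.single i 1) z) (a, t) := by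
    refine contDiffAt_pi.2 fun i => ContDiffAt.sum fun z _ => ?_
    exact (contDiffAt_pi.1 hW' z).mul
      (contDiffAt_pi.1 (h1.clm_apply contDiffAt_const) z)
  refine h2.congr_of_eventuallyEq ?_
  filter_upwards [eventually_score_eq (W := W) hlam] with x hx
  exact funext hx

theorem score_eq_zero (hlam : ContDiffAt ℝ 2 lam (a, t)) {c : ζ → ℝ} {K : ℝ}
    (hc : ∀ᶠ x in 𝓝 (a, t), ∑ z, c z * Real.exp (lam x z) = K)
    (hWc : ∀ z, W a z = c z * Real.exp (lam (a, t) z)) : score W lam (a, t) = 0 := by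
  ext i
  rw [(eventually_score_eq hlam).self_of_nhds i]
  simp only [hWc]
  exact (eventually_sum_mul_fderiv_eq_zero hlam hc).self_of_nhds _

/-- At a correctly specified point, the derivative of the score involves first derivatives only. -/
theorem fderiv_score (hlam : ContDiffAt ℝ 2 lam (a, t)) (hW : ContDiffAt ℝ 1 W a) {c : ζ → ℝ}
    {K : ℝ} (hc : ∀ᶠ x in 𝓝 (a, t), ∑ z, c z * Real.exp (lam x z) = K)
    (hWc : ∀ z, W a z = c z * Real.exp (lam (a, t) z)) (δ : E × (ι → ℝ)) (i : ι) :
    fderiv ℝ (score W lam) (a, t) δ i =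
      ∑ z, (fderiv ℝ W a δ.1 z - c z * Real.exp (lam (a, t) z) * fderiv ℝ lam (a, t) δ z) *
        fderiv ℝ lam (a, t) (0, Pi.single i 1) z := by
  have hd : HasFDerivAt lam (fderiv ℝ lam (a, t)) (a, t) :=
    (hlam.differentiableAt (by simp)).hasFDerivAt
  have hWd : HasFDerivAt W (fderiv ℝ W a) a := (hW.differentiableAt (by simp)).hasFDerivAt
  have hWf : HasFDerivAt (fun x : E × (ι → ℝ) => W x.1)
      ((fderiv ℝ W a).comp (ContinuousLinearMap.fst ℝ E (ι → ℝ))) (a, t) :=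
    HasFDerivAt.comp (g := W) (a, t) hWd hasFDerivAt_fst
  have hv : ∀ z, DifferentiableAt ℝ (fun x => fderiv ℝ lam x (0, Pi.single i 1) z) (a, t) := by
    intro z
    have h1 : ContDiffAt ℝ 1 (fderiv ℝ lam) (a, t) := hlam.fderiv_right (by norm_num)
    exact (contDiffAt_pi.1 (h1.clm_apply contDiffAt_const) z).differentiableAt (by simp)
  -- By the mean-zero identity, c exp(lam) may be subtracted from the weights. The new factor
  -- vanishes at the point itself, so the product rule leaves no term with a second derivative of
  -- `lam`.
  have heq : (fun x => score W lam x i) =ᶠ[𝓝 (a, t)] fun x =>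
      ∑ z, (W x.1 z - c z * Real.exp (lam x z)) * fderiv ℝ lam x (0, Pi.single i 1) z := by
    filter_upwards [eventually_score_eq (W := W) hlam,
      eventually_sum_mul_fderiv_eq_zero hlam hc] with x h1 h2
    rw [h1]
    simp only [sub_mul, Finset.sum_sub_distrib, h2, sub_zero]
  have hder := HasFDerivAt.fun_sum (u := Finset.univ) fun z _ =>
    (((hasFDerivAt_pi'.1 hWf) z).fun_sub
      ((((hasFDerivAt_pi'.1 hd) z).exp).const_mul (c z))).fun_mul (hv z).hasFDerivAt
  have h1 := (hder.congr_of_eventuallyEq heq).fderiv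
  have hs : DifferentiableAt ℝ (score W lam) (a, t) :=
    (contDiffAt_score hlam hW).differentiableAt (by simp)
  have h2 : fderiv ℝ (fun x => score W lam x i) (a, t) δ =
      fderiv ℝ (score W lam) (a, t) δ i := by
    rw [((hasFDerivAt_pi'.1 hs.hasFDerivAt) i).fderiv]
    rfl
  rw [← h2, h1]
  simp only [hWc, sub_self, zero_smul, zero_add, _root_.sum_apply]
  refine Finset.sum_congr rfl fun z _ => ?_
  simp
  ring

end Score

namespace Setup

/-! ### Smoothness of the stacked maps -/

section Smooth

variable {M J d n T : ℕ} [NeZero T] {X A : Type*} [Fintype X] [Fintype A]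

/-- `Γ^q(θ', θ, P; Y)` as a function of the state and of the new parameter. -/
def GamJ (S : Setup J d n X A) (q : ℕ∞) (x : State M J d n X A × (Fin M × Fin d → ℝ)) :
    Fin M × Fin n → ℝ :=
  S.GamS q x.2 x.1.2.1 x.1.2.2.2 x.1.2.2.1

/-- `Λ^q(θ', θ, Y, P)` as a function of the state and of the new parameter. -/
def LamqJ (S : Setup J d n X A) (q : ℕ∞) (x : State M J d n X A × (Fin M × Fin d → ℝ)) :
    Fin M × (Fin J × X × A) → ℝ :=
  S.LamqS q x.2 x.1.2.1 x.1.2.2.1 x.1.2.2.2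

/-- The stacked CCP map as a function of a triple. -/
def LamJ (S : Setup J d n X A) (y : (Fin M × Fin d → ℝ) × (Fin M × Fin n → ℝ) ×
    (Fin M × (Fin J × X × A) → ℝ)) : Fin M × (Fin J × X × A) → ℝ :=
  S.LamS y.1 y.2.1 y.2.2

/-- Log-likelihoods of all records under all types, as a function of the stacked CCPs. -/
def logLikAll (T : ℕ) (Q : Fin M × (Fin J × X × A) → ℝ) (c : Fin M × Obs J T X A) : ℝ :=
  Real.log (lik (blk Q c.1) c.2)

theorem contDiff_blk {ι : Type*} [Fintype ι] {k : WithTop ℕ∞} (m : Fin M) :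
    ContDiff ℝ k (fun u : Fin M × ι → ℝ => blk u m) :=
  contDiff_pi.2 fun i => contDiff_apply ℝ ℝ (m, i)

variable {S : Setup J d n X A} {s₀ : State M J d n X A}

theorem contDiffAt_Gam [DecidableEq X] [DecidableEq A] (hT : S.IsTruth s₀) (hR : S.Regular T s₀)
    {q : ℕ∞} (hq : 1 ≤ q) (m : Fin M) : ContDiffAt ℝ 3
      (fun p : (Fin d → ℝ) × (Fin d → ℝ) × (Fin J × X × A → ℝ) × (Fin n → ℝ) =>
        S.Γ q p.1 p.2.1 p.2.2.1 p.2.2.2)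
      (blk s₀.2.1 m, blk s₀.2.1 m, blk s₀.2.2.2 m, blk s₀.2.2.1 m) := by
  refine (hR.smooth_inner q hq).contDiffAt ?_
  have h1 := mem_interior_iff_mem_nhds.1 (hT.theta_interior m)
  exact prod_mem_nhds h1 (prod_mem_nhds h1 (prod_mem_nhds
    (mem_interior_iff_mem_nhds.1 (hT.P_interior m))
    (mem_interior_iff_mem_nhds.1 (hT.Y_interior m))))

theorem contDiffAt_GamJ [DecidableEq X] [DecidableEq A] (hT : S.IsTruth s₀) (hR : S.Regular T s₀)
    {q : ℕ∞} (hq : 1 ≤ q) : ContDiffAt ℝ 3 (S.GamJ (M := M) q) (s₀, s₀.2.1) := by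
  refine contDiffAt_pi.2 fun c => ?_
  have hin : ContDiff ℝ 3 fun x : State M J d n X A × (Fin M × Fin d → ℝ) =>
      (blk x.2 c.1, blk x.1.2.1 c.1, blk x.1.2.2.2 c.1, blk x.1.2.2.1 c.1) := by
    refine ContDiff.prodMk ((contDiff_blk _).comp contDiff_snd) (ContDiff.prodMk
      ((contDiff_blk _).comp (by fun_prop)) (ContDiff.prodMk
      ((contDiff_blk _).comp (by fun_prop)) ((contDiff_blk _).comp (by fun_prop))))
  exact contDiffAt_pi.1 (ContDiffAt.comp (s₀, s₀.2.1) (contDiffAt_Gam hT hR hq c.1)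
    hin.contDiffAt) c.2

theorem contDiffAt_LamJ [DecidableEq X] [DecidableEq A] (hT : S.IsTruth s₀)
    (hR : S.Regular T s₀) :
    ContDiffAt ℝ 3 (S.LamJ (M := M)) (s₀.2.1, s₀.2.2.1, s₀.2.2.2) := by
  refine contDiffAt_pi.2 fun c => ?_
  have hv : ContDiffAt ℝ 3 (fun p : (Fin d → ℝ) × (Fin n → ℝ) × (Fin J × X × A → ℝ) =>
      S.v p.1 p.2.1 p.2.2) (blk s₀.2.1 c.1, blk s₀.2.2.1 c.1, blk s₀.2.2.2 c.1) :=
    hR.smooth_ccp.contDiffAt (prod_mem_nhds (mem_interior_iff_mem_nhds.1 (hT.theta_interior c.1))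
      (prod_mem_nhds (mem_interior_iff_mem_nhds.1 (hT.Y_interior c.1))
        (mem_interior_iff_mem_nhds.1 (hT.P_interior c.1))))
  have hin : ContDiff ℝ 3 fun x : (Fin M × Fin d → ℝ) × (Fin M × Fin n → ℝ) ×
      (Fin M × (Fin J × X × A) → ℝ) => (blk x.1 c.1, blk x.2.1 c.1, blk x.2.2 c.1) :=
    ContDiff.prodMk ((contDiff_blk _).comp contDiff_fst) (ContDiff.prodMk
      ((contDiff_blk _).comp (by fun_prop)) ((contDiff_blk _).comp (by fun_prop)))
  have hvc : ∀ e, ContDiffAt ℝ 3 (fun x : (Fin M × Fin d → ℝ) × (Fin M × Fin n → ℝ) ×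
      (Fin M × (Fin J × X × A) → ℝ) => S.v (blk x.1 c.1) (blk x.2.1 c.1) (blk x.2.2 c.1) e)
      (s₀.2.1, s₀.2.2.1, s₀.2.2.2) := fun e =>
    contDiffAt_pi.1 (ContDiffAt.comp (g := fun p : (Fin d → ℝ) × (Fin n → ℝ) ×
      (Fin J × X × A → ℝ) => S.v p.1 p.2.1 p.2.2) (s₀.2.1, s₀.2.2.1, s₀.2.2.2) hv
      hin.contDiffAt) e
  exact (hvc c.2).exp.div (ContDiffAt.sum fun a _ => (hvc _).exp)
    (Finset.sum_pos (fun _ _ => Real.exp_pos _) ⟨c.2.2.2, Finset.mem_univ _⟩).ne'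

theorem GamJ_truth (hT : S.IsTruth s₀) (hF : S.SameFixedPoint) {q : ℕ∞} (hq : 1 ≤ q) :
    S.GamJ q (s₀, s₀.2.1) = s₀.2.2.1 := GamS_truth hT hF hq

theorem LamqJ_truth (hT : S.IsTruth s₀) (hF : S.SameFixedPoint) {q : ℕ∞} (hq : 1 ≤ q) :
    S.LamqJ q (s₀, s₀.2.1) = s₀.2.2.2 := LamqS_truth hT hF hq

theorem contDiffAt_LamqJ [DecidableEq X] [DecidableEq A] (hT : S.IsTruth s₀)
    (hF : S.SameFixedPoint) (hR : S.Regular T s₀) {q : ℕ∞} (hq : 1 ≤ q) :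
    ContDiffAt ℝ 3 (S.LamqJ (M := M) q) (s₀, s₀.2.1) := by
  have h1 : ContDiffAt ℝ 3 (fun x : State M J d n X A × (Fin M × Fin d → ℝ) =>
      (x.2, S.GamJ q x, x.1.2.2.2)) (s₀, s₀.2.1) :=
    contDiffAt_snd.prodMk ((contDiffAt_GamJ hT hR hq).prodMk
      (by fun_prop : ContDiff ℝ 3 _).contDiffAt)
  refine ContDiffAt.comp (g := S.LamJ) (s₀, s₀.2.1) ?_ h1
  simp only [GamJ_truth hT hF hq]
  exact contDiffAt_LamJ hT hR

/-- At the truth the inner map returns Y* for every q, so the outer derivative is taken at a point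
independent of q; q enters only through the derivative of the inner map. -/
theorem fderiv_LamqJ [DecidableEq X] [DecidableEq A] (hT : S.IsTruth s₀)
    (hF : S.SameFixedPoint) (hR : S.Regular T s₀) {q : ℕ∞} (hq : 1 ≤ q)
    (δ : State M J d n X A × (Fin M × Fin d → ℝ)) :
    fderiv ℝ (S.LamqJ q) (s₀, s₀.2.1) δ =
      fderiv ℝ S.LamJ (s₀.2.1, s₀.2.2.1, s₀.2.2.2)
        (δ.2, fderiv ℝ (S.GamJ q) (s₀, s₀.2.1) δ, δ.1.2.2.2) := by
  have hG := ((contDiffAt_GamJ (M := M) hT hR hq).differentiableAt (by simp)).hasFDerivAt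
  have h1 : HasFDerivAt (fun x : State M J d n X A × (Fin M × Fin d → ℝ) =>
      (x.2, S.GamJ q x, x.1.2.2.2)) _ (s₀, s₀.2.1) :=
    hasFDerivAt_snd.prodMk (hG.prodMk
      (hasFDerivAt_snd.comp _ (hasFDerivAt_snd.comp _ (hasFDerivAt_snd.comp _ hasFDerivAt_fst))))
  have hL := ((contDiffAt_LamJ (M := M) hT hR).differentiableAt (by simp)).hasFDerivAt
  have h2 : HasFDerivAt (S.LamqJ q) _ (s₀, s₀.2.1) :=
    HasFDerivAt.comp (g := S.LamJ) (s₀, s₀.2.1)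
      (by simp only [GamJ_truth hT hF hq]; exact hL) h1
  rw [h2.fderiv]
  rfl

theorem contDiffAt_logLikAll (T : ℕ) {k : WithTop ℕ∞} {Q : Fin M × (Fin J × X × A) → ℝ}
    (hQ : ∀ c, 0 < Q c) : ContDiffAt ℝ k (logLikAll (M := M) (J := J) (X := X) (A := A) T) Q := by
  refine contDiffAt_pi.2 fun c => ContDiffAt.log ?_ (lik_pos (fun e => hQ (c.1, e)) c.2).ne'
  refine contDiffAt_prod fun t _ => contDiffAt_prod fun j _ => ?_
  exact (contDiff_apply ℝ ℝ (c.1, (j, (c.2 t).1, c.2 t |>.2 j))).contDiffAt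

end Smooth

end Setup

/-! ### Jacobians along affine embeddings -/

section Jac

variable {E : Type*} [NormedAddCommGroup E] [NormedSpace ℝ E] {ι κ : Type*} [Fintype ι]
  [DecidableEq ι] [Fintype κ]

theorem CloseTo.clm {f : ℕ → ℝ} (L : (ι → ℝ) →L[ℝ] (κ → ℝ)) {v : ℕ → ι → ℝ} {w : ι → ℝ}
    (h : ∀ i, CloseTo f (fun q => v q i) (w i)) (k : κ) :
    CloseTo f (fun q => L (v q) k) (L w k) := by
  have e : ∀ u : ι → ℝ, L u k = ∑ i, u i * L (Pi.single i 1) k := by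
    intro u
    have := LinearMap.pi_apply_eq_sum_univ L.toLinearMap u
    have h2 : ∀ i : ι, (fun j => if i = j then (1 : ℝ) else 0) = Pi.single i 1 := by
      intro i
      ext j
      simp [Pi.single_apply, eq_comm]
    simp only [h2] at this
    have h3 := congrFun this k
    simpa using h3
  rw [e w]
  refine CloseTo.of_eventuallyEq (CloseTo.sum fun i _ => ?_) (Eventually.of_forall fun q => e (v q))
  simpa only [mul_comm] using (h i).const_mul (L (Pi.single i 1) k)

end Jac

/-! ### Euclidean norm, maximum norm and blocks -/

theorem abs_le_norm2 {ι : Type*} [Fintype ι] (v : ι → ℝ) (i : ι) : |v i| ≤ norm2 v := by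
  rw [norm2, ← Real.sqrt_sq_eq_abs]
  exact Real.sqrt_le_sqrt (Finset.single_le_sum (f := fun i => v i ^ 2)
    (fun i _ => sq_nonneg _) (Finset.mem_univ i))

theorem norm2_le {ι : Type*} [Fintype ι] (v : ι → ℝ) :
    norm2 v ≤ Real.sqrt (Fintype.card ι) * ‖v‖ := by
  rw [norm2, ← Real.sqrt_sq (norm_nonneg v), ← Real.sqrt_mul (by positivity)]
  refine Real.sqrt_le_sqrt ((Finset.sum_le_sum fun i _ => ?_).trans_eq
    (by rw [Finset.sum_const, nsmul_eq_mul, Finset.card_univ]) : _ ≤ (Fintype.card ι : ℝ) * ‖v‖ ^ 2)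
  rw [← sq_abs]
  exact pow_le_pow_left₀ (abs_nonneg _) (norm_le_pi_norm v i) 2

theorem norm_blk_le {M : ℕ} {ι : Type*} [Fintype ι] (u : Fin M × ι → ℝ) (m : Fin M) :
    ‖blk u m‖ ≤ ‖u‖ :=
  (pi_norm_le_iff_of_nonneg (norm_nonneg _)).2 fun i => norm_le_pi_norm u (m, i)

namespace Setup

/-! ### Approximation of the exact inner solution to first order -/

section Approximation

variable {M J d n T : ℕ} [NeZero T] {X A : Type*} [Fintype X] [Fintype A]
  {S : Setup J d n X A} {s₀ : State M J d n X A}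

/-- Both solve the fixed-point equation, which has only one solution. -/
theorem Gam_top_eq_exactSol (hF : S.SameFixedPoint) {θ θt : Fin d → ℝ} {P : Fin J × X × A → ℝ}
    {Y : Fin n → ℝ} (hθ : θ ∈ S.Θ) (hθt : θt ∈ S.Θ) (hP : P ∈ S.PSp) (hY : Y ∈ S.YSp) :
    S.Γ ⊤ θ θt P Y = S.exactSol θ θt P := by
  have hu := hF.unique θ hθ θt hθt P hP
  exact hu.unique ⟨hF.mapsTo ⊤ le_top θ hθ θt hθt P hP Y hY, hF.exact_top θ hθ θt hθt P hP Y hY⟩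
    (Classical.epsilon_spec hu.exists)

/-- The approximation bound carries the factor ‖exact solution - Y‖, itself O(‖x - x*‖). The
constant comes from the exact map alone and so does not depend on q; the square root of n converts
the maximum norm to the Euclidean one. -/
theorem exists_GamJ_sub_le [DecidableEq X] [DecidableEq A] (hT : S.IsTruth s₀)
    (hF : S.SameFixedPoint) (hR : S.Regular T s₀) {f : ℕ → ℝ} (hA : S.ApproxError s₀ f) :
    ∃ C : ℝ, 0 ≤ C ∧ ∀ q : ℕ, 1 ≤ q → ∀ᶠ x in 𝓝 (s₀, s₀.2.1),
      ‖S.GamJ q x - S.GamJ ⊤ x‖ ≤ C * |f q| * ‖x - (s₀, s₀.2.1)‖ := by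
  -- This map vanishes at the truth, so differentiability there bounds it linearly.
  have hY : DifferentiableAt ℝ (fun x : State M J d n X A × (Fin M × Fin d → ℝ) =>
      S.GamJ ⊤ x - x.1.2.2.1) (s₀, s₀.2.1) :=
    ((contDiffAt_GamJ hT hR le_top).differentiableAt (by simp)).sub
      (by fun_prop : Differentiable ℝ _).differentiableAt
  obtain ⟨C, hC0, hC⟩ := hY.isBigO_sub.exists_nonneg
  refine ⟨Real.sqrt n * C, by positivity, fun q hq => ?_⟩
  have hin : ∀ m, Tendsto (fun x : State M J d n X A × (Fin M × Fin d → ℝ) =>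
      (blk x.2 m, blk x.1.2.1 m, blk x.1.2.2.2 m, blk x.1.2.2.1 m)) (𝓝 (s₀, s₀.2.1))
      (𝓝 (blk s₀.2.1 m, blk s₀.2.1 m, blk s₀.2.2.2 m, blk s₀.2.2.1 m)) := by
    intro m
    refine Continuous.tendsto (f := fun x : State M J d n X A × (Fin M × Fin d → ℝ) =>
      (blk x.2 m, blk x.1.2.1 m, blk x.1.2.2.2 m, blk x.1.2.2.1 m)) ?_ (s₀, s₀.2.1)
    exact ((contDiff_blk (k := 0) m).continuous.comp continuous_snd).prodMk
      (((contDiff_blk (k := 0) m).continuous.comp (by fun_prop)).prodMk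
      (((contDiff_blk (k := 0) m).continuous.comp (by fun_prop)).prodMk
      ((contDiff_blk (k := 0) m).continuous.comp (by fun_prop))))
  have hmem : ∀ m, ∀ᶠ p in 𝓝 (blk s₀.2.1 m, blk s₀.2.1 m, blk s₀.2.2.2 m, blk s₀.2.2.1 m),
      p ∈ S.Θ ×ˢ S.Θ ×ˢ S.PSp ×ˢ S.YSp := by
    intro m
    have h1 := mem_interior_iff_mem_nhds.1 (hT.theta_interior m)
    exact prod_mem_nhds h1 (prod_mem_nhds h1 (prod_mem_nhds
      (mem_interior_iff_mem_nhds.1 (hT.P_interior m))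
      (mem_interior_iff_mem_nhds.1 (hT.Y_interior m))))
  have hall : ∀ᶠ x in 𝓝 (s₀, s₀.2.1), ∀ m,
      norm2 (blk (S.GamJ ⊤ x) m - blk (S.GamJ q x) m) ≤
        norm2 (blk (S.GamJ ⊤ x) m - blk x.1.2.2.1 m) * f q := by
    rw [eventually_all]
    intro m
    filter_upwards [(hin m).eventually (hA.bound m), (hin m).eventually (hmem m)] with x h1 h2
    have h3 := h1 q hq
    rw [← Gam_top_eq_exactSol hF h2.1 h2.2.1 h2.2.2.1 h2.2.2.2] at h3
    exact h3
  filter_upwards [hall, hC.bound] with x hx hCx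
  have h0 : S.GamJ ⊤ (s₀, s₀.2.1) - s₀.2.2.1 = 0 := by rw [GamJ_truth hT hF le_top, sub_self]
  rw [h0, sub_zero] at hCx
  refine (pi_norm_le_iff_of_nonneg (by positivity)).2 fun c => ?_
  have h1 := abs_le_norm2 (blk (S.GamJ ⊤ x) c.1 - blk (S.GamJ q x) c.1) c.2
  have h2 : norm2 (blk (S.GamJ ⊤ x) c.1 - blk x.1.2.2.1 c.1) ≤
      Real.sqrt n * (C * ‖x - (s₀, s₀.2.1)‖) := by
    have h3 := norm2_le (blk (S.GamJ ⊤ x) c.1 - blk x.1.2.2.1 c.1)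
    rw [Fintype.card_fin] at h3
    exact h3.trans (mul_le_mul_of_nonneg_left
      ((norm_blk_le (S.GamJ ⊤ x - x.1.2.2.1) c.1).trans hCx) (Real.sqrt_nonneg _))
  rw [Pi.sub_apply, Real.norm_eq_abs, abs_sub_comm]
  calc |S.GamJ ⊤ x c - S.GamJ q x c| ≤ _ := h1
    _ ≤ norm2 (blk (S.GamJ ⊤ x) c.1 - blk x.1.2.2.1 c.1) * f q := hx c.1
    _ ≤ norm2 (blk (S.GamJ ⊤ x) c.1 - blk x.1.2.2.1 c.1) * |f q| :=
        mul_le_mul_of_nonneg_left (le_abs_self _) (Real.sqrt_nonneg _)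
    _ ≤ Real.sqrt n * (C * ‖x - (s₀, s₀.2.1)‖) * |f q| :=
        mul_le_mul_of_nonneg_right h2 (abs_nonneg _)
    _ = Real.sqrt n * C * |f q| * ‖x - (s₀, s₀.2.1)‖ := by ring

/-- The two inner maps agree at the truth and their difference grows there at rate at most C |f q|,
which bounds the operator norm of the difference of the derivatives. -/
theorem closeTo_fderiv_GamJ [DecidableEq X] [DecidableEq A] (hT : S.IsTruth s₀)
    (hF : S.SameFixedPoint) (hR : S.Regular T s₀) {f : ℕ → ℝ} (hA : S.ApproxError s₀ f)
    (δ : State M J d n X A × (Fin M × Fin d → ℝ)) (c : Fin M × Fin n) :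
    CloseTo f (fun q => fderiv ℝ (S.GamJ q) (s₀, s₀.2.1) δ c)
      (fderiv ℝ (S.GamJ ⊤) (s₀, s₀.2.1) δ c) := by
  obtain ⟨C, hC0, hC⟩ := exists_GamJ_sub_le hT hF hR hA
  refine Asymptotics.IsBigO.of_bound (C * ‖δ‖) ?_
  filter_upwards [eventually_ge_atTop 1] with q hq
  have hq' : (1 : ℕ∞) ≤ q := by exact_mod_cast hq
  have h1 := ((contDiffAt_GamJ (M := M) hT hR hq').differentiableAt (by simp)).hasFDerivAt
  have h2 := ((contDiffAt_GamJ (M := M) hT hR le_top).differentiableAt (by simp)).hasFDerivAt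
  have h3 := (h1.sub h2).le_of_lip' (C := C * |f q|) (by positivity) (by
    filter_upwards [hC q hq] with x hx
    simp only [Pi.sub_apply, GamJ_truth hT hF hq', GamJ_truth hT hF le_top, sub_self, sub_zero]
    exact hx)
  have h4 := (norm_le_pi_norm ((fderiv ℝ (S.GamJ q) (s₀, s₀.2.1) -
    fderiv ℝ (S.GamJ ⊤) (s₀, s₀.2.1)) δ) c).trans (ContinuousLinearMap.le_of_opNorm_le _ h3 δ)
  rw [Real.norm_eq_abs (f q)]
  refine le_trans (le_of_eq rfl) (h4.trans (le_of_eq ?_))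
  ring

theorem closeTo_fderiv_LamqJ [DecidableEq X] [DecidableEq A] (hT : S.IsTruth s₀)
    (hF : S.SameFixedPoint) (hR : S.Regular T s₀) {f : ℕ → ℝ} (hA : S.ApproxError s₀ f)
    (δ : State M J d n X A × (Fin M × Fin d → ℝ)) (c : Fin M × (Fin J × X × A)) :
    CloseTo f (fun q => fderiv ℝ (S.LamqJ q) (s₀, s₀.2.1) δ c)
      (fderiv ℝ (S.LamqJ ⊤) (s₀, s₀.2.1) δ c) := by
  set L := fderiv ℝ S.LamJ (s₀.2.1, s₀.2.2.1, s₀.2.2.2) with hL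
  -- The outer derivative is affine in the inner one, with coefficients independent of q.
  have hsplit : ∀ g : Fin M × Fin n → ℝ, L (δ.2, g, δ.1.2.2.2) c =
      L (δ.2, 0, δ.1.2.2.2) c +
        (L.comp ((ContinuousLinearMap.inr ℝ (Fin M × Fin d → ℝ) _).comp
          (ContinuousLinearMap.inl ℝ (Fin M × Fin n → ℝ) _))) g c := by
    intro g
    rw [← Pi.add_apply, ContinuousLinearMap.comp_apply, ← map_add]
    simp
  have h : CloseTo f (fun q => L (δ.2, fderiv ℝ (S.GamJ q) (s₀, s₀.2.1) δ, δ.1.2.2.2) c)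
      (L (δ.2, fderiv ℝ (S.GamJ ⊤) (s₀, s₀.2.1) δ, δ.1.2.2.2) c) := by
    rw [hsplit]
    exact ((CloseTo.const f _).add (CloseTo.clm _
      (fun i => closeTo_fderiv_GamJ hT hF hR hA δ i) c)).of_eventuallyEq
      (Eventually.of_forall fun q => hsplit _)
  rw [fderiv_LamqJ hT hF hR le_top]
  refine h.of_eventuallyEq ?_
  filter_upwards [eventually_ge_atTop 1] with q hq
  rw [fderiv_LamqJ hT hF hR (by exact_mod_cast hq)]

end Approximation

/-! ### The score of the M-step objective -/

section ModelScore

variable {M J d n T : ℕ} [NeZero T] {X A : Type*} [Fintype X] [Fintype A]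

/-- True law of a record. -/
def truthLaw (T : ℕ) [NeZero T] (S : Setup J d n X A) (s₀ : State M J d n X A)
    (z : Obs J T X A) : ℝ :=
  S.mixProb s₀.1 s₀.2.2.2 z

/-- Weights of the log-likelihoods in the M-step, given the record frequencies and the state. -/
def wt (x : (Obs J T X A → ℝ) × State M J d n X A) (c : Fin M × Obs J T X A) : ℝ :=
  x.1 c.2 * post x.2.1 x.2.2.2.2 c.1 c.2

/-- The E-step map, given the record frequencies and the state. -/
def EstepJ (x : (Obs J T X A → ℝ) × State M J d n X A) (m : Fin M) : ℝ :=
  ∑ z, wt x (m, z)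

/-- Log-likelihoods in the M-step. -/
def lamJ (T : ℕ) (S : Setup J d n X A) (q : ℕ∞)
    (x : ((Obs J T X A → ℝ) × State M J d n X A) × (Fin M × Fin d → ℝ)) :
    Fin M × Obs J T X A → ℝ :=
  logLikAll T (S.LamqJ q (x.1.2, x.2))

/-- Score of the M-step. -/
def scoreJ (T : ℕ) (S : Setup J d n X A) (q : ℕ∞)
    (x : ((Obs J T X A → ℝ) × State M J d n X A) × (Fin M × Fin d → ℝ)) : Fin M × Fin d → ℝ :=
  score wt (lamJ T S q) x

variable {S : Setup J d n X A} {s₀ : State M J d n X A}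

theorem contDiffAt_wt (hT : S.IsTruth s₀) {k : WithTop ℕ∞} (p : Obs J T X A → ℝ) :
    ContDiffAt ℝ k (wt (M := M) (J := J) (d := d) (n := n) (T := T)) (p, s₀) := by
  have hl : ∀ (m : Fin M) (z : Obs J T X A), ContDiffAt ℝ k
      (fun x : (Obs J T X A → ℝ) × State M J d n X A => lik (blk x.2.2.2.2 m) z) (p, s₀) := by
    intro m z
    refine contDiffAt_prod fun t _ => contDiffAt_prod fun j _ => ?_
    exact ((contDiff_apply ℝ ℝ (m, (j, (z t).1, z t |>.2 j))).comp
      (by fun_prop : ContDiff ℝ k fun x : (Obs J T X A → ℝ) × State M J d n X A =>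
        x.2.2.2.2)).contDiffAt
  have hp : ∀ m : Fin M, ContDiffAt ℝ k
      (fun x : (Obs J T X A → ℝ) × State M J d n X A => x.2.1 m) (p, s₀) := fun m =>
    ((contDiff_apply ℝ ℝ m).comp
      (by fun_prop : ContDiff ℝ k fun x : (Obs J T X A → ℝ) × State M J d n X A =>
        x.2.1)).contDiffAt
  refine contDiffAt_pi.2 fun c => ContDiffAt.mul ?_ (ContDiffAt.div ((hp _).mul (hl _ _))
    (ContDiffAt.sum fun m _ => (hp _).mul (hl _ _)) ?_)
  · exact ((contDiff_apply ℝ ℝ c.2).comp contDiff_fst).contDiffAt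
  · exact (mixture_pos (truth_mem_stdSimplex hT) fun m =>
      lik_pos (fun e => truth_P_pos hT (m, e)) c.2).ne'

theorem contDiffAt_EstepJ (hT : S.IsTruth s₀) {k : WithTop ℕ∞} (p : Obs J T X A → ℝ) :
    ContDiffAt ℝ k (EstepJ (M := M) (J := J) (d := d) (n := n) (T := T)) (p, s₀) :=
  contDiffAt_pi.2 fun m => ContDiffAt.sum fun z _ => contDiffAt_pi.1 (contDiffAt_wt hT p) (m, z)

theorem exp_lamJ (q : ℕ∞)
    (x : ((Obs J T X A → ℝ) × State M J d n X A) × (Fin M × Fin d → ℝ))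
    (c : Fin M × Obs J T X A) :
    Real.exp (lamJ T S q x c) = lik (blk (S.LamqJ q (x.1.2, x.2)) c.1) c.2 :=
  Real.exp_log (lik_pos (fun _ => S.Lam_pos _ _ _ _) _)

theorem sum_wt_mul_lamJ (q : ℕ∞)
    (x : ((Obs J T X A → ℝ) × State M J d n X A) × (Fin M × Fin d → ℝ)) :
    ∑ c, wt x.1 c * lamJ T S q x c = ∑ m, ∑ z, x.1.1 z * (post x.1.2.1 x.1.2.2.2.2 m z *
      S.logLik q (blk x.1.2.2.1 m) (blk x.1.2.2.2.1 m) (blk x.1.2.2.2.2 m) (blk x.2 m) z) := by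
  rw [Fintype.sum_prod_type]
  refine Finset.sum_congr rfl fun m _ => Finset.sum_congr rfl fun z _ => ?_
  rw [logLik_eq_log_lik, ← mul_assoc]
  rfl

variable [DecidableEq X] [DecidableEq A]

theorem ellE_eq (q : ℕ∞) (θ' θ : Fin M × Fin d → ℝ) (Y : Fin M × Fin n → ℝ)
    (P : Fin M × (Fin J × X × A) → ℝ) (π : Fin M → ℝ) :
    S.ellE T s₀ q θ' θ Y P π = ∑ c, wt (truthLaw T S s₀, (π, θ, Y, P)) c *
      lamJ T S q ((truthLaw T S s₀, (π, θ, Y, P)), θ') c :=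
  (sum_wt_mul_lamJ q ((truthLaw T S s₀, (π, θ, Y, P)), θ')).symm

theorem scoreJ_eq (q : ℕ∞)
    (x : ((Obs J T X A → ℝ) × State M J d n X A) × (Fin M × Fin d → ℝ)) :
    scoreJ T S q x = grad (fun θ => ∑ c, wt x.1 c * lamJ T S q (x.1, θ) c) x.2 := by
  rw [scoreJ, score]

theorem grad_ellE (q : ℕ∞) (θ' θ : Fin M × Fin d → ℝ) (Y : Fin M × Fin n → ℝ)
    (P : Fin M × (Fin J × X × A) → ℝ) (π : Fin M → ℝ) :
    grad (fun θ' => S.ellE T s₀ q θ' θ Y P π) θ' =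
      scoreJ T S q ((truthLaw T S s₀, (π, θ, Y, P)), θ') := by
  rw [scoreJ_eq]
  simp only [ellE_eq]

theorem contDiffAt_lamJ (hT : S.IsTruth s₀) (hF : S.SameFixedPoint) (hR : S.Regular T s₀)
    {q : ℕ∞} (hq : 1 ≤ q) (p : Obs J T X A → ℝ) :
    ContDiffAt ℝ 2 (lamJ (M := M) T S q) ((p, s₀), s₀.2.1) := by
  have h1 : ContDiffAt ℝ 2 (fun x : ((Obs J T X A → ℝ) × State M J d n X A) ×
      (Fin M × Fin d → ℝ) => S.LamqJ q (x.1.2, x.2)) ((p, s₀), s₀.2.1) :=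
    ContDiffAt.comp (g := S.LamqJ q) ((p, s₀), s₀.2.1)
      ((contDiffAt_LamqJ (M := M) hT hF hR hq).of_le (by norm_num))
      (by fun_prop : ContDiff ℝ 2 fun x : ((Obs J T X A → ℝ) × State M J d n X A) ×
        (Fin M × Fin d → ℝ) => (x.1.2, x.2)).contDiffAt
  refine ContDiffAt.comp (g := logLikAll T) ((p, s₀), s₀.2.1) (contDiffAt_logLikAll T ?_) h1
  simp only [LamqJ_truth hT hF hq]
  exact truth_P_pos hT

theorem fderiv_lamJ (hT : S.IsTruth s₀) (hF : S.SameFixedPoint) (hR : S.Regular T s₀)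
    {q : ℕ∞} (hq : 1 ≤ q) (p : Obs J T X A → ℝ)
    (δ : ((Obs J T X A → ℝ) × State M J d n X A) × (Fin M × Fin d → ℝ)) :
    fderiv ℝ (lamJ T S q) ((p, s₀), s₀.2.1) δ =
      fderiv ℝ (logLikAll T) s₀.2.2.2 (fderiv ℝ (S.LamqJ q) (s₀, s₀.2.1) (δ.1.2, δ.2)) := by
  have h0 : HasFDerivAt (fun x : ((Obs J T X A → ℝ) × State M J d n X A) ×
      (Fin M × Fin d → ℝ) => (x.1.2, x.2)) _ ((p, s₀), s₀.2.1) :=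
    (((ContinuousLinearMap.snd ℝ (Obs J T X A → ℝ) (State M J d n X A)).comp
      (ContinuousLinearMap.fst ℝ _ (Fin M × Fin d → ℝ))).prod
      (ContinuousLinearMap.snd ℝ _ _)).hasFDerivAt
  have h1 := HasFDerivAt.comp (g := S.LamqJ q) ((p, s₀), s₀.2.1)
    ((contDiffAt_LamqJ (M := M) hT hF hR hq).differentiableAt (by simp)).hasFDerivAt h0
  have h2 : HasFDerivAt (logLikAll (M := M) (J := J) (X := X) (A := A) T)
      (fderiv ℝ (logLikAll T) s₀.2.2.2) (S.LamqJ q (s₀, s₀.2.1)) := by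
    rw [LamqJ_truth hT hF hq]
    exact ((contDiffAt_logLikAll (k := 1) T (truth_P_pos hT)).differentiableAt
      (by simp)).hasFDerivAt
  have h3 : HasFDerivAt (lamJ T S q) _ ((p, s₀), s₀.2.1) :=
    HasFDerivAt.comp (g := logLikAll T) ((p, s₀), s₀.2.1) h2 h1
  rw [h3.fderiv]
  rfl

/-- Logit probabilities are normalised for all arguments, so total mass one is an identity in the
state and the parameter. This feeds the mean-zero identity of the score. -/
theorem sum_mul_exp_lamJ (hT : S.IsTruth s₀) (hA : Fin J → Nonempty A) (q : ℕ∞)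
    (x : ((Obs J T X A → ℝ) × State M J d n X A) × (Fin M × Fin d → ℝ)) :
    ∑ c : Fin M × Obs J T X A, (s₀.1 c.1 * S.pathProb c.2) * Real.exp (lamJ T S q x c) = 1 := by
  have h := sum_pathProb_mixture (T := T) hT hT.pi_sum
    (Q := fun m => blk (S.LamqJ q (x.1.2, x.2)) m) fun m j x => by
      rw [LamqJ, blk_LamqS]; exact S.Lam_sum hA _ _ _ j x
  rw [← h, Fintype.sum_prod_type, Finset.sum_comm]
  refine Finset.sum_congr rfl fun z _ => ?_
  rw [Finset.mul_sum]
  refine Finset.sum_congr rfl fun m _ => ?_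
  rw [exp_lamJ]
  ring

/-- Correct specification: by Bayes' rule the E-step weights at the truth are the model's own joint
probabilities of type and record. -/
theorem wt_truth (hT : S.IsTruth s₀) (hF : S.SameFixedPoint) {q : ℕ∞} (hq : 1 ≤ q)
    (c : Fin M × Obs J T X A) : wt (truthLaw T S s₀, s₀) c =
      (s₀.1 c.1 * S.pathProb c.2) *
        Real.exp (lamJ T S q ((truthLaw T S s₀, s₀), s₀.2.1) c) := by
  rw [exp_lamJ, LamqJ_truth hT hF hq, ← mixProb_mul_post hT]
  rfl

theorem contDiffAt_scoreJ (hT : S.IsTruth s₀) (hF : S.SameFixedPoint) (hR : S.Regular T s₀)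
    {q : ℕ∞} (hq : 1 ≤ q) :
    ContDiffAt ℝ 1 (scoreJ T S q) ((truthLaw T S s₀, s₀), s₀.2.1) :=
  contDiffAt_score (contDiffAt_lamJ hT hF hR hq _) (contDiffAt_wt hT _)

theorem scoreJ_truth (hT : S.IsTruth s₀) (hA : Fin J → Nonempty A) (hF : S.SameFixedPoint)
    (hR : S.Regular T s₀) {q : ℕ∞} (hq : 1 ≤ q) :
    scoreJ T S q ((truthLaw T S s₀, s₀), s₀.2.1) = 0 :=
  score_eq_zero (contDiffAt_lamJ hT hF hR hq _)
    (Eventually.of_forall fun x => sum_mul_exp_lamJ hT hA q x) (wt_truth hT hF hq)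

/-- This covers the M-step Hessian and all cross derivatives at once. The derivative of the score is
a fixed polynomial in first derivatives of log-likelihoods and of the weights; the weights do not
depend on q. -/
theorem closeTo_fderiv_scoreJ (hT : S.IsTruth s₀) (hA : Fin J → Nonempty A)
    (hF : S.SameFixedPoint) (hR : S.Regular T s₀) {f : ℕ → ℝ} (hE : S.ApproxError s₀ f)
    (δ : ((Obs J T X A → ℝ) × State M J d n X A) × (Fin M × Fin d → ℝ)) (i : Fin M × Fin d) :
    CloseTo f (fun q => fderiv ℝ (scoreJ T S q) ((truthLaw T S s₀, s₀), s₀.2.1) δ i)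
      (fderiv ℝ (scoreJ T S ⊤) ((truthLaw T S s₀, s₀), s₀.2.1) δ i) := by
  classical
  have hlam : ∀ δ c, CloseTo f
      (fun q => fderiv ℝ (lamJ T S q) ((truthLaw T S s₀, s₀), s₀.2.1) δ c)
      (fderiv ℝ (lamJ T S ⊤) ((truthLaw T S s₀, s₀), s₀.2.1) δ c) := by
    intro δ c
    rw [fderiv_lamJ hT hF hR le_top]
    refine (CloseTo.clm (fderiv ℝ (logLikAll T) s₀.2.2.2)
      (fun e => closeTo_fderiv_LamqJ hT hF hR hE (δ.1.2, δ.2) e) c).of_eventuallyEq ?_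
    filter_upwards [eventually_ge_atTop 1] with q hq
    rw [fderiv_lamJ hT hF hR (by exact_mod_cast hq)]
  have hform : ∀ q : ℕ∞, 1 ≤ q →
      fderiv ℝ (scoreJ T S q) ((truthLaw T S s₀, s₀), s₀.2.1) δ i =
      ∑ c, (fderiv ℝ wt (truthLaw T S s₀, s₀) δ.1 c - wt (truthLaw T S s₀, s₀) c *
        fderiv ℝ (lamJ T S q) ((truthLaw T S s₀, s₀), s₀.2.1) δ c) *
        fderiv ℝ (lamJ T S q) ((truthLaw T S s₀, s₀), s₀.2.1) (0, Pi.single i 1) c := by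
    intro q hq
    have h := fderiv_score (contDiffAt_lamJ hT hF hR hq _) (contDiffAt_wt hT _)
      (Eventually.of_forall fun x => sum_mul_exp_lamJ hT hA q x) (wt_truth hT hF hq) δ i
    simp only [← wt_truth hT hF hq] at h
    exact h
  rw [hform ⊤ le_top]
  refine CloseTo.of_eventuallyEq (CloseTo.sum fun c _ => ?_)
    ((eventually_ge_atTop 1).mono fun q hq => hform q (by exact_mod_cast hq))
  exact CloseTo.mul hE.tendsto ((CloseTo.const f _).sub ((hlam δ c).const_mul _)) (hlam _ c)

end ModelScore

end Setup

/-! ### Partial Jacobians -/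

section PartialJac

variable {E : Type*} [NormedAddCommGroup E] [NormedSpace ℝ E] {ι κ : Type*} [Fintype ι]
  [DecidableEq ι] [Fintype κ]

/-- Matrix of the restriction of a derivative along an embedding of coordinates. -/
def partialJac (F' : E →L[ℝ] (κ → ℝ)) (L : (ι → ℝ) →L[ℝ] E) : Matrix κ ι ℝ :=
  LinearMap.toMatrix' (F'.comp L).toLinearMap

theorem partialJac_mulVec (F' : E →L[ℝ] (κ → ℝ)) (L : (ι → ℝ) →L[ℝ] E) (v : ι → ℝ) :
    (partialJac F' L).mulVec v = F' (L v) := by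
  rw [partialJac, LinearMap.toMatrix'_mulVec]
  rfl

theorem jac_comp {f : E → κ → ℝ} {x : E} (hf : DifferentiableAt ℝ f x) {g : (ι → ℝ) → E}
    {g' : (ι → ℝ) →L[ℝ] E} {y : ι → ℝ} (hg : HasFDerivAt g g' y) (hx : g y = x) :
    jac (fun u => f (g u)) y = partialJac (fderiv ℝ f x) g' := by
  subst hx
  have h : HasFDerivAt (fun u => f (g u)) ((fderiv ℝ f (g y)).comp g') y :=
    HasFDerivAt.comp y hf.hasFDerivAt hg
  rw [jac, partialJac, h.fderiv]

theorem MClose.partialJac {f : ℕ → ℝ} {F' : ℕ → E →L[ℝ] (κ → ℝ)} {F₀' : E →L[ℝ] (κ → ℝ)}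
    (h : ∀ δ i, CloseTo f (fun q => F' q δ i) (F₀' δ i)) (L : (ι → ℝ) →L[ℝ] E) :
    MClose f (fun q => EMNPL.partialJac (F' q) L) (EMNPL.partialJac F₀' L) := by
  intro i j
  have e : ∀ F' : E →L[ℝ] (κ → ℝ),
      EMNPL.partialJac F' L i j = F' (L (Pi.single j 1)) i := by
    intro F'
    rw [← partialJac_mulVec, Matrix.mulVec_single_one]
    rfl
  rw [e]
  exact (h _ i).of_eventuallyEq (Eventually.of_forall fun q => e _)

end PartialJac

/-! ### Derivatives of pairs with a constant component -/

section ProdMk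

variable {E F G : Type*} [NormedAddCommGroup E] [NormedSpace ℝ E] [NormedAddCommGroup F]
  [NormedSpace ℝ F] [NormedAddCommGroup G] [NormedSpace ℝ G]

theorem _root_.HasFDerivAt.prodMk_const_right {g : G → E} {g' : G →L[ℝ] E} {y : G}
    (h : HasFDerivAt g g' y) (b : F) :
    HasFDerivAt (fun u => (g u, b)) ((ContinuousLinearMap.inl ℝ E F).comp g') y :=
  HasFDerivAt.comp (g := fun e => (e, b)) y (hasFDerivAt_prodMk_left _ _) h

theorem _root_.HasFDerivAt.prodMk_const_left {g : G → F} {g' : G →L[ℝ] F} {y : G}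
    (h : HasFDerivAt g g' y) (a : E) :
    HasFDerivAt (fun u => (a, g u)) ((ContinuousLinearMap.inr ℝ E F).comp g') y :=
  HasFDerivAt.comp (g := fun e => (a, e)) y (hasFDerivAt_prodMk_right _ _) h

end ProdMk

namespace Setup

/-! ### The rate matrix in terms of first derivatives -/

section Rate

variable {M J d n T : ℕ} [NeZero T] {X A : Type*} [Fintype X] [Fintype A]

/-! ### Coordinate embeddings into the state space -/

section Embeddings

variable (M J d n X A)

/-- Embedding of the type probabilities into the states. -/
def inPi : (Fin M → ℝ) →L[ℝ] State M J d n X A := .inl ℝ _ _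

/-- Embedding of the structural parameters into the states. -/
def inTheta : (Fin M × Fin d → ℝ) →L[ℝ] State M J d n X A :=
  (ContinuousLinearMap.inr ℝ _ _).comp (.inl ℝ _ _)

/-- Embedding of the nuisance vectors into the states. -/
def inY : (Fin M × Fin n → ℝ) →L[ℝ] State M J d n X A :=
  (ContinuousLinearMap.inr ℝ _ _).comp ((ContinuousLinearMap.inr ℝ _ _).comp (.inl ℝ _ _))

/-- Embedding of the CCPs into the states. -/
def inP : (Fin M × (Fin J × X × A) → ℝ) →L[ℝ] State M J d n X A :=
  (ContinuousLinearMap.inr ℝ _ _).comp ((ContinuousLinearMap.inr ℝ _ _).comp (.inr ℝ _ _))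

end Embeddings

theorem hasFDerivAt_setPi (s : State M J d n X A) :
    HasFDerivAt (fun u => ((u, s.2) : State M J d n X A)) (inPi M J d n X A) s.1 :=
  hasFDerivAt_prodMk_left _ _

theorem hasFDerivAt_setTheta (s : State M J d n X A) :
    HasFDerivAt (fun u => ((s.1, u, s.2.2) : State M J d n X A)) (inTheta M J d n X A) s.2.1 :=
  HasFDerivAt.comp (g := fun r => ((s.1, r) : State M J d n X A)) s.2.1
    (hasFDerivAt_prodMk_right _ _) (hasFDerivAt_prodMk_left _ _)

theorem hasFDerivAt_setY (s : State M J d n X A) :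
    HasFDerivAt (fun u => ((s.1, s.2.1, u, s.2.2.2) : State M J d n X A)) (inY M J d n X A)
      s.2.2.1 :=
  HasFDerivAt.comp (g := fun r => ((s.1, r) : State M J d n X A)) s.2.2.1
    (hasFDerivAt_prodMk_right _ _)
    (HasFDerivAt.comp (g := fun r => (s.2.1, r)) s.2.2.1 (hasFDerivAt_prodMk_right _ _)
      (hasFDerivAt_prodMk_left _ _))

theorem hasFDerivAt_setP (s : State M J d n X A) :
    HasFDerivAt (fun u => ((s.1, s.2.1, s.2.2.1, u) : State M J d n X A)) (inP M J d n X A)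
      s.2.2.2 :=
  HasFDerivAt.comp (g := fun r => ((s.1, r) : State M J d n X A)) s.2.2.2
    (hasFDerivAt_prodMk_right _ _)
    (HasFDerivAt.comp (g := fun r => (s.2.1, r)) s.2.2.2 (hasFDerivAt_prodMk_right _ _)
      (hasFDerivAt_prodMk_right _ _))

variable [DecidableEq X] [DecidableEq A]

/-- Rate matrix assembled from the derivatives of the E-step, of the score and of the maps
`Γ` and `Λ`. -/
def rateOf
    (E' : State M J d n X A →L[ℝ] (Fin M → ℝ))
    (D₁ : State M J d n X A →L[ℝ] (Fin M × Fin d → ℝ))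
    (D₂ : (Fin M × Fin d → ℝ) →L[ℝ] (Fin M × Fin d → ℝ))
    (G₁ : State M J d n X A →L[ℝ] (Fin M × Fin n → ℝ))
    (G₂ : (Fin M × Fin d → ℝ) →L[ℝ] (Fin M × Fin n → ℝ))
    (L₁ : State M J d n X A →L[ℝ] (Fin M × (Fin J × X × A) → ℝ))
    (L₂ : (Fin M × Fin d → ℝ) →L[ℝ] (Fin M × (Fin J × X × A) → ℝ)) :
    Matrix (Fin M ⊕ (Fin M × Fin d) ⊕ (Fin M × Fin n) ⊕ (Fin M × (Fin J × X × A)))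
      (Fin M ⊕ (Fin M × Fin d) ⊕ (Fin M × Fin n) ⊕ (Fin M × (Fin J × X × A))) ℝ :=
  let H := (partialJac D₂ (.id ℝ _))⁻¹
  let Hπ := -(H * partialJac D₁ (inPi M J d n X A))
  let Hθ := -(H * partialJac D₁ (inTheta M J d n X A))
  let HY := -(H * partialJac D₁ (inY M J d n X A))
  let HP := -(H * partialJac D₁ (inP M J d n X A))
  let Γθ := partialJac G₂ (.id ℝ _)
  let Λθ := partialJac L₂ (.id ℝ _)
  .fromRows (.fromCols (partialJac E' (inPi M J d n X A))
      (.fromCols 0 (.fromCols 0 (partialJac E' (inP M J d n X A)))))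
    (.fromRows (.fromCols Hπ (.fromCols Hθ (.fromCols HY HP)))
      (.fromRows
        (.fromCols (Γθ * Hπ)
          (.fromCols (Γθ * Hθ + partialJac G₁ (inTheta M J d n X A))
            (.fromCols (Γθ * HY + partialJac G₁ (inY M J d n X A))
              (Γθ * HP + partialJac G₁ (inP M J d n X A)))))
        (.fromCols (Λθ * Hπ)
          (.fromCols (Λθ * Hθ + partialJac L₁ (inTheta M J d n X A))
            (.fromCols (Λθ * HY + partialJac L₁ (inY M J d n X A))
              (Λθ * HP + partialJac L₁ (inP M J d n X A)))))))

variable {S : Setup J d n X A} {s₀ : State M J d n X A}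

/-- Derivative of the E-step in the state. -/
def dE (T : ℕ) [NeZero T] (S : Setup J d n X A) (s₀ : State M J d n X A) :
    State M J d n X A →L[ℝ] (Fin M → ℝ) :=
  (fderiv ℝ (EstepJ (T := T)) (truthLaw T S s₀, s₀)).comp (.inr ℝ _ _)

/-- Derivative of the score in the state. -/
def dScore₁ (T : ℕ) [NeZero T] (S : Setup J d n X A) (s₀ : State M J d n X A) (q : ℕ∞) :
    State M J d n X A →L[ℝ] (Fin M × Fin d → ℝ) :=
  (fderiv ℝ (scoreJ T S q) ((truthLaw T S s₀, s₀), s₀.2.1)).comp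
    ((ContinuousLinearMap.inl ℝ _ _).comp (.inr ℝ _ _))

/-- Derivative of the score in the parameter. -/
def dScore₂ (T : ℕ) [NeZero T] (S : Setup J d n X A) (s₀ : State M J d n X A) (q : ℕ∞) :
    (Fin M × Fin d → ℝ) →L[ℝ] (Fin M × Fin d → ℝ) :=
  (fderiv ℝ (scoreJ T S q) ((truthLaw T S s₀, s₀), s₀.2.1)).comp (.inr ℝ _ _)

theorem hessE_eq (hT : S.IsTruth s₀) (hF : S.SameFixedPoint) (hR : S.Regular T s₀)
    {q : ℕ∞} (hq : 1 ≤ q) :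
    S.hessE T s₀ q = partialJac (dScore₂ T S s₀ q) (.id ℝ _) := by
  rw [hessE, hess]
  simp only [grad_ellE]
  exact jac_comp ((contDiffAt_scoreJ hT hF hR hq).differentiableAt (by simp))
    (hasFDerivAt_prodMk_right _ _) rfl

theorem jac_scoreJ (hT : S.IsTruth s₀) (hF : S.SameFixedPoint) (hR : S.Regular T s₀)
    {q : ℕ∞} (hq : 1 ≤ q) {ι : Type*} [Fintype ι] [DecidableEq ι]
    {g : (ι → ℝ) → State M J d n X A} {g' : (ι → ℝ) →L[ℝ] State M J d n X A} {y : ι → ℝ}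
    (hg : HasFDerivAt g g' y) (hx : g y = s₀) :
    jac (fun u => scoreJ T S q ((truthLaw T S s₀, g u), s₀.2.1)) y =
      partialJac (dScore₁ T S s₀ q) g' := by
  have hS : DifferentiableAt ℝ (scoreJ T S q) ((truthLaw T S s₀, s₀), s₀.2.1) :=
    (contDiffAt_scoreJ hT hF hR hq).differentiableAt (by simp)
  rw [jac_comp hS ((hg.prodMk_const_left (truthLaw T S s₀)).prodMk_const_right s₀.2.1) (by rw [hx])]
  rfl

theorem Hpi_eq (hT : S.IsTruth s₀) (hF : S.SameFixedPoint) (hR : S.Regular T s₀)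
    {q : ℕ∞} (hq : 1 ≤ q) : S.Hpi T s₀ q = -((partialJac (dScore₂ T S s₀ q) (.id ℝ _))⁻¹ *
      partialJac (dScore₁ T S s₀ q) (inPi M J d n X A)) := by
  rw [Hpi, hessE_eq hT hF hR hq, crossHess, ← jac_scoreJ hT hF hR hq (hasFDerivAt_setPi s₀) rfl]
  simp only [grad_ellE]

theorem Hth_eq (hT : S.IsTruth s₀) (hF : S.SameFixedPoint) (hR : S.Regular T s₀)
    {q : ℕ∞} (hq : 1 ≤ q) : S.Hth T s₀ q = -((partialJac (dScore₂ T S s₀ q) (.id ℝ _))⁻¹ *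
      partialJac (dScore₁ T S s₀ q) (inTheta M J d n X A)) := by
  rw [Hth, hessE_eq hT hF hR hq, crossHess, ← jac_scoreJ hT hF hR hq (hasFDerivAt_setTheta s₀) rfl]
  simp only [grad_ellE]

theorem HY_eq (hT : S.IsTruth s₀) (hF : S.SameFixedPoint) (hR : S.Regular T s₀)
    {q : ℕ∞} (hq : 1 ≤ q) : S.HY T s₀ q = -((partialJac (dScore₂ T S s₀ q) (.id ℝ _))⁻¹ *
      partialJac (dScore₁ T S s₀ q) (inY M J d n X A)) := by
  rw [HY, hessE_eq hT hF hR hq, crossHess, ← jac_scoreJ hT hF hR hq (hasFDerivAt_setY s₀) rfl]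
  simp only [grad_ellE]

theorem HP_eq (hT : S.IsTruth s₀) (hF : S.SameFixedPoint) (hR : S.Regular T s₀)
    {q : ℕ∞} (hq : 1 ≤ q) : S.HP T s₀ q = -((partialJac (dScore₂ T S s₀ q) (.id ℝ _))⁻¹ *
      partialJac (dScore₁ T S s₀ q) (inP M J d n X A)) := by
  rw [HP, hessE_eq hT hF hR hq, crossHess, ← jac_scoreJ hT hF hR hq (hasFDerivAt_setP s₀) rfl]
  simp only [grad_ellE]

/-- Each block is the restriction of one total derivative to a coordinate subspace, by the chain
rule along an affine embedding. -/
theorem rateMatrix_eq (hT : S.IsTruth s₀) (hF : S.SameFixedPoint) (hR : S.Regular T s₀)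
    {q : ℕ∞} (hq : 1 ≤ q) :
    S.rateMatrix T s₀ q = rateOf (dE T S s₀) (dScore₁ T S s₀ q) (dScore₂ T S s₀ q)
      ((fderiv ℝ (S.GamJ q) (s₀, s₀.2.1)).comp (.inl ℝ _ _))
      ((fderiv ℝ (S.GamJ q) (s₀, s₀.2.1)).comp (.inr ℝ _ _))
      ((fderiv ℝ (S.LamqJ q) (s₀, s₀.2.1)).comp (.inl ℝ _ _))
      ((fderiv ℝ (S.LamqJ q) (s₀, s₀.2.1)).comp (.inr ℝ _ _)) := by
  have hE : DifferentiableAt ℝ (EstepJ (T := T)) (truthLaw T S s₀, s₀) :=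
    (contDiffAt_EstepJ (k := 1) hT _).differentiableAt (by simp)
  have hG : DifferentiableAt ℝ (S.GamJ q) (s₀, s₀.2.1) :=
    (contDiffAt_GamJ hT hR hq).differentiableAt (by simp)
  have hL : DifferentiableAt ℝ (S.LamqJ q) (s₀, s₀.2.1) :=
    (contDiffAt_LamqJ hT hF hR hq).differentiableAt (by simp)
  have hEπ : jac (fun π => S.Estep T s₀ π s₀.2.2.2) s₀.1 =
      partialJac (dE T S s₀) (inPi M J d n X A) :=
    jac_comp hE ((hasFDerivAt_setPi s₀).prodMk_const_left _) rfl
  have hEP : jac (fun P => S.Estep T s₀ s₀.1 P) s₀.2.2.2 =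
      partialJac (dE T S s₀) (inP M J d n X A) :=
    jac_comp hE ((hasFDerivAt_setP s₀).prodMk_const_left _) rfl
  have hGθ : jac (fun θ' => S.GamS q θ' s₀.2.1 s₀.2.2.2 s₀.2.2.1) s₀.2.1 =
      partialJac ((fderiv ℝ (S.GamJ q) (s₀, s₀.2.1)).comp (.inr ℝ _ _)) (.id ℝ _) :=
    jac_comp hG (hasFDerivAt_prodMk_right _ _) rfl
  have hGt : jac (fun θt' => S.GamS q s₀.2.1 θt' s₀.2.2.2 s₀.2.2.1) s₀.2.1 =
      partialJac ((fderiv ℝ (S.GamJ q) (s₀, s₀.2.1)).comp (.inl ℝ _ _)) (inTheta M J d n X A) :=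
    jac_comp hG ((hasFDerivAt_setTheta s₀).prodMk_const_right _) rfl
  have hGY : jac (fun Y' => S.GamS q s₀.2.1 s₀.2.1 s₀.2.2.2 Y') s₀.2.2.1 =
      partialJac ((fderiv ℝ (S.GamJ q) (s₀, s₀.2.1)).comp (.inl ℝ _ _)) (inY M J d n X A) :=
    jac_comp hG ((hasFDerivAt_setY s₀).prodMk_const_right _) rfl
  have hGP : jac (fun P' => S.GamS q s₀.2.1 s₀.2.1 P' s₀.2.2.1) s₀.2.2.2 =
      partialJac ((fderiv ℝ (S.GamJ q) (s₀, s₀.2.1)).comp (.inl ℝ _ _)) (inP M J d n X A) :=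
    jac_comp hG ((hasFDerivAt_setP s₀).prodMk_const_right _) rfl
  have hLθ : jac (fun θ' => S.LamqS q θ' s₀.2.1 s₀.2.2.1 s₀.2.2.2) s₀.2.1 =
      partialJac ((fderiv ℝ (S.LamqJ q) (s₀, s₀.2.1)).comp (.inr ℝ _ _)) (.id ℝ _) :=
    jac_comp hL (hasFDerivAt_prodMk_right _ _) rfl
  have hLt : jac (fun θt' => S.LamqS q s₀.2.1 θt' s₀.2.2.1 s₀.2.2.2) s₀.2.1 =
      partialJac ((fderiv ℝ (S.LamqJ q) (s₀, s₀.2.1)).comp (.inl ℝ _ _)) (inTheta M J d n X A) :=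
    jac_comp hL ((hasFDerivAt_setTheta s₀).prodMk_const_right _) rfl
  have hLY : jac (fun Y' => S.LamqS q s₀.2.1 s₀.2.1 Y' s₀.2.2.2) s₀.2.2.1 =
      partialJac ((fderiv ℝ (S.LamqJ q) (s₀, s₀.2.1)).comp (.inl ℝ _ _)) (inY M J d n X A) :=
    jac_comp hL ((hasFDerivAt_setY s₀).prodMk_const_right _) rfl
  have hLP : jac (fun P' => S.LamqS q s₀.2.1 s₀.2.1 s₀.2.2.1 P') s₀.2.2.2 =
      partialJac ((fderiv ℝ (S.LamqJ q) (s₀, s₀.2.1)).comp (.inl ℝ _ _)) (inP M J d n X A) :=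
    jac_comp hL ((hasFDerivAt_setP s₀).prodMk_const_right _) rfl
  simp only [rateMatrix, rateOf, hEπ, hEP, Hpi_eq hT hF hR hq,
    Hth_eq hT hF hR hq, HY_eq hT hF hR hq, HP_eq hT hF hR hq, hGθ, hGt, hGY, hGP, hLθ, hLt, hLY,
    hLP]

theorem mclose_sensitivity {f : ℕ → ℝ} (hf : Tendsto f atTop (𝓝 0)) {ι κ : Type*} [Fintype ι]
    [Fintype κ] [DecidableEq ι] [DecidableEq κ] {E : Type*} [NormedAddCommGroup E]
    [NormedSpace ℝ E] {D₁ : ℕ → E →L[ℝ] (κ → ℝ)} {D₂ : ℕ → Matrix κ κ ℝ} {d₁ : E →L[ℝ] (κ → ℝ)}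
    {d₂ : Matrix κ κ ℝ} (hD₁ : ∀ δ i, CloseTo f (fun q => D₁ q δ i) (d₁ δ i))
    (hD₂ : MClose f D₂ d₂) (L : (ι → ℝ) →L[ℝ] E) :
    MClose f (fun q => -(D₂ q * partialJac (D₁ q) L)) (-(d₂ * partialJac d₁ L)) :=
  (hD₂.mul hf (MClose.partialJac hD₁ L)).neg

theorem mclose_rateMatrix (hT : S.IsTruth s₀) (hA : Fin J → Nonempty A) (hF : S.SameFixedPoint)
    (hR : S.Regular T s₀) {f : ℕ → ℝ} (hE : S.ApproxError s₀ f) :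
    MClose f (fun q : ℕ => S.rateMatrix T s₀ q) (S.rateMatrix T s₀ ⊤) := by
  have hf := hE.tendsto
  have hdet : IsUnit (partialJac (dScore₂ T S s₀ ⊤) (.id ℝ _)).det := by
    rw [← hessE_eq hT hF hR le_top]
    exact hR.nonsingular ⊤ le_top
  have hS := closeTo_fderiv_scoreJ (T := T) hT hA hF hR hE
  have hG := closeTo_fderiv_GamJ (T := T) hT hF hR hE
  have hL := closeTo_fderiv_LamqJ (T := T) hT hF hR hE
  have hH := (MClose.partialJac (F' := fun q : ℕ => dScore₂ T S s₀ q)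
    (F₀' := dScore₂ T S s₀ ⊤) (fun δ i => hS _ i) (.id ℝ _)).inv hf hdet
  have hD₁ : ∀ δ i, CloseTo f (fun q : ℕ => dScore₁ T S s₀ q δ i) (dScore₁ T S s₀ ⊤ δ i) :=
    fun δ i => hS _ i
  have hG₁ : ∀ δ i, CloseTo f
      (fun q : ℕ => ((fderiv ℝ (S.GamJ q) (s₀, s₀.2.1)).comp (.inl ℝ _ _)) δ i)
      (((fderiv ℝ (S.GamJ ⊤) (s₀, s₀.2.1)).comp (.inl ℝ _ _)) δ i) := fun δ i => hG _ i
  have hL₁ : ∀ δ i, CloseTo f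
      (fun q : ℕ => ((fderiv ℝ (S.LamqJ q) (s₀, s₀.2.1)).comp (.inl ℝ _ _)) δ i)
      (((fderiv ℝ (S.LamqJ ⊤) (s₀, s₀.2.1)).comp (.inl ℝ _ _)) δ i) := fun δ i => hL _ i
  have hG₂ := MClose.partialJac
    (F' := fun q : ℕ => (fderiv ℝ (S.GamJ q) (s₀, s₀.2.1)).comp (.inr ℝ _ _))
    (F₀' := (fderiv ℝ (S.GamJ ⊤) (s₀, s₀.2.1)).comp (.inr ℝ _ _)) (fun δ i => hG _ i) (.id ℝ _)
  have hL₂ := MClose.partialJac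
    (F' := fun q : ℕ => (fderiv ℝ (S.LamqJ q) (s₀, s₀.2.1)).comp (.inr ℝ _ _))
    (F₀' := (fderiv ℝ (S.LamqJ ⊤) (s₀, s₀.2.1)).comp (.inr ℝ _ _)) (fun δ i => hL _ i) (.id ℝ _)
  have hmain : MClose f (fun q : ℕ => rateOf (dE T S s₀) (dScore₁ T S s₀ q) (dScore₂ T S s₀ q)
      ((fderiv ℝ (S.GamJ q) (s₀, s₀.2.1)).comp (.inl ℝ _ _))
      ((fderiv ℝ (S.GamJ q) (s₀, s₀.2.1)).comp (.inr ℝ _ _))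
      ((fderiv ℝ (S.LamqJ q) (s₀, s₀.2.1)).comp (.inl ℝ _ _))
      ((fderiv ℝ (S.LamqJ q) (s₀, s₀.2.1)).comp (.inr ℝ _ _)))
      (rateOf (dE T S s₀) (dScore₁ T S s₀ ⊤) (dScore₂ T S s₀ ⊤)
      ((fderiv ℝ (S.GamJ ⊤) (s₀, s₀.2.1)).comp (.inl ℝ _ _))
      ((fderiv ℝ (S.GamJ ⊤) (s₀, s₀.2.1)).comp (.inr ℝ _ _))
      ((fderiv ℝ (S.LamqJ ⊤) (s₀, s₀.2.1)).comp (.inl ℝ _ _))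
      ((fderiv ℝ (S.LamqJ ⊤) (s₀, s₀.2.1)).comp (.inr ℝ _ _))) := by
    have hπ := mclose_sensitivity hf hD₁ hH (inPi M J d n X A)
    have hθ := mclose_sensitivity hf hD₁ hH (inTheta M J d n X A)
    have hY := mclose_sensitivity hf hD₁ hH (inY M J d n X A)
    have hP := mclose_sensitivity hf hD₁ hH (inP M J d n X A)
    refine MClose.fromRows (MClose.const f _) (MClose.fromRows ?_ (MClose.fromRows ?_ ?_))
    · exact hπ.fromCols (hθ.fromCols (hY.fromCols hP))
    · exact (hG₂.mul hf hπ).fromCols (((hG₂.mul hf hθ).add (MClose.partialJac hG₁ _)).fromCols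
        (((hG₂.mul hf hY).add (MClose.partialJac hG₁ _)).fromCols
          ((hG₂.mul hf hP).add (MClose.partialJac hG₁ _))))
    · exact (hL₂.mul hf hπ).fromCols (((hL₂.mul hf hθ).add (MClose.partialJac hL₁ _)).fromCols
        (((hL₂.mul hf hY).add (MClose.partialJac hL₁ _)).fromCols
          ((hL₂.mul hf hP).add (MClose.partialJac hL₁ _))))
  -- The expression through first derivatives is available only for q ≥ 1, hence the passage to
  -- eventual equality.
  intro i j
  rw [rateMatrix_eq hT hF hR le_top]
  refine (hmain i j).of_eventuallyEq ?_
  filter_upwards [eventually_ge_atTop 1] with q hq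
  rw [rateMatrix_eq hT hF hR (by exact_mod_cast hq)]

/-- The coordinates of a state. -/
def flat (s : State M J d n X A) :
    Fin M ⊕ (Fin M × Fin d) ⊕ (Fin M × Fin n) ⊕ (Fin M × (Fin J × X × A)) → ℝ :=
  Sum.elim s.1 (Sum.elim s.2.1 (Sum.elim s.2.2.1 s.2.2.2))

theorem apply_add_apply_embeddings {F : Type*} [NormedAddCommGroup F] [NormedSpace ℝ F]
    (L : State M J d n X A →L[ℝ] F) (δ : State M J d n X A) :
    L (inPi M J d n X A δ.1) + (L (inTheta M J d n X A δ.2.1) +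
      (L (inY M J d n X A δ.2.2.1) + L (inP M J d n X A δ.2.2.2))) = L δ := by
  simp only [← map_add]
  congr 1
  simp [inPi, inTheta, inY, inP]

/-- The vector h is the response of the M-step given by the implicit function theorem, so the
right-hand side is the derivative of the composed iteration. The four vanishing hypotheses account
for the blocks absent from the matrix. -/
theorem rateOf_mulVec {E' : State M J d n X A →L[ℝ] (Fin M → ℝ)}
    (hEθ : ∀ v, E' (inTheta M J d n X A v) = 0) (hEY : ∀ v, E' (inY M J d n X A v) = 0)
    (D₁ : State M J d n X A →L[ℝ] (Fin M × Fin d → ℝ))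
    (D₂ : (Fin M × Fin d → ℝ) →L[ℝ] (Fin M × Fin d → ℝ))
    (G₁ : State M J d n X A →L[ℝ] (Fin M × Fin n → ℝ))
    (G₂ : (Fin M × Fin d → ℝ) →L[ℝ] (Fin M × Fin n → ℝ))
    (L₁ : State M J d n X A →L[ℝ] (Fin M × (Fin J × X × A) → ℝ))
    (L₂ : (Fin M × Fin d → ℝ) →L[ℝ] (Fin M × (Fin J × X × A) → ℝ))
    (hGπ : ∀ v, G₁ (inPi M J d n X A v) = 0) (hLπ : ∀ v, L₁ (inPi M J d n X A v) = 0)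
    (δ : State M J d n X A) {h : Fin M × Fin d → ℝ}
    (hh : h = -((partialJac D₂ (.id ℝ _))⁻¹.mulVec (D₁ δ))) :
    (rateOf E' D₁ D₂ G₁ G₂ L₁ L₂).mulVec (flat δ) =
      flat ((E' δ, h, G₂ h + G₁ δ, L₂ h + L₁ δ) : State M J d n X A) := by
  have hh' : h = -((partialJac D₂ (.id ℝ _))⁻¹.mulVec (D₁ (inPi M J d n X A δ.1))) +
      (-((partialJac D₂ (.id ℝ _))⁻¹.mulVec (D₁ (inTheta M J d n X A δ.2.1))) +
      (-((partialJac D₂ (.id ℝ _))⁻¹.mulVec (D₁ (inY M J d n X A δ.2.2.1))) +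
      -((partialJac D₂ (.id ℝ _))⁻¹.mulVec (D₁ (inP M J d n X A δ.2.2.2))))) := by
    rw [hh, ← apply_add_apply_embeddings D₁ δ]
    simp only [Matrix.mulVec_add]
    abel
  rw [hh']
  simp only [rateOf, flat, Matrix.fromRows_mulVec, Matrix.fromCols_mulVec, Sum.elim_comp_inl,
    Sum.elim_comp_inr, Matrix.add_mulVec, Matrix.neg_mulVec, ← Matrix.mulVec_mulVec,
    partialJac_mulVec, Matrix.zero_mulVec, map_add, map_neg, ContinuousLinearMap.id_apply]
  congr 1
  · rw [← apply_add_apply_embeddings E' δ, hEθ, hEY]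
  · congr 1
    congr 1
    · rw [← apply_add_apply_embeddings G₁ δ, hGπ]
      abel
    · rw [← apply_add_apply_embeddings L₁ δ, hLπ]
      abel

end Rate

/-! ### The M-step near the true values -/

section MStep

variable {M J d n T : ℕ} [NeZero T] {X A : Type*} [Fintype X] [Fintype A] [DecidableEq X]
  [DecidableEq A] {S : Setup J d n X A} {s₀ : State M J d n X A}

/-- M-step objective of one type, given the record frequencies and the state. -/
def mObj (S : Setup J d n X A) (q : ℕ∞) (m : Fin M)
    (x : (Obs J T X A → ℝ) × State M J d n X A) (ϑ : Fin d → ℝ) : ℝ :=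
  ∑ z, x.1 z * (post x.2.1 x.2.2.2.2 m z *
    S.logLik q (blk x.2.2.1 m) (blk x.2.2.2.1 m) (blk x.2.2.2.2 m) ϑ z)

/-- Each inner map keeps the nuisance vector in its space, where the choice-specific values are
smooth. -/
theorem continuousOn_logLik (hF : S.SameFixedPoint) (hR : S.Regular T s₀) {q : ℕ∞} (hq : 1 ≤ q)
    (z : Obs J T X A) : ContinuousOn
      (fun p : (Fin d → ℝ) × (Fin d → ℝ) × (Fin J × X × A → ℝ) × (Fin n → ℝ) =>
        S.logLik q p.2.1 p.2.2.2 p.2.2.1 p.1 z) (S.Θ ×ˢ S.Θ ×ˢ S.PSp ×ˢ S.YSp) := by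
  have hv : ContinuousOn
      (fun p : (Fin d → ℝ) × (Fin d → ℝ) × (Fin J × X × A → ℝ) × (Fin n → ℝ) =>
        S.v p.1 (S.Γ q p.1 p.2.1 p.2.2.1 p.2.2.2) p.2.2.1) (S.Θ ×ˢ S.Θ ×ˢ S.PSp ×ˢ S.YSp) := by
    refine hR.smooth_ccp.continuousOn.comp (f := fun p : (Fin d → ℝ) × (Fin d → ℝ) ×
      (Fin J × X × A → ℝ) × (Fin n → ℝ) => (p.1, S.Γ q p.1 p.2.1 p.2.2.1 p.2.2.2, p.2.2.1)) ?_ ?_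
    · exact continuousOn_fst.prodMk ((hR.smooth_inner q hq).continuousOn.prodMk
        (by fun_prop : Continuous _).continuousOn)
    · rintro ⟨θ, θt, P, Y⟩ ⟨h1, h2, h3, h4⟩
      exact ⟨h1, hF.mapsTo q hq θ h1 θt h2 P h3 Y h4, h3⟩
  have hvc := fun c => continuousOn_pi.1 hv c
  refine continuousOn_finsetSum _ fun t _ => continuousOn_finsetSum _ fun j _ => ?_
  refine ContinuousOn.log ?_ fun p _ => (S.Lam_pos _ _ _ _).ne'
  refine ContinuousOn.div (hvc _).rexp (continuousOn_finsetSum _ fun a _ => (hvc _).rexp) ?_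
  exact fun p _ => (Finset.sum_pos (fun _ _ => Real.exp_pos _)
    ⟨(z t).2 j, Finset.mem_univ _⟩).ne'

theorem continuousOn_mObj (hF : S.SameFixedPoint) (hR : S.Regular T s₀) {q : ℕ∞} (hq : 1 ≤ q)
    {m : Fin M} {x : (Obs J T X A → ℝ) × State M J d n X A} (h1 : blk x.2.2.1 m ∈ S.Θ)
    (h2 : blk x.2.2.2.1 m ∈ S.YSp) (h3 : blk x.2.2.2.2 m ∈ S.PSp) :
    ContinuousOn (S.mObj q m x) S.Θ := by
  refine continuousOn_finsetSum _ fun z _ => continuousOn_const.mul (continuousOn_const.mul ?_)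
  exact (continuousOn_logLik hF hR hq z).comp
    (f := fun ϑ => (ϑ, blk x.2.2.1 m, blk x.2.2.2.2 m, blk x.2.2.2.1 m))
    (by fun_prop) fun ϑ hϑ => ⟨hϑ, h1, h3, h2⟩

theorem eventually_mem_domain (hT : S.IsTruth s₀) (p : Obs J T X A → ℝ) (m : Fin M) :
    ∀ᶠ x : (Obs J T X A → ℝ) × State M J d n X A in 𝓝 (p, s₀),
      blk x.2.2.1 m ∈ S.Θ ∧ blk x.2.2.2.1 m ∈ S.YSp ∧ blk x.2.2.2.2 m ∈ S.PSp := by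
  have h1 : Continuous fun x : (Obs J T X A → ℝ) × State M J d n X A => blk x.2.2.1 m :=
    (contDiff_blk (k := 0) m).continuous.comp (by fun_prop)
  have h2 : Continuous fun x : (Obs J T X A → ℝ) × State M J d n X A => blk x.2.2.2.1 m :=
    (contDiff_blk (k := 0) m).continuous.comp (by fun_prop)
  have h3 : Continuous fun x : (Obs J T X A → ℝ) × State M J d n X A => blk x.2.2.2.2 m :=
    (contDiff_blk (k := 0) m).continuous.comp (by fun_prop)
  exact ((h1.tendsto (p, s₀)).eventually (mem_interior_iff_mem_nhds.1 (hT.theta_interior m))).and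
    (((h2.tendsto (p, s₀)).eventually (mem_interior_iff_mem_nhds.1 (hT.Y_interior m))).and
    ((h3.tendsto (p, s₀)).eventually (mem_interior_iff_mem_nhds.1 (hT.P_interior m))))

/-- Joint continuity with ϑ restricted to the parameter space: a competing maximiser may lie on the
boundary, where smoothness holds only from within. -/
theorem tendsto_mObj (hT : S.IsTruth s₀) (hF : S.SameFixedPoint) (hR : S.Regular T s₀) {q : ℕ∞}
    (hq : 1 ≤ q) (p : Obs J T X A → ℝ) (m : Fin M) {ϑ : Fin d → ℝ} (hϑ : ϑ ∈ S.Θ) :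
    Tendsto (fun y : ((Obs J T X A → ℝ) × State M J d n X A) × (Fin d → ℝ) => S.mObj q m y.1 y.2)
      (𝓝 (p, s₀) ×ˢ 𝓝[S.Θ] ϑ) (𝓝 (S.mObj q m (p, s₀) ϑ)) := by
  have hw := (contDiffAt_wt (M := M) (k := 0) hT p).continuousAt
  have hl : ∀ z : Obs J T X A, Tendsto (fun y : ((Obs J T X A → ℝ) × State M J d n X A) × (Fin d → ℝ) =>
      S.logLik q (blk y.1.2.2.1 m) (blk y.1.2.2.2.1 m) (blk y.1.2.2.2.2 m) y.2 z)
      (𝓝 (p, s₀) ×ˢ 𝓝[S.Θ] ϑ)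
      (𝓝 (S.logLik q (blk s₀.2.1 m) (blk s₀.2.2.1 m) (blk s₀.2.2.2 m) ϑ z)) := by
    intro z
    have hc := continuousOn_logLik hF hR hq z (ϑ, blk s₀.2.1 m, blk s₀.2.2.2 m, blk s₀.2.2.1 m)
      ⟨hϑ, interior_subset (hT.theta_interior m), interior_subset (hT.P_interior m),
        interior_subset (hT.Y_interior m)⟩
    refine Tendsto.comp (f := fun y : ((Obs J T X A → ℝ) × State M J d n X A) × (Fin d → ℝ) =>
      (y.2, blk y.1.2.2.1 m, blk y.1.2.2.2.2 m, blk y.1.2.2.2.1 m)) hc ?_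
    refine tendsto_nhdsWithin_iff.2 ⟨?_, ?_⟩
    · have hcont : Continuous fun y : ((Obs J T X A → ℝ) × State M J d n X A) × (Fin d → ℝ) =>
          (y.2, blk y.1.2.2.1 m, blk y.1.2.2.2.2 m, blk y.1.2.2.2.1 m) :=
        continuous_snd.prodMk
          (((contDiff_blk (k := 0) m).continuous.comp (by fun_prop)).prodMk
          (((contDiff_blk (k := 0) m).continuous.comp (by fun_prop)).prodMk
          ((contDiff_blk (k := 0) m).continuous.comp (by fun_prop))))
      refine (hcont.tendsto ((p, s₀), ϑ)).mono_left ?_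
      rw [nhds_prod_eq (x := (p, s₀)) (y := ϑ)]
      exact Filter.prod_mono_right (𝓝 (p, s₀)) (nhdsWithin_le_nhds (a := ϑ) (s := S.Θ))
    · have h1 := (eventually_mem_domain hT p m).prod_inl (𝓝[S.Θ] ϑ)
      have h2 := (eventually_mem_nhdsWithin (a := ϑ) (s := S.Θ)).prod_inr (𝓝 (p, s₀))
      filter_upwards [h1, h2] with y h1 h2
      exact ⟨h2, h1.1, h1.2.2, h1.2.1⟩
  have e : ∀ (x : (Obs J T X A → ℝ) × State M J d n X A) ϑ, S.mObj q m x ϑ = ∑ z, wt x (m, z) *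
      S.logLik q (blk x.2.2.1 m) (blk x.2.2.2.1 m) (blk x.2.2.2.2 m) ϑ z := by
    intro x ϑ
    exact Finset.sum_congr rfl fun z _ => (mul_assoc _ _ _).symm
  simp only [e]
  refine tendsto_finsetSum _ fun z _ => Tendsto.mul ?_ (hl z)
  exact ((tendsto_pi_nhds.1 hw (m, z)).comp tendsto_fst)

theorem eventually_exists_isMaxOn (hT : S.IsTruth s₀) (hF : S.SameFixedPoint)
    (hR : S.Regular T s₀) {q : ℕ∞} (hq : 1 ≤ q) (p : Obs J T X A → ℝ) (m : Fin M) :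
    ∀ᶠ x in 𝓝 (p, s₀), ∃ ϑ ∈ S.Θ, IsMaxOn (S.mObj q m x) S.Θ ϑ := by
  filter_upwards [eventually_mem_domain hT p m] with x hx
  exact hR.compact.exists_isMaxOn ⟨_, interior_subset (hT.theta_interior m)⟩
    (continuousOn_mObj hF hR hq hx.1 hx.2.1 hx.2.2)

/-- Near the true values, all global maximisers of the M-step are close to the true parameter. -/
theorem eventually_isMaxOn_mem (hT : S.IsTruth s₀) (hA : Fin J → Nonempty A)
    (hF : S.SameFixedPoint) (hR : S.Regular T s₀) {q : ℕ∞} (hq : 1 ≤ q) (m : Fin M)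
    {V : Set (Fin d → ℝ)} (hV : V ∈ 𝓝 (blk s₀.2.1 m)) :
    ∀ᶠ x in 𝓝 (truthLaw T S s₀, s₀), ∀ ϑ ∈ S.Θ, IsMaxOn (S.mObj q m x) S.Θ ϑ → ϑ ∈ V := by
  have hθ := interior_subset (hT.theta_interior m)
  have hK : IsCompact (S.Θ \ interior V) := hR.compact.diff isOpen_interior
  have key : ∀ᶠ x in 𝓝 (truthLaw T S s₀, s₀), ∀ ϑ ∈ S.Θ \ interior V,
      S.mObj q m x ϑ < S.mObj q m x (blk s₀.2.1 m) := by
    -- Strict inferiority to the true parameter holds near each single point of the compact set,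
    -- uniformly for nearby data and states; finitely many such neighbourhoods cover it.
    refine hK.induction_on (p := fun t => ∀ᶠ x in 𝓝 (truthLaw T S s₀, s₀), ∀ ϑ ∈ t,
      S.mObj q m x ϑ < S.mObj q m x (blk s₀.2.1 m)) (by simp)
      (fun t t' htt h => h.mono fun x hx ϑ hϑ => hx ϑ (htt hϑ)) (fun t t' h h' => ?_)
      fun ϑ hϑ => ?_
    · filter_upwards [h, h'] with x hx hx' ϑ hϑ
      exact hϑ.elim (hx ϑ) (hx' ϑ)
    · have hlt : S.mObj q m (truthLaw T S s₀, s₀) ϑ <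
          S.mObj q m (truthLaw T S s₀, s₀) (blk s₀.2.1 m) := by
        by_contra! hcon
        have := eq_truth_of_le hT hA hF hR hq m hϑ.1 hcon
        exact hϑ.2 (this ▸ mem_interior_iff_mem_nhds.2 hV)
      have h1 := tendsto_mObj hT hF hR hq (truthLaw T S s₀) m hϑ.1
      have h2 : Tendsto (fun x => S.mObj q m x (blk s₀.2.1 m)) (𝓝 (truthLaw T S s₀, s₀))
          (𝓝 (S.mObj q m (truthLaw T S s₀, s₀) (blk s₀.2.1 m))) :=
        (tendsto_mObj hT hF hR hq (truthLaw T S s₀) m hθ).comp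
          (tendsto_id.prodMk (tendsto_const_nhdsWithin hθ))
      have h3 := h1.eventually_lt (h2.comp tendsto_fst) hlt
      obtain ⟨pa, hpa, pb, hpb, h⟩ := eventually_prod_iff.1 h3
      refine ⟨{ϑ | pb ϑ}, nhdsWithin_mono _ Set.sdiff_subset hpb, ?_⟩
      filter_upwards [hpa] with x hx ϑ hϑ
      exact h hx hϑ
  filter_upwards [key] with x hx ϑ hϑ hmax
  by_contra hcon
  exact absurd (hmax hθ) (not_le.2 (hx ϑ ⟨hϑ, fun h => hcon (interior_subset h)⟩))

/-- The stacked objective is the sum of the objectives of the types, so interior blockwise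
maximisers form a local maximum of the sum. -/
theorem scoreJ_eq_zero_of_isMaxOn {q : ℕ∞} {x : (Obs J T X A → ℝ) × State M J d n X A}
    {θ : Fin M × Fin d → ℝ} (hθ : ∀ m, blk θ m ∈ interior S.Θ)
    (hmax : ∀ m, IsMaxOn (S.mObj q m x) S.Θ (blk θ m)) : scoreJ T S q (x, θ) = 0 := by
  have hloc : IsLocalMax (fun θ' => ∑ c, wt x c * lamJ T S q (x, θ') c) θ := by
    have hnear : ∀ᶠ θ' in 𝓝 θ, ∀ m, blk θ' m ∈ S.Θ := by
      rw [eventually_all]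
      exact fun m => ((contDiff_blk (k := 0) m).continuous.tendsto θ).eventually
        (mem_interior_iff_mem_nhds.1 (hθ m))
    filter_upwards [hnear] with θ' hθ'
    rw [sum_wt_mul_lamJ q (x, θ'), sum_wt_mul_lamJ q (x, θ)]
    exact Finset.sum_le_sum fun m _ => hmax m (hθ' m)
  ext i
  rw [scoreJ_eq]
  simp only [grad]
  rw [hloc.fderiv_eq_zero]
  rfl

end MStep

/-! ### The iteration as a smooth map near the true values -/

section Iteration

variable {M J d n T : ℕ} [NeZero T] {X A : Type*} [Fintype X] [Fintype A] [DecidableEq X]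
  [DecidableEq A] {S : Setup J d n X A} {s₀ : State M J d n X A}

/-- One iteration, with a given selection `ψ` of the M-step maximiser. -/
def iter (S : Setup J d n X A) (q : ℕ∞)
    (ψ : (Obs J T X A → ℝ) × State M J d n X A → Fin M × Fin d → ℝ)
    (x : (Obs J T X A → ℝ) × State M J d n X A) : State M J d n X A :=
  (EstepJ x, ψ x, S.GamJ q (x.2, ψ x), S.LamqJ q (x.2, ψ x))

theorem emStep_iff {q : ℕ∞} (x : (Obs J T X A → ℝ) × State M J d n X A)
    (s' : State M J d n X A) :
    S.EMStep q (fun g : Obs J T X A → ℝ => ∑ z, x.1 z * g z) x.2 s' ↔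
      (∀ m, blk s'.2.1 m ∈ S.Θ ∧ IsMaxOn (S.mObj q m x) S.Θ (blk s'.2.1 m)) ∧
      s' = (EstepJ x, s'.2.1, S.GamJ q (x.2, s'.2.1), S.LamqJ q (x.2, s'.2.1)) := by
  obtain ⟨π', θ', Y', P'⟩ := s'
  constructor
  · rintro ⟨h1, h2, h3, h4⟩
    refine ⟨h2, ?_⟩
    simp only at h1 h3 h4
    subst h3
    subst h4
    simp only [Prod.mk.injEq]
    exact ⟨funext h1, trivial, rfl, rfl⟩
  · rintro ⟨h1, h2⟩
    simp only [Prod.mk.injEq, true_and] at h2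
    obtain ⟨rfl, rfl, rfl⟩ := h2
    exact ⟨fun m => rfl, h1, rfl, rfl⟩

/-- Near the truth every global maximiser is interior and close to the truth, so it is a zero of the
score on the branch ψ. Compactness supplies at least one maximiser; hence ψ is itself the maximiser
and the step is single-valued. -/
theorem eventually_emStep_iff (hT : S.IsTruth s₀) (hA : Fin J → Nonempty A)
    (hF : S.SameFixedPoint) (hR : S.Regular T s₀) {q : ℕ∞} (hq : 1 ≤ q)
    {ψ : (Obs J T X A → ℝ) × State M J d n X A → Fin M × Fin d → ℝ}
    (hψ : ∀ᶠ v in 𝓝 ((truthLaw T S s₀, s₀), s₀.2.1), scoreJ T S q v = 0 → ψ v.1 = v.2) :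
    ∀ᶠ x in 𝓝 (truthLaw T S s₀, s₀), ∀ s',
      S.EMStep q (fun g : Obs J T X A → ℝ => ∑ z, x.1 z * g z) x.2 s' ↔ s' = S.iter q ψ x := by
  rw [nhds_prod_eq] at hψ
  obtain ⟨pa, hpa, pb, hpb, hab⟩ := eventually_prod_iff.1 hψ
  -- The norm on stacked parameters is a maximum over types, so one radius for all blocks places the
  -- stacked maximiser where the score determines it.
  obtain ⟨ε, hε, hball⟩ := Metric.eventually_nhds_iff.1 hpb
  have hloc : ∀ᶠ x in 𝓝 (truthLaw T S s₀, s₀), ∀ m, ∀ ϑ ∈ S.Θ,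
      IsMaxOn (S.mObj q m x) S.Θ ϑ → ϑ ∈ Metric.ball (blk s₀.2.1 m) ε ∩ interior S.Θ := by
    rw [eventually_all]
    exact fun m => eventually_isMaxOn_mem hT hA hF hR hq m (inter_mem (Metric.ball_mem_nhds _ hε)
      (isOpen_interior.mem_nhds (hT.theta_interior m)))
  have hex : ∀ᶠ x in 𝓝 (truthLaw T S s₀, s₀), ∀ m,
      ∃ ϑ ∈ S.Θ, IsMaxOn (S.mObj q m x) S.Θ ϑ := by
    rw [eventually_all]
    exact fun m => eventually_exists_isMaxOn hT hF hR hq _ m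
  filter_upwards [hpa, hloc, hex] with x hx hlocx hexx s'
  have huniq : ∀ θ' : Fin M × Fin d → ℝ,
      (∀ m, blk θ' m ∈ S.Θ ∧ IsMaxOn (S.mObj q m x) S.Θ (blk θ' m)) → ψ x = θ' := by
    intro θ' hθ'
    refine hab hx (hball ?_) (scoreJ_eq_zero_of_isMaxOn
      (fun m => (hlocx m _ (hθ' m).1 (hθ' m).2).2) fun m => (hθ' m).2)
    rw [dist_pi_lt_iff hε]
    intro c
    have h := (hlocx c.1 _ (hθ' c.1).1 (hθ' c.1).2).1
    rw [Metric.mem_ball, dist_pi_lt_iff hε] at h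
    exact h c.2
  rw [emStep_iff]
  constructor
  · rintro ⟨h1, h2⟩
    rw [h2, iter, huniq _ h1]
  · rintro rfl
    choose ϑ hϑ hmax using hexx
    have h := huniq (fun c => ϑ c.1 c.2) fun m => ⟨hϑ m, hmax m⟩
    refine ⟨fun m => ?_, rfl⟩
    change blk (ψ x) m ∈ S.Θ ∧ IsMaxOn (S.mObj q m x) S.Θ (blk (ψ x) m)
    rw [h]
    exact ⟨hϑ m, hmax m⟩

theorem EstepJ_truth (hT : S.IsTruth s₀) (hA : Fin J → Nonempty A) :
    EstepJ (truthLaw T S s₀, s₀) = s₀.1 := by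
  ext m
  have h : ∀ z : Obs J T X A, wt (truthLaw T S s₀, s₀) (m, z) =
      s₀.1 m * (S.pathProb z * lik (blk s₀.2.2.2 m) z) := fun z => by
    rw [← mul_assoc, ← mixProb_mul_post hT]
    rfl
  simp only [EstepJ, h]
  rw [← Finset.mul_sum, sum_pathProb_mul_lik S hT.init_sum hT.trans_sum (truth_P_sum hT hA m),
    mul_one]

theorem iter_truth (hT : S.IsTruth s₀) (hA : Fin J → Nonempty A) (hF : S.SameFixedPoint)
    {q : ℕ∞} (hq : 1 ≤ q) {ψ : (Obs J T X A → ℝ) × State M J d n X A → Fin M × Fin d → ℝ}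
    (hψ : ψ (truthLaw T S s₀, s₀) = s₀.2.1) : S.iter q ψ (truthLaw T S s₀, s₀) = s₀ := by
  rw [iter, hψ, EstepJ_truth hT hA, GamJ_truth hT hF hq, LamqJ_truth hT hF hq]

/-- A derivative vanishes along an embedding that does not change the value. -/
theorem _root_.HasFDerivAt.apply_eq_zero_of_const {E F G : Type*} [NormedAddCommGroup E]
    [NormedSpace ℝ E] [NormedAddCommGroup F] [NormedSpace ℝ F] [NormedAddCommGroup G]
    [NormedSpace ℝ G] {f : E → F} {f' : E →L[ℝ] F} {x : E} (hf : HasFDerivAt f f' x) {g : G → E}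
    {g' : G →L[ℝ] E} {y : G} (hg : HasFDerivAt g g' y) (hx : g y = x)
    (hc : ∀ u, f (g u) = f x) (v : G) : f' (g' v) = 0 := by
  subst hx
  have h1 : HasFDerivAt (fun u => f (g u)) (f'.comp g') y := HasFDerivAt.comp y hf hg
  have h2 : HasFDerivAt (fun u => f (g u)) (0 : G →L[ℝ] F) y := by
    simp only [hc]
    exact hasFDerivAt_const _ _
  exact congrArg (fun L => L v) (h1.unique h2)

/-- This matches the operator inverse in the derivative of an implicit function with the matrix
inverse in the rate matrix. -/
theorem isInvertible_and_inverse {κ : Type*} [Fintype κ] [DecidableEq κ]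
    (L : (κ → ℝ) →L[ℝ] (κ → ℝ)) (h : IsUnit (partialJac L (.id ℝ _)).det) :
    L.IsInvertible ∧ ∀ v, L.inverse v = (partialJac L (.id ℝ _))⁻¹.mulVec v := by
  set B := partialJac L (.id ℝ _) with hB
  have hL : ∀ v, B.mulVec v = L v := fun v => partialJac_mulVec L (.id ℝ _) v
  have h1 : L ∘L LinearMap.toContinuousLinearMap (Matrix.mulVecLin B⁻¹) = .id ℝ _ := by
    ext1 v
    change L (B⁻¹.mulVec v) = v
    rw [← hL, Matrix.mulVec_mulVec, Matrix.mul_nonsing_inv _ h, Matrix.one_mulVec]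
  have h2 : LinearMap.toContinuousLinearMap (Matrix.mulVecLin B⁻¹) ∘L L = .id ℝ _ := by
    ext1 v
    change B⁻¹.mulVec (L v) = v
    rw [← hL, Matrix.mulVec_mulVec, Matrix.nonsing_inv_mul _ h, Matrix.one_mulVec]
  exact ⟨.of_inverse h1 h2, fun v => by rw [ContinuousLinearMap.inverse_eq h1 h2]; rfl⟩

/-- Near the true values the iteration is a map whose state derivative is the rate matrix. -/
theorem exists_strict_iteration (hT : S.IsTruth s₀) (hA : Fin J → Nonempty A)
    (hF : S.SameFixedPoint) (hR : S.Regular T s₀) {q : ℕ∞} (hq : 1 ≤ q) :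
    ∃ (F : (Obs J T X A → ℝ) × State M J d n X A → State M J d n X A)
      (F' : (Obs J T X A → ℝ) × State M J d n X A →L[ℝ] State M J d n X A),
      HasStrictFDerivAt F F' (truthLaw T S s₀, s₀) ∧ F (truthLaw T S s₀, s₀) = s₀ ∧
      (∀ᶠ x in 𝓝 (truthLaw T S s₀, s₀), ∀ s',
        S.EMStep q (fun g : Obs J T X A → ℝ => ∑ z, x.1 z * g z) x.2 s' ↔ s' = F x) ∧
      ∀ δ, flat (F' (0, δ)) = (S.rateMatrix T s₀ q).mulVec (flat δ) := by
  have hS : HasStrictFDerivAt (scoreJ T S q)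
      (fderiv ℝ (scoreJ T S q) ((truthLaw T S s₀, s₀), s₀.2.1))
      ((truthLaw T S s₀, s₀), s₀.2.1) :=
    (contDiffAt_scoreJ hT hF hR hq).hasStrictFDerivAt (by simp)
  have hE : HasStrictFDerivAt (EstepJ (T := T)) (fderiv ℝ EstepJ (truthLaw T S s₀, s₀))
      (truthLaw T S s₀, s₀) :=
    (contDiffAt_EstepJ (k := 1) hT _).hasStrictFDerivAt (by simp)
  have hG : HasStrictFDerivAt (S.GamJ q) (fderiv ℝ (S.GamJ q) (s₀, s₀.2.1)) (s₀, s₀.2.1) :=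
    (contDiffAt_GamJ hT hR hq).hasStrictFDerivAt (by simp)
  have hL : HasStrictFDerivAt (S.LamqJ q) (fderiv ℝ (S.LamqJ q) (s₀, s₀.2.1)) (s₀, s₀.2.1) :=
    (contDiffAt_LamqJ hT hF hR hq).hasStrictFDerivAt (by simp)
  have hdet : IsUnit (partialJac (dScore₂ T S s₀ q) (.id ℝ _)).det := by
    rw [← hessE_eq hT hF hR hq]
    exact hR.nonsingular q hq
  obtain ⟨hinv, hinv'⟩ := isInvertible_and_inverse (dScore₂ T S s₀ q) hdet
  -- The M-step branch solves score = 0 for the parameter; the partial derivative to be inverted is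
  -- the M-step Hessian.
  set ψ := hS.implicitFunctionOfProdDomain hinv
  set ψ' := -(dScore₂ T S s₀ q).inverse ∘L
    (fderiv ℝ (scoreJ T S q) ((truthLaw T S s₀, s₀), s₀.2.1) ∘L .inl ℝ _ _)
  have hψ' : HasStrictFDerivAt ψ ψ' (truthLaw T S s₀, s₀) :=
    hS.hasStrictFDerivAt_implicitFunctionOfProdDomain hinv
  have hev := hS.eventually_apply_eq_iff_implicitFunctionOfProdDomain hinv
  rw [scoreJ_truth hT hA hF hR hq] at hev
  have hψ0 : ψ (truthLaw T S s₀, s₀) = s₀.2.1 :=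
    hev.self_of_nhds.1 (scoreJ_truth hT hA hF hR hq)
  have hpair : HasStrictFDerivAt
      (fun x : (Obs J T X A → ℝ) × State M J d n X A => (x.2, ψ x))
      ((ContinuousLinearMap.snd ℝ _ _).prod ψ') (truthLaw T S s₀, s₀) :=
    hasStrictFDerivAt_snd.prodMk hψ'
  have hG' : HasStrictFDerivAt (fun x => S.GamJ q (x.2, ψ x)) _ (truthLaw T S s₀, s₀) :=
    HasStrictFDerivAt.comp (g := S.GamJ q) (truthLaw T S s₀, s₀)
      (by simp only [hψ0]; exact hG) hpair
  have hL' : HasStrictFDerivAt (fun x => S.LamqJ q (x.2, ψ x)) _ (truthLaw T S s₀, s₀) :=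
    HasStrictFDerivAt.comp (g := S.LamqJ q) (truthLaw T S s₀, s₀)
      (by simp only [hψ0]; exact hL) hpair
  refine ⟨S.iter q ψ, _, hE.prodMk (hψ'.prodMk (hG'.prodMk hL')), iter_truth hT hA hF hq hψ0,
    eventually_emStep_iff hT hA hF hR hq (hev.mono fun v hv => hv.1), fun δ => ?_⟩
  rw [rateMatrix_eq hT hF hR hq, rateOf_mulVec
    (fun v => hE.hasFDerivAt.apply_eq_zero_of_const
      ((hasFDerivAt_setTheta s₀).prodMk_const_left _) rfl (fun _ => rfl) v)
    (fun v => hE.hasFDerivAt.apply_eq_zero_of_const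
      ((hasFDerivAt_setY s₀).prodMk_const_left _) rfl (fun _ => rfl) v)
    _ _ _ _ _ _
    (fun v => hG.hasFDerivAt.apply_eq_zero_of_const
      ((hasFDerivAt_setPi s₀).prodMk_const_right _) rfl (fun _ => rfl) v)
    (fun v => hL.hasFDerivAt.apply_eq_zero_of_const
      ((hasFDerivAt_setPi s₀).prodMk_const_right _) rfl (fun _ => rfl) v)
    δ rfl]
  have hh : ψ' (0, δ) = -((partialJac (dScore₂ T S s₀ q) (.id ℝ _))⁻¹.mulVec
      (dScore₁ T S s₀ q δ)) := by
    rw [← hinv']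
    rfl
  rw [← hh]
  congr 1
  refine Prod.ext rfl (Prod.ext rfl (Prod.ext ?_ ?_))
  · change fderiv ℝ (S.GamJ q) (s₀, s₀.2.1) (δ, ψ' (0, δ)) =
      fderiv ℝ (S.GamJ q) (s₀, s₀.2.1) (0, ψ' (0, δ)) +
        fderiv ℝ (S.GamJ q) (s₀, s₀.2.1) (δ, 0)
    rw [← map_add, Prod.mk_add_mk, zero_add, add_zero]
  · change fderiv ℝ (S.LamqJ q) (s₀, s₀.2.1) (δ, ψ' (0, δ)) =
      fderiv ℝ (S.LamqJ q) (s₀, s₀.2.1) (0, ψ' (0, δ)) +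
        fderiv ℝ (S.LamqJ q) (s₀, s₀.2.1) (δ, 0)
    rw [← map_add, Prod.mk_add_mk, zero_add, add_zero]

end Iteration

/-! ### Local convergence -/

section LocalConvergence

variable {M J d n T : ℕ} [NeZero T] {X A : Type*} [Fintype X] [Fintype A]
  {S : Setup J d n X A} {s₀ : State M J d n X A}

/-- All norms involved are maxima over coordinates, so the norm adapted to the matrix transfers to
states with the same constants. -/
theorem norm_flat (s : State M J d n X A) : ‖flat s‖ = ‖s‖ := by
  refine le_antisymm ((pi_norm_le_iff_of_nonneg (norm_nonneg _)).2 ?_) ?_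
  · have h1 : ‖s.2‖ ≤ ‖s‖ := norm_snd_le s
    have h2 : ‖s.2.2‖ ≤ ‖s‖ := (norm_snd_le s.2).trans h1
    rintro (i | i | i | i)
    · exact (norm_le_pi_norm s.1 i).trans (norm_fst_le s)
    · exact (norm_le_pi_norm s.2.1 i).trans ((norm_fst_le s.2).trans h1)
    · exact (norm_le_pi_norm s.2.2.1 i).trans ((norm_fst_le s.2.2).trans h2)
    · exact (norm_le_pi_norm s.2.2.2 i).trans ((norm_snd_le s.2.2).trans h2)
  · refine max_le ?_ (max_le ?_ (max_le ?_ ?_)) <;>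
      refine (pi_norm_le_iff_of_nonneg (norm_nonneg _)).2 fun i => ?_
    · exact norm_le_pi_norm (flat s) (.inl i)
    · exact norm_le_pi_norm (flat s) (.inr (.inl i))
    · exact norm_le_pi_norm (flat s) (.inr (.inr (.inl i)))
    · exact norm_le_pi_norm (flat s) (.inr (.inr (.inr i)))

/-- `flat` as a linear map. -/
def flatₗ (M J d n : ℕ) (X A : Type*) : State M J d n X A →ₗ[ℝ]
    (Fin M ⊕ (Fin M × Fin d) ⊕ (Fin M × Fin n) ⊕ (Fin M × (Fin J × X × A)) → ℝ) where
  toFun := flat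
  map_add' s t := by ext (i | i | i | i) <;> rfl
  map_smul' c s := by ext (i | i | i | i) <;> rfl

theorem locallyConverges_of_specRad_lt_one [DecidableEq X] [MeasurableSpace X]
    [MeasurableSingletonClass X] [DecidableEq A] [MeasurableSpace A] [MeasurableSingletonClass A]
    {Ω : Type*} [MeasurableSpace Ω] {μ : Measure Ω} [IsProbabilityMeasure μ]
    {obs : ℕ → Ω → Obs J T X A} (hT : S.IsTruth s₀) (hA : Fin J → Nonempty A)
    (hSample : S.IsSample s₀ μ obs) (hF : S.SameFixedPoint) (hR : S.Regular T s₀) {q : ℕ∞}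
    (hq : 1 ≤ q) (hρ : specRad (S.rateMatrix T s₀ q) < 1) : S.LocallyConverges q μ obs s₀ := by
  obtain ⟨F, F', hF', hfix, hstep, hflat⟩ := exists_strict_iteration hT hA hF hR hq
  obtain ⟨V, C, r, hC, hr0, hr1, hlow, hup, hcontr⟩ := exists_contracted_seminorm _ hρ
  obtain ⟨U, hU, h⟩ := exists_local_attractor hF' hfix (V.comp (flatₗ M J d n X A))
    (fun x => (norm_flat x).symm.le.trans (hlow _))
    (fun x => (hup _).trans_eq (congrArg (C * ·) (norm_flat x))) hC hr0 hr1
    (fun x => by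
      change V (flat (F' (0, x))) ≤ r * V (flat x)
      rw [hflat]
      exact hcontr _)
    (fun p s s' => S.EMStep q (fun g : Obs J T X A → ℝ => ∑ z, p z * g z) s s') hstep
  refine ⟨U, hU, ?_⟩
  -- The neighbourhood `U` is already fixed; randomness enters only through the convergence of the
  -- frequencies to the true law.
  filter_upwards [ae_tendsto_empFreq hSample.meas hSample.indep hSample.law] with ω hω
  obtain ⟨shat, hs, hev⟩ := h _ hω
  have he : ∀ N, sampleMean N (fun i => obs i ω) = fun g : Obs J T X A → ℝ =>
      ∑ z, empFreq N (fun i => obs i ω) z * g z := fun N => funext fun g => sampleMean_eq N _ g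
  refine ⟨shat, hs, hev.mono fun N hN => ?_⟩
  simp only [IsRun, he]
  exact hN

end LocalConvergence

end Setup

end EMNPL

end

/-! ### Conclusion -/

theorem mainTheorem5
    {M J T d n : ℕ} [NeZero T]
    {X A : Type*} [Fintype X] [DecidableEq X] [MeasurableSpace X] [MeasurableSingletonClass X]
    [Fintype A] [DecidableEq A] [MeasurableSpace A] [MeasurableSingletonClass A]
    {Ω : Type*} [MeasurableSpace Ω] (μ : Measure Ω) [IsProbabilityMeasure μ]
    (S : EMNPL.Setup J d n X A) (s₀ : EMNPL.State M J d n X A)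
    (obs : ℕ → Ω → EMNPL.Obs J T X A) (f : ℕ → ℝ)
    (hTruth : S.IsTruth s₀)
    (hSample : S.IsSample s₀ μ obs)
    (hFix : S.SameFixedPoint)
    (hReg : S.Regular T s₀)
    (hApprox : S.ApproxError s₀ f)
    (hGrad : S.GradBound s₀)
    (hRho : EMNPL.specRad (S.rateMatrix T s₀ ⊤) < 1) :
    (fun q : ℕ => EMNPL.frob (S.rateMatrix T s₀ q - S.rateMatrix T s₀ ⊤)) =O[atTop] f ∧
    ∃ q₀ : ℕ, ∀ q : ℕ, q₀ ≤ q →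
      EMNPL.specRad (S.rateMatrix T s₀ q) < 1 ∧
      S.LocallyConverges q μ obs s₀ := by
  -- A firm j has an observed action in period 0 of market 0, since the probability space is
  -- nonempty and there is at least one period.
  have hA : Fin J → Nonempty A := fun j => by
    obtain ⟨ω⟩ := MeasureTheory.nonempty_of_isProbabilityMeasure μ
    exact ⟨(obs 0 ω 0).2 j⟩
  have hclose := EMNPL.Setup.mclose_rateMatrix hTruth hA hFix hReg hApprox
  refine ⟨hclose.frob_isBigO, ?_⟩
  obtain ⟨q₀, hq₀⟩ := eventually_atTop.1 (EMNPL.specRad_lt_one_of_tendsto hRho fun i j =>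
    (hclose i j).tendsto hApprox.tendsto)
  -- The assumptions on the inner algorithm start at q = 1.
  refine ⟨max q₀ 1, fun q hq => ?_⟩
  have h1 := hq₀ q ((le_max_left _ _).trans hq)
  refine ⟨h1, EMNPL.Setup.locallyConverges_of_specRad_lt_one hTruth hA hSample hFix hReg ?_ h1⟩
  exact_mod_cast (le_max_right q₀ 1).trans hq
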